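/- Let $d\ge 2$ and $k\ge 1$ be integers with $(d,k)\neq(2,1)$, and let $\mathbf k=(k,\dots,k)\in\mathbb N^{d+1}$ (so the case $\mathbf k=(1,1,1)$ is excluded). Let $M_{\mathbf k}$ be the $(d+1)\times(d+1)$ matrix whose $i$-th row has $k_i+1$ in column $i$, $-k_{i+1}$ in column $i+1$ (indices cyclic modulo $d+1$) and zeros elsewhere. Let $w_i=(d+1)e_i-\sum_j e_j\in\mathbb Z^{d+1}$, $\widetilde w_i=\tfrac1{d+1}w_i$, and let $\mathcal L_{\mathbf k}=\{\sum_i a_iw_i : (a_1,\dots,a_{d+1})=bM_{\mathbf k},\ b\in\mathbb Z^{d+1}\}$ and $\widetilde{\mathcal L}_{\mathbf k}=\tfrac1{d+1}\mathcal L_{\mathbf k}$. Let $\widetilde G_d$ be the infinite graph whose vertices are the points $x\in\mathbb Z^{d+1}$ with $\sum_i x_i=1+\dots+(d+1)$ whose coordinates represent all residues modulo $d+1$, where $x,y$ are adjacent iff $y-x=e_j-e_i$ for some $i\ne j$. The generalized Heawood graph $H_{\mathbf k}$ is the quotient of $\widetilde G_d$ (vertices and edges) by translations by $\mathcal L_{\mathbf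 k}$. Let $V=\{x\in\mathbb R^{d+1}:\sum_i x_i=0\}$, and let $\widetilde{\mathcal C}_d$ be the simplicial complex into which the hyperplanes $\{x\in V: x_j-x_i=n\}$ ($i\neq j$, $n\in\mathbb Z$) decompose $V$. The torus $T_{\mathbf k}$ is the complex of classes of nonempty faces of $\widetilde{\mathcal C}_d$ modulo translations by $\widetilde{\mathcal L}_{\mathbf k}$, where a class is contained in another if this holds for some representatives; its automorphisms are the bijections of its faces preserving containment in both directions. The facet of $\widetilde{\mathcal C}_d$ dual to a vertex $x$ of $\widetilde G_d$ has as its vertices those vertices $v$ of $\widetilde{\mathcal C}_d$ for which $x-(d+1)v$ is a permutation of $(1,\dots,d+1)$; this induces a map from the vertices of $H_{\mathbf k}$ to the facets of $T_{\mathbf k}$. Let $T\le\operatorname{Aut}(H_{\mathbf k})$ be the group generated by the translations $x\mapsto x+w_i$, let $R$ be the automorphism induced by $x\mapsto (d+2)(1,\dots,1)-x$ (which replaces each $w_i$ by $-w_i$), and let $C_{d+1}$ be the cyclic group generated by the automorphism induced by the cyclic shift of coordinates (which sends $w_i$ to $w_{i+1}$). Then the automorphism group of $H_{\mathbf k}$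 coincides with that of $T_{\mathbf k}$: there is a group isomorphism $\Phi:\operatorname{Aut}(T_{\mathbf k})\to\operatorname{Aut}(H_{\mathbf k})$ such that for every $\tau\in\operatorname{Aut}(T_{\mathbf k})$ and every vertex $a$ of $H_{\mathbf k}$, the facet dual to $\Phi(\tau)(a)$ is the image under $\tau$ of the facet dual to $a$. Moreover $\operatorname{Aut}(H_{\mathbf k})$ is generated by $T$, $R$ and $C_{d+1}$, and $$|\operatorname{Aut}(H_{\mathbf k})| = 2(d+1)\det M_{\mathbf k}.$$ -/

import Mathlib

namespace Heawood

/-! ### The infinite graph of the permutahedral tiling -/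

/-- Integer points of the affine subspace `∑ xᵢ = 1 + ⋯ + (d+1)` whose coordinates
contain all the residues modulo `d+1`. -/
@[ext]
structure AffineVertex (d : ℕ) where
  coord : Fin (d + 1) → ℤ
  sum_eq : ∑ i, coord i = ∑ i : Fin (d + 1), ((i : ℤ) + 1)
  residues : Function.Surjective fun i => (coord i : ZMod (d + 1))

/-- `x` and `y` are joined by an edge if `y - x = e_j - e_i` with `i ≠ j`. -/
def affineGraph (d : ℕ) : SimpleGraph (AffineVertex d) where
  Adj x y := ∃ i j : Fin (d + 1), i ≠ j ∧ y.coord - x.coord = Pi.single j 1 - Pi.single i 1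
  symm := ⟨fun x y ⟨i, j, hij, h⟩ => ⟨j, i, hij.symm, by rw [← neg_sub, h, neg_sub]⟩⟩
  loopless := ⟨fun x ⟨i, j, hij, h⟩ => by
    have := congrFun h j
    simp [Pi.single_eq_of_ne hij.symm] at this⟩

/-- The matrix `M_k`; indices are cyclic. -/
def M {d : ℕ} (k : Fin (d + 1) → ℕ) : Matrix (Fin (d + 1)) (Fin (d + 1)) ℤ :=
  fun i j => (if j = i then (k j : ℤ) + 1 else 0) - (if j = i + 1 then (k j : ℤ) else 0)

/-- `w_i = (d+1) e_i - ∑_j e_j`. -/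
def w (d : ℕ) (i : Fin (d + 1)) : Fin (d + 1) → ℤ :=
  ((d : ℤ) + 1) • Pi.single i 1 - ∑ j, Pi.single j 1

/-- The lattice of all `∑ aᵢ wᵢ` with `a = b M_k` for an integer row vector `b`. -/
def sublattice {d : ℕ} (k : Fin (d + 1) → ℕ) : AddSubgroup (Fin (d + 1) → ℤ) where
  carrier := {v | ∃ b : Fin (d + 1) → ℤ, v = ∑ i, Matrix.vecMul b (M k) i • w d i}
  zero_mem' := ⟨0, by simp⟩
  add_mem' := by
    rintro _ _ ⟨b, rfl⟩ ⟨c, rfl⟩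
    exact ⟨b + c, by simp [Matrix.add_vecMul, add_smul, Finset.sum_add_distrib]⟩
  neg_mem' := by
    rintro _ ⟨b, rfl⟩
    exact ⟨-b, by simp [Matrix.neg_vecMul]⟩

/-- `k`-equivalence of vertices: `y = x + v` with `v` in the sublattice. -/
def vertexSetoid {d : ℕ} (k : Fin (d + 1) → ℕ) : Setoid (AffineVertex d) where
  r x y := ∃ v ∈ sublattice k, y.coord = x.coord + v
  iseqv :=
    { refl := fun x => ⟨0, zero_mem _, by simp⟩
      symm := fun ⟨v, hv, h⟩ => ⟨-v, neg_mem hv, by simp [h]⟩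
      trans := fun ⟨v, hv, h⟩ ⟨u, hu, h'⟩ => ⟨v + u, add_mem hv hu, by rw [h', h, add_assoc]⟩ }

/-- The vertices of the generalized Heawood graph. -/
abbrev HeawoodVertex {d : ℕ} (k : Fin (d + 1) → ℕ) : Type := Quotient (vertexSetoid k)

/-- The generalized Heawood graph `H_k`: vertices and edges of the infinite graph up to
translation by vectors of the sublattice. -/
def heawoodGraph {d : ℕ} (k : Fin (d + 1) → ℕ) : SimpleGraph (HeawoodVertex k) where
  Adj a b := a ≠ b ∧ ∃ x y : AffineVertex d, (affineGraph d).Adj x y ∧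
    a = Quotient.mk (vertexSetoid k) x ∧ b = Quotient.mk (vertexSetoid k) y
  symm := ⟨fun _ _ ⟨h, x, y, hxy, hx, hy⟩ => ⟨h.symm, y, x, hxy.symm, hy, hx⟩⟩
  loopless := ⟨fun _ h => h.1 rfl⟩

/-- The automorphism group of `H_k`. -/
abbrev GraphAut {d : ℕ} (k : Fin (d + 1) → ℕ) : Type := heawoodGraph k ≃g heawoodGraph k

/-! ### The automorphisms `T`, `R`, `C` -/

/-- A symmetry of the infinite graph that respects `k`-equivalence induces an automorphism of
`H_k`. -/
def inducedAut {d : ℕ} (k : Fin (d + 1) → ℕ) (e : AffineVertex d ≃ AffineVertex d)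
    (hadj : ∀ x y, (affineGraph d).Adj x y ↔ (affineGraph d).Adj (e x) (e y))
    (heq : ∀ x y, (vertexSetoid k).r x y ↔ (vertexSetoid k).r (e x) (e y)) : GraphAut k where
  toEquiv := Quotient.congr e heq
  map_rel_iff' := by
    intro a b
    refine and_congr (not_congr (Quotient.congr e heq).injective.eq_iff) ⟨?_, ?_⟩
    · rintro ⟨x, y, h, hx, hy⟩
      refine ⟨e.symm x, e.symm y, by rw [hadj]; simpa using h, ?_, ?_⟩
      · exact (Quotient.congr e heq).eq_symm_apply.2 hx
      · exact (Quotient.congr e heq).eq_symm_apply.2 hy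
    · rintro ⟨x, y, h, rfl, rfl⟩
      exact ⟨e x, e y, (hadj x y).1 h, rfl, rfl⟩

theorem w_apply (d : ℕ) (i j : Fin (d + 1)) :
    w d i j = (if j = i then (d : ℤ) + 1 else 0) - 1 := by
  simp [w, Pi.single_apply, Finset.sum_apply]

theorem AffineVertex.residues_add_mul_w {d : ℕ} (x : AffineVertex d) (c : ℤ) (i : Fin (d + 1)) :
    Function.Surjective fun j => (((x.coord + c • w d i) j : ℤ) : ZMod (d + 1)) := by
  intro r
  obtain ⟨j, hj⟩ := x.residues (r + c)
  refine ⟨j, ?_⟩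
  have h0 : ((d : ZMod (d + 1)) + 1) = 0 := by exact_mod_cast ZMod.natCast_self (d + 1)
  have h1 : (d : ZMod (d + 1)) = -1 := eq_neg_of_add_eq_zero_left h0
  have hj' : ((x.coord j : ℤ) : ZMod (d + 1)) = r + c := hj
  simp only [Pi.add_apply, Pi.smul_apply, w_apply]
  split_ifs <;> simp [hj', h1]

/-- Translation by `w_i` on the infinite graph. -/
def affineTranslation (d : ℕ) (i : Fin (d + 1)) : AffineVertex d ≃ AffineVertex d where
  toFun x :=
    { coord := x.coord + w d i
      sum_eq := by simp [Finset.sum_add_distrib, w_apply, x.sum_eq]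
      residues := by simpa using x.residues_add_mul_w 1 i }
  invFun x :=
    { coord := x.coord - w d i
      sum_eq := by simp [Finset.sum_sub_distrib, w_apply, x.sum_eq]
      residues := by simpa [sub_eq_add_neg] using x.residues_add_mul_w (-1) i }
  left_inv x := AffineVertex.ext (by simp)
  right_inv x := AffineVertex.ext (by simp)

/-- Translation of `H_k` by `w_i`. -/
def translation {d : ℕ} (k : Fin (d + 1) → ℕ) (i : Fin (d + 1)) : GraphAut k :=
  inducedAut k (affineTranslation d i)
    (fun x y => by simp [affineGraph, affineTranslation])
    (fun x y => by
      refine exists_congr fun v => and_congr_right fun _ => ?_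
      change _ ↔ y.coord + w d i = x.coord + w d i + v
      rw [add_right_comm, add_left_inj])

/-- The group `T` of translations. -/
def T {d : ℕ} (k : Fin (d + 1) → ℕ) : Subgroup (GraphAut k) :=
  Subgroup.closure (Set.range (translation k))

theorem two_mul_sum_succ (n : ℕ) : 2 * ∑ i : Fin n, ((i : ℤ) + 1) = n * (n + 1) := by
  induction n with
  | zero => simp
  | succ n ih =>
    rw [Fin.sum_univ_castSucc, mul_add]
    simp only [Fin.val_castSucc, Fin.val_last, ih]
    push_cast
    ring

/-- The point reflection `x ↦ (d+2)(1,…,1) - x` in the barycenter of the permutahedron; its linear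
part sends each `w_i` to `-w_i`. -/
def affineReflection (d : ℕ) : AffineVertex d ≃ AffineVertex d :=
  Function.Involutive.toPerm
    (fun x =>
      { coord := fun i => (d : ℤ) + 2 - x.coord i
        sum_eq := by
          have := two_mul_sum_succ (d + 1)
          rw [Finset.sum_sub_distrib, x.sum_eq]
          simp only [Finset.sum_const, Finset.card_univ, Fintype.card_fin, nsmul_eq_mul]
          push_cast at this ⊢
          linarith
        residues := by
          intro r
          obtain ⟨j, hj⟩ := x.residues (d + 2 - r)
          have hj' : ((x.coord j : ℤ) : ZMod (d + 1)) = d + 2 - r := hj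
          exact ⟨j, by simp [hj']⟩ })
    (fun x => AffineVertex.ext (by funext i; simp))

@[simp] theorem affineReflection_coord {d : ℕ} (x : AffineVertex d) (i : Fin (d + 1)) :
    (affineReflection d x).coord i = (d : ℤ) + 2 - x.coord i := rfl

/-- The automorphism `R` of `H_k`. -/
def R {d : ℕ} (k : Fin (d + 1) → ℕ) : GraphAut k :=
  inducedAut k (affineReflection d)
    (fun x y => by
      have key : (affineReflection d y).coord - (affineReflection d x).coord
          = -(y.coord - x.coord) := by
        funext l
        simp
      constructor
      · rintro ⟨i, j, hij, h⟩
        exact ⟨j, i, hij.symm, by rw [key, h, neg_sub]⟩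
      · rintro ⟨i, j, hij, h⟩
        exact ⟨j, i, hij.symm, by rw [← neg_inj, ← key, h, neg_sub]⟩)
    (fun x y => by
      constructor
      · rintro ⟨v, hv, h⟩
        refine ⟨-v, neg_mem hv, ?_⟩
        funext l
        simp [h]
        ring
      · rintro ⟨v, hv, h⟩
        refine ⟨-v, neg_mem hv, ?_⟩
        funext l
        have := congrFun h l
        simp at this ⊢
        linarith)

/-- The cyclic shift of coordinates, `(C x)_{i+1} = x_i`, which sends `w_i` to `w_{i+1}`. -/
def affineRotation (d : ℕ) : AffineVertex d ≃ AffineVertex d where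
  toFun x :=
    { coord := fun i => x.coord (i - 1)
      sum_eq := (Equiv.sum_comp (Equiv.subRight (1 : Fin (d + 1))) x.coord).trans x.sum_eq
      residues := x.residues.comp (Equiv.subRight 1).surjective }
  invFun x :=
    { coord := fun i => x.coord (i + 1)
      sum_eq := (Equiv.sum_comp (Equiv.addRight (1 : Fin (d + 1))) x.coord).trans x.sum_eq
      residues := x.residues.comp (Equiv.addRight 1).surjective }
  left_inv x := AffineVertex.ext (by simp)
  right_inv x := AffineVertex.ext (by simp)

theorem sublattice_const_shift {d k : ℕ} (c : Fin (d + 1)) {v : Fin (d + 1) → ℤ}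
    (hv : v ∈ sublattice (d := d) fun _ => k) :
    (fun i => v (i - c)) ∈ sublattice (d := d) fun _ => k := by
  obtain ⟨b, rfl⟩ := hv
  refine ⟨fun i => b (i - c), ?_⟩
  funext l
  simp only [Finset.sum_apply, Pi.smul_apply, smul_eq_mul]
  rw [← (Equiv.subRight c).sum_comp]
  refine Finset.sum_congr rfl fun i _ => ?_
  congr 1
  · simp only [Matrix.vecMul, dotProduct, Equiv.subRight_apply]
    rw [← (Equiv.subRight c).sum_comp]
    refine Finset.sum_congr rfl fun j _ => ?_
    simp [M, sub_add_eq_add_sub]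
  · simp [w_apply]

/-- The generator of `C_{d+1}` acting on `H_k` for constant `k`. -/
def C (d k : ℕ) : GraphAut (d := d) fun _ => k :=
  inducedAut _ (affineRotation d)
    (fun x y => by
      constructor
      · rintro ⟨i, j, hij, h⟩
        refine ⟨i + 1, j + 1, by simpa using hij, ?_⟩
        funext l
        have := congrFun h (l - 1)
        simpa [affineRotation, Pi.single_apply, sub_eq_iff_eq_add] using this
      · rintro ⟨i, j, hij, h⟩
        refine ⟨i - 1, j - 1, by simpa using hij, ?_⟩
        funext l
        have := congrFun h (l + 1)
        simpa [affineRotation, Pi.single_apply, eq_sub_iff_add_eq] using this)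
    (fun x y => by
      constructor
      · rintro ⟨v, hv, h⟩
        refine ⟨_, sublattice_const_shift 1 hv, ?_⟩
        funext l
        simp [affineRotation, h]
      · rintro ⟨v, hv, h⟩
        refine ⟨_, sublattice_const_shift (-1) hv, ?_⟩
        funext l
        have := congrFun h (l + 1)
        simpa [affineRotation] using this)

/-! ### The triangulated torus -/

/-- `w̃_i = w_i / (d+1)`. -/
noncomputable def wTilde (d : ℕ) (i : Fin (d + 1)) : Fin (d + 1) → ℝ :=
  fun j => (w d i j : ℝ) / (d + 1)

/-- Vertices of the affine Coxeter complex: the points of `V = {∑ xᵢ = 0}` all of whose coordinate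
differences are integers. -/
def affineLattice (d : ℕ) : Set (Fin (d + 1) → ℝ) :=
  {x | ∑ i, x i = 0 ∧ ∀ i j, ∃ n : ℤ, x j - x i = n}

/-- The smallest closed cell of the affine Coxeter arrangement `{x ∈ V : x_j - x_i = n}` that
contains `p`: the intersection of `V` with all closed half-spaces bounded by hyperplanes of the
arrangement that contain `p`. -/
def closedCell {d : ℕ} (p : Fin (d + 1) → ℝ) : Set (Fin (d + 1) → ℝ) :=
  {x | ∑ i, x i = 0 ∧ ∀ (i j : Fin (d + 1)) (n : ℤ), (n : ℝ) ≤ p j - p i → (n : ℝ) ≤ x j - x i}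

/-- The faces of the infinite simplicial complex cut out by the affine Coxeter arrangement of type
`Ã_d` in `V`. Each cell is a simplex, recorded by its set of vertices. -/
@[ext]
structure AffineFace (d : ℕ) where
  verts : Set (Fin (d + 1) → ℝ)
  isFace : ∃ p : Fin (d + 1) → ℝ, ∑ i, p i = 0 ∧ verts = affineLattice d ∩ closedCell p

/-- The lattice of all `∑ aᵢ w̃ᵢ` with `a = b M_k` for an integer row vector `b`. -/
def sublatticeTilde {d : ℕ} (k : Fin (d + 1) → ℕ) : AddSubgroup (Fin (d + 1) → ℝ) where
  carrier := {v | ∃ b : Fin (d + 1) → ℤ, v = ∑ i, Matrix.vecMul b (M k) i • wTilde d i}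
  zero_mem' := ⟨0, by simp⟩
  add_mem' := by
    rintro _ _ ⟨b, rfl⟩ ⟨c, rfl⟩
    exact ⟨b + c, by simp [Matrix.add_vecMul, add_smul, Finset.sum_add_distrib]⟩
  neg_mem' := by
    rintro _ ⟨b, rfl⟩
    exact ⟨-b, by simp [Matrix.neg_vecMul]⟩

/-- `k`-equivalence of faces: `F' = F + v` with `v` in the sublattice. -/
def faceSetoid {d : ℕ} (k : Fin (d + 1) → ℕ) : Setoid (AffineFace d) where
  r F F' := ∃ v ∈ sublatticeTilde k, F'.verts = (fun x => x + v) '' F.verts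
  iseqv :=
    { refl := fun F => ⟨0, zero_mem _, by simp⟩
      symm := fun ⟨v, hv, h⟩ =>
        ⟨-v, neg_mem hv, by rw [h, Set.image_image]; simp only [add_neg_cancel_right, Set.image_id']⟩
      trans := fun ⟨v, hv, h⟩ ⟨u, hu, h'⟩ =>
        ⟨v + u, add_mem hv hu, by rw [h', h, Set.image_image]; simp only [add_assoc]⟩ }

/-- The (nonempty) faces of the triangulated torus `T_k`: classes of faces of the infinite complex
up to translation by the sublattice. -/
def TorusFace {d : ℕ} (k : Fin (d + 1) → ℕ) : Type := Quotient (faceSetoid k)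

/-- A class is contained in another one if some representative of the first is contained in some
representative of the second. -/
instance {d : ℕ} (k : Fin (d + 1) → ℕ) : LE (TorusFace k) where
  le a b := ∃ F F' : AffineFace d, a = Quotient.mk (faceSetoid k) F ∧
    b = Quotient.mk (faceSetoid k) F' ∧ F.verts ⊆ F'.verts

/-- The automorphism group of `T_k`: bijections of its faces that preserve containment in both
directions. -/
abbrev TorusAut {d : ℕ} (k : Fin (d + 1) → ℕ) : Type := TorusFace k ≃o TorusFace k

/-! ### Duality between tiling vertices and facets -/

/-- The vertices `v` of the affine Coxeter complex such that `x` is a vertex of the tile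
`Perm_d + (d+1) v`, where the vertices of `Perm_d` are the permutations of `(1, …, d+1)`. -/
def dualVertices {d : ℕ} (x : AffineVertex d) : Set (Fin (d + 1) → ℝ) :=
  {v | v ∈ affineLattice d ∧ ∃ σ : Equiv.Perm (Fin (d + 1)),
    ∀ i, (x.coord i : ℝ) = ((σ i : ℕ) + 1) + (d + 1) * v i}

theorem dualVertices_isFace {d : ℕ} (x : AffineVertex d) :
    ∃ p : Fin (d + 1) → ℝ, ∑ i, p i = 0 ∧ dualVertices x = affineLattice d ∩ closedCell p := by
  have hd : (0 : ℝ) < d + 1 := by positivity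
  have hsum := two_mul_sum_succ (d + 1)
  have hsumR : 2 * ∑ i, (x.coord i : ℝ) = (d + 1) * (d + 2) := by
    rw [← x.sum_eq] at hsum
    have : ((2 * ∑ i, x.coord i : ℤ) : ℝ) = (((d + 1 : ℕ) : ℤ) * (((d + 1 : ℕ) : ℤ) + 1) : ℤ) := by
      rw [hsum]
    push_cast at this
    rw [this]
    ring
  refine ⟨fun i => (x.coord i - (d + 2) / 2) / (d + 1), ?_, ?_⟩
  · rw [← Finset.sum_div, Finset.sum_sub_distrib]
    simp only [Finset.sum_const, Finset.card_univ, Fintype.card_fin, nsmul_eq_mul]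
    push_cast
    rw [div_eq_zero_iff]
    left
    linarith
  · ext v
    have hp : ∀ i j, ((x.coord j : ℝ) - (d + 2) / 2) / (d + 1) - (x.coord i - (d + 2) / 2) / (d + 1)
        = (x.coord j - x.coord i) / (d + 1) := fun i j => by rw [← sub_div]; ring_nf
    constructor
    · rintro ⟨hv, σ, hσ⟩
      refine ⟨hv, hv.1, fun i j n hn => ?_⟩
      obtain ⟨m, hm⟩ := hv.2 i j
      rw [hp, le_div_iff₀ hd, hσ, hσ] at hn
      rw [hm]
      have hlt : ((σ j : ℕ) : ℝ) < d + 1 := by exact_mod_cast (σ j).2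
      have h0 : (0 : ℝ) ≤ ((σ i : ℕ) : ℝ) := by positivity
      have hvj : v j = v i + m := by linarith
      rw [hvj] at hn
      have h1 : ((n : ℝ) - m - 1) * (d + 1) < 0 := by linarith
      have h2 : (n : ℝ) - m - 1 < 0 := by
        by_contra hcon
        exact absurd h1 (not_lt.2 (mul_nonneg (not_lt.1 hcon) hd.le))
      have h3 : n < m + 1 := by exact_mod_cast (by linarith : (n : ℝ) < m + 1)
      exact_mod_cast Int.lt_add_one_iff.1 h3
    · rintro ⟨hv, -, hcell⟩
      refine ⟨hv, ?_⟩
      -- the point relative to the tile at `v`, and its differences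
      have hdiff : ∀ i j, ∃ m : ℤ, v j - v i = m ∧ |x.coord j - x.coord i - (d + 1) * m| ≤ d := by
        intro i j
        obtain ⟨m, hm⟩ := hv.2 i j
        refine ⟨m, hm, ?_⟩
        have hup : ∀ a b : Fin (d + 1), ∀ c : ℤ, v b - v a = c →
            x.coord b - x.coord a - (d + 1) * c ≤ d := by
          intro a b c hc
          by_contra hcon
          have h1 : ((c : ℤ) + 1) * (d + 1) ≤ x.coord b - x.coord a := by linarith
          have h2 := hcell a b (c + 1) (by
            rw [hp, le_div_iff₀ hd]
            exact_mod_cast h1)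
          rw [hc] at h2
          push_cast at h2
          linarith
        rw [abs_le]
        have h1 := hup i j m hm
        have h2 := hup j i (-m) (by push_cast; linarith)
        constructor <;> linarith
      -- a coordinate at which the relative position is smallest
      obtain ⟨a, -, ha⟩ := Finset.exists_min_image Finset.univ
        (fun i => (x.coord i : ℝ) - (d + 1) * v i) ⟨0, Finset.mem_univ _⟩
      have hτ : ∀ i, ∃ t : Fin (d + 1),
          (x.coord i : ℝ) - (d + 1) * v i = x.coord a - (d + 1) * v a + (t : ℕ) ∧
          ((x.coord i : ℤ) : ZMod (d + 1)) = x.coord a + (t : ℕ) := by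
        intro i
        obtain ⟨m, hm, hle⟩ := hdiff a i
        have h0 : 0 ≤ x.coord i - x.coord a - (d + 1) * m := by
          have := ha i (Finset.mem_univ _)
          have h' : (0 : ℝ) ≤ x.coord i - x.coord a - (d + 1) * m := by
            rw [← hm]; linarith
          exact_mod_cast h'
        obtain ⟨t, ht⟩ := Int.eq_ofNat_of_zero_le h0
        rw [ht, abs_of_nonneg (by positivity)] at hle
        refine ⟨⟨t, by omega⟩, ?_, ?_⟩
        · have h' : (x.coord i : ℝ) - x.coord a - (d + 1) * m = t := by exact_mod_cast ht
          rw [← hm] at h'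
          simp only
          linarith
        · have h' : x.coord i = x.coord a + t + ((d + 1 : ℕ) : ℤ) * m := by push_cast; linarith
          rw [h']
          push_cast
          have hz : ((d : ZMod (d + 1)) + 1) = 0 := by exact_mod_cast ZMod.natCast_self (d + 1)
          rw [hz]
          ring
      choose τ hτ1 hτ2 using hτ
      have hxinj : Function.Injective fun i => ((x.coord i : ℤ) : ZMod (d + 1)) := by
        exact ((Fintype.bijective_iff_surjective_and_card _).2
          ⟨x.residues, by rw [ZMod.card, Fintype.card_fin]⟩).1
      have hτinj : Function.Injective τ := fun i j hij => hxinj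
        ((hτ2 i).trans (Eq.trans (by rw [hij]) (hτ2 j).symm))
      let σ : Equiv.Perm (Fin (d + 1)) :=
        Equiv.ofBijective τ (Finite.injective_iff_bijective.1 hτinj)
      refine ⟨σ, ?_⟩
      have hmin : (x.coord a : ℝ) - (d + 1) * v a = 1 := by
        have hS : ∑ i, ((x.coord i : ℝ) - (d + 1) * v i) =
            ∑ i, ((x.coord a : ℝ) - (d + 1) * v a + ((σ i : ℕ) : ℝ)) :=
          Finset.sum_congr rfl fun i _ => hτ1 i
        rw [Finset.sum_sub_distrib, ← Finset.mul_sum, hv.1, Finset.sum_add_distrib,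
          Equiv.sum_comp σ (fun i : Fin (d + 1) => ((i : ℕ) : ℝ))] at hS
        have hT : 2 * ∑ i : Fin (d + 1), ((i : ℕ) : ℝ) = (d + 1) * d := by
          have h' : ((2 * ∑ i : Fin (d + 1), ((i : ℤ) + 1) : ℤ) : ℝ) =
            (((d + 1 : ℕ) : ℤ) * (((d + 1 : ℕ) : ℤ) + 1) : ℤ) := by rw [two_mul_sum_succ]
          push_cast at h'
          rw [Finset.sum_add_distrib] at h'
          simp at h'
          linarith
        simp only [Finset.sum_const, Finset.card_univ, Fintype.card_fin, nsmul_eq_mul] at hS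
        push_cast at hS
        have hfin : ((d : ℝ) + 1) * ((x.coord a : ℝ) - (d + 1) * v a) = (d + 1) * 1 := by
          linarith
        exact mul_left_cancel₀ hd.ne' hfin
      intro i
      have := hτ1 i
      rw [hmin] at this
      change _ = (((τ i : Fin (d + 1)) : ℕ) : ℝ) + 1 + _
      linarith

/-- The facet of the affine Coxeter complex dual to the tiling vertex `x`. -/
def dualFacet {d : ℕ} (x : AffineVertex d) : AffineFace d :=
  ⟨dualVertices x, dualVertices_isFace x⟩

theorem scaled_mem_sublatticeTilde {d : ℕ} {k : Fin (d + 1) → ℕ} {v : Fin (d + 1) → ℤ}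
    (hv : v ∈ sublattice k) : (fun j => (v j : ℝ) / (d + 1)) ∈ sublatticeTilde k := by
  obtain ⟨b, rfl⟩ := hv
  refine ⟨b, ?_⟩
  funext j
  simp [wTilde, Finset.sum_apply, Finset.sum_div, mul_div_assoc]

theorem sublatticeTilde_subset {d : ℕ} {k : Fin (d + 1) → ℕ} {v : Fin (d + 1) → ℝ}
    (hv : v ∈ sublatticeTilde k) : v ∈ affineLattice d := by
  obtain ⟨b, rfl⟩ := hv
  have hd : (d : ℝ) + 1 ≠ 0 := by positivity
  generalize Matrix.vecMul b (M k) = c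
  have hw : ∀ j, (∑ i, c i • wTilde d i) j = c j - (∑ i, (c i : ℝ)) / (d + 1) := by
    intro j
    have h1 : ∀ i, (c i : ℝ) * wTilde d i j = (if j = i then (c i : ℝ) else 0) - c i / (d + 1) := by
      intro i
      simp only [wTilde, w_apply]
      split_ifs
      · push_cast
        field_simp
      · push_cast
        ring
    have h2 : ∀ i, (c i • wTilde d i) j = (c i : ℝ) * wTilde d i j := fun i => by
      rw [Pi.smul_apply, zsmul_eq_mul]
    rw [Finset.sum_apply, Finset.sum_congr rfl fun i _ => (h2 i).trans (h1 i),
      Finset.sum_sub_distrib, Finset.sum_div]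
    simp
  refine ⟨?_, fun i j => ⟨c j - c i, ?_⟩⟩
  · simp only [hw, Finset.sum_sub_distrib, Finset.sum_const, Finset.card_univ, Fintype.card_fin,
      nsmul_eq_mul]
    push_cast
    field_simp
    ring
  · simp only [hw]
    push_cast
    ring

theorem affineLattice_add {d : ℕ} {u v : Fin (d + 1) → ℝ} (hu : u ∈ affineLattice d)
    (hv : v ∈ affineLattice d) : u + v ∈ affineLattice d := by
  refine ⟨by simp [Finset.sum_add_distrib, hu.1, hv.1], fun i j => ?_⟩
  obtain ⟨m, hm⟩ := hu.2 i j
  obtain ⟨n, hn⟩ := hv.2 i j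
  exact ⟨m + n, by push_cast; rw [← hm, ← hn]; simp only [Pi.add_apply]; ring⟩

theorem dualFacet_equiv {d : ℕ} (k : Fin (d + 1) → ℕ) {x y : AffineVertex d}
    (h : (vertexSetoid k).r x y) : (faceSetoid k).r (dualFacet x) (dualFacet y) := by
  obtain ⟨v, hv, hxy⟩ := h
  have hd : (d : ℝ) + 1 ≠ 0 := by positivity
  have ht := scaled_mem_sublatticeTilde hv
  refine ⟨_, ht, ?_⟩
  ext u
  constructor
  · rintro ⟨hu, σ, hσ⟩
    refine ⟨u + -(fun j => (v j : ℝ) / (d + 1)), ⟨affineLattice_add hu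
      (sublatticeTilde_subset (neg_mem ht)), σ, fun i => ?_⟩, by simp⟩
    have := hσ i
    rw [hxy] at this
    simp only [Pi.add_apply, Pi.neg_apply] at this ⊢
    push_cast at this
    field_simp
    linarith
  · rintro ⟨u, ⟨hu, σ, hσ⟩, rfl⟩
    refine ⟨affineLattice_add hu (sublatticeTilde_subset ht), σ, fun i => ?_⟩
    rw [hxy]
    simp only [Pi.add_apply]
    push_cast
    rw [hσ]
    field_simp
    ring

/-- The facet of `T_k` dual to a vertex of `H_k`. -/
def torusFacet {d : ℕ} (k : Fin (d + 1) → ℕ) : HeawoodVertex k → TorusFace k :=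
  Quotient.map dualFacet fun _ _ h => dualFacet_equiv k h

end Heawood

/-! Each edge of the infinite graph at `x` exchanges two consecutive residues `r`, `r + 1`, so the
edges at a vertex are labelled by `ZMod (d + 1)`, and the squares and hexagons of the graph are the
commutation and braid relations of the affine Weyl group of type Ã_d. The graph `H_k` is a quotient
by a lattice; the proof is a covering argument followed by a rigidity argument.

Arithmetic: with N = (k+1)^(d+1) - k^(d+1), the vector ∑ aᵢ wᵢ lies in the lattice exactly when N
divides ∑ aᵢ (k+1)^i k^(d-i). Hence nonzero lattice vectors are long. Counting separating
hyperplanes then shows that distinct vertices of one class are more than six edges apart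
(`eq_of_wallDist_le`). Only here does the case (2,1) have to be excluded.

Lifting: descent on the squared distance to a root reduces path independence to squares and
hexagons, whose images cannot fail to close up by the previous bound. So every automorphism of `H_k`
lifts to a local isomorphism of the infinite graph (`exists_lift`).

Rigidity: squares and hexagons go to squares and hexagons, so the lift acts on labels in the same
way at every vertex, by a rotation or a reflection of the cycle. The reflection `R` reduces to the
first case, where the lift is a permutation of coordinates followed by a translation; as it
preserves the lattice, the permutation is cyclic (`rotation_of_preserves`). Since k is a unit modulo
N, multiples of w₀ represent all translations modulo the lattice. Every automorphism thus has a
unique normal form (`exists_normalForm`, `normalForm_injective`), which gives generation and order.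

Torus: facets are the maximal faces, vertices the minimal ones, and distinct facets are adjacent
when they share at least d vertices; hence an automorphism of the torus acts on `H_k`. The action is
faithful because a vertex is the only common vertex of a facet and of its opposite at that vertex,
and it is onto because the generators come from affine maps. -/

namespace Heawood

/-! ### Arithmetic of the sublattice -/

/-- The order `(k+1)^(d+1) - k^(d+1)` of the group of translations. -/
def latticeIndex (d k : ℕ) : ℤ := ((k : ℤ) + 1) ^ (d + 1) - (k : ℤ) ^ (d + 1)

/-- The weight of the `m`-th coordinate in the congruence that cuts out the sublattice. -/
def weight (d k : ℕ) (m : Fin (d + 1)) : ℤ := ((k : ℤ) + 1) ^ (m : ℕ) * (k : ℤ) ^ (d - (m : ℕ))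

/-- The functional whose divisibility by `latticeIndex` cuts out the sublattice. -/
def weightedSum {d : ℕ} (k : ℕ) (a : Fin (d + 1) → ℤ) : ℤ := ∑ i, a i * weight d k i

/-- The weights form a geometric progression of ratio (k+1)/k, closed up cyclically modulo N. Since
row m of `M` is (k+1)e_m - k e_{m+1}, this evaluates the weighted functional on the rows. -/
theorem weight_succ (d k : ℕ) (m : Fin (d + 1)) :
    ((k : ℤ) + 1) * weight d k m =
      k * weight d k (m + 1) + if m = Fin.last d then latticeIndex d k else 0 := by
  induction m using Fin.lastCases with
  | last =>
    simp [weight, latticeIndex]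
    ring
  | cast m =>
    rw [if_neg (Fin.castSucc_lt_last m).ne, Fin.coeSucc_eq_succ]
    simp only [weight, Fin.val_castSucc, Fin.val_succ]
    obtain ⟨e, he⟩ := Nat.exists_eq_add_of_lt m.2
    rw [show d - (m : ℕ) = e + 1 by omega, show d - ((m : ℕ) + 1) = e by omega]
    ring

theorem sum_weight (d k : ℕ) : ∑ i, weight d k i = latticeIndex d k := by
  have := geom_sum₂_mul ((k : ℤ) + 1) (k : ℤ) (d + 1)
  rw [latticeIndex, ← this, ← Fin.sum_univ_eq_sum_range
    (fun i => ((k : ℤ) + 1) ^ i * (k : ℤ) ^ (d + 1 - 1 - i))]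
  simp [weight]

theorem weight_pos {d k : ℕ} (hk : 1 ≤ k) (m : Fin (d + 1)) : 0 < weight d k m := by
  unfold weight
  positivity

theorem weight_strictMono {d k : ℕ} (hk : 1 ≤ k) : StrictMono (weight d k) := by
  rw [Fin.strictMono_iff_lt_succ]
  intro i
  have h := weight_succ d k i.castSucc
  rw [if_neg (Fin.castSucc_lt_last i).ne, Fin.coeSucc_eq_succ] at h
  have hp := weight_pos hk i.castSucc
  have hk' : (0 : ℤ) < k := by exact_mod_cast hk
  by_contra hcon
  have := mul_le_mul_of_nonneg_left (not_lt.1 hcon) hk'.le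
  linarith

theorem isCoprime_latticeIndex (d k : ℕ) : IsCoprime (latticeIndex d k) (k : ℤ) := by
  have h1 : IsCoprime (((k : ℤ) + 1) ^ (d + 1)) (k : ℤ) :=
    IsCoprime.pow_left ⟨1, -1, by ring⟩
  have h2 : latticeIndex d k = ((k : ℤ) + 1) ^ (d + 1) + (k : ℤ) * (-(k : ℤ) ^ d) := by
    rw [latticeIndex]; ring
  rw [h2]
  exact IsCoprime.add_mul_left_left h1 _

theorem latticeIndex_pos {d k : ℕ} (hk : 1 ≤ k) : 0 < latticeIndex d k := by
  rw [← sum_weight]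
  exact Finset.sum_pos (fun i _ => weight_pos hk i) Finset.univ_nonempty

theorem weight_lt_latticeIndex {d k : ℕ} (hd : 2 ≤ d) (hk : 1 ≤ k) (m : Fin (d + 1)) :
    weight d k m < latticeIndex d k := by
  have : Nontrivial (Fin (d + 1)) := Fin.nontrivial_iff_two_le.2 (by omega)
  obtain ⟨j, hj⟩ := exists_ne m
  rw [← sum_weight]
  exact Finset.single_lt_sum hj (Finset.mem_univ _) (Finset.mem_univ _) (weight_pos hk j)
    (fun i _ _ => (weight_pos hk i).le)

theorem vecMul_M {d : ℕ} (k : ℕ) (b : Fin (d + 1) → ℤ) (i : Fin (d + 1)) :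
    Matrix.vecMul b (M fun _ => k) i = ((k : ℤ) + 1) * b i - k * b (i - 1) := by
  simp only [Matrix.vecMul, dotProduct, M, mul_sub, Finset.sum_sub_distrib, mul_ite, mul_zero]
  rw [Finset.sum_ite_eq]
  have : ∀ x : Fin (d + 1), (i = x + 1) ↔ (i - 1 = x) := fun x => (sub_eq_iff_eq_add).symm
  simp only [this, Finset.sum_ite_eq, Finset.mem_univ, if_true]
  ring

/-- After reindexing, the contributions of each `b i` cancel by `weight_succ`; only the wrap-around
at the last index survives. -/
theorem weightedSum_vecMul {d : ℕ} (k : ℕ) (b : Fin (d + 1) → ℤ) :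
    weightedSum k (Matrix.vecMul b (M fun _ => k)) = latticeIndex d k * b (Fin.last d) := by
  simp only [weightedSum, vecMul_M, sub_mul, Finset.sum_sub_distrib]
  rw [← Equiv.sum_comp (Equiv.addRight (1 : Fin (d + 1))) fun i => (k : ℤ) * b (i - 1) * weight d k i]
  rw [← Finset.sum_sub_distrib]
  simp only [Equiv.coe_addRight, add_sub_cancel_right]
  have : ∀ i, ((k : ℤ) + 1) * b i * weight d k i - k * b i * weight d k (i + 1) =
      if i = Fin.last d then latticeIndex d k * b i else 0 := by
    intro i
    have := weight_succ d k i
    split_ifs at this ⊢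
    · linear_combination b i * this
    · linear_combination b i * this
  rw [Finset.sum_congr rfl fun i _ => this i]
  simp

/-- The rotated sums are the entries of `a` times the adjugate of `M`. One congruence implies all of
them, which is why a single divisibility suffices to cut out the lattice. -/
theorem latticeIndex_dvd_rotate {d : ℕ} (k : ℕ) {a : Fin (d + 1) → ℤ}
    (h : latticeIndex d k ∣ weightedSum k a) (j : Fin (d + 1)) :
    latticeIndex d k ∣ ∑ l, a l * weight d k (l - j) := by
  induction j using Fin.induction with
  | zero => simpa [weightedSum] using h
  | succ j ih =>
    -- rotating once more multiplies by `k + 1` and divides by `k` modulo the index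
    have key : latticeIndex d k ∣ (((k : ℤ) + 1) * ∑ l, a l * weight d k (l - j.succ)) := by
      rw [Finset.mul_sum]
      have : ∀ l, ((k : ℤ) + 1) * (a l * weight d k (l - j.succ)) =
          k * (a l * weight d k (l - j.castSucc)) +
          latticeIndex d k * (a l * if l - j.succ = Fin.last d then 1 else 0) := by
        intro l
        have h1 := weight_succ d k (l - j.succ)
        have h2 : l - j.succ + 1 = l - j.castSucc := by
          rw [← Fin.coeSucc_eq_succ]; abel
        rw [h2] at h1
        split_ifs at h1 ⊢ <;> linear_combination a l * h1
      rw [Finset.sum_congr rfl fun l _ => this l, Finset.sum_add_distrib, ← Finset.mul_sum,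
        ← Finset.mul_sum]
      exact dvd_add (ih.mul_left _) (dvd_mul_right _ _)
    have hcop : IsCoprime (latticeIndex d k) ((k : ℤ) + 1) := by
      have h1 : IsCoprime (-(k : ℤ) ^ (d + 1)) ((k : ℤ) + 1) :=
        (IsCoprime.pow_left ⟨-1, 1, by ring⟩).neg_left
      have h2 : latticeIndex d k = -(k : ℤ) ^ (d + 1) + ((k : ℤ) + 1) * ((k : ℤ) + 1) ^ d := by
        rw [latticeIndex]; ring
      rw [h2]
      exact IsCoprime.add_mul_left_left h1 _
    exact hcop.dvd_of_dvd_mul_left key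

/-- Cramer's rule: the rotated weighted sums divided by N are the coefficients `b`. -/
theorem exists_vecMul_eq {d k : ℕ} (hk : 1 ≤ k) {a : Fin (d + 1) → ℤ}
    (h : latticeIndex d k ∣ weightedSum k a) :
    ∃ b : Fin (d + 1) → ℤ, Matrix.vecMul b (M fun _ => k) = a := by
  have hrot : ∀ j, ∃ b, ∑ l, a l * weight d k (l - (j + 1)) = latticeIndex d k * b :=
    fun j => latticeIndex_dvd_rotate k h (j + 1)
  choose b hb using hrot
  refine ⟨b, funext fun i => ?_⟩
  have hN := (latticeIndex_pos (d := d) hk).ne'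
  apply mul_left_cancel₀ hN
  rw [vecMul_M]
  have e1 := hb i
  have e2 := hb (i - 1)
  have : latticeIndex d k * (((k : ℤ) + 1) * b i - k * b (i - 1)) =
      ((k : ℤ) + 1) * (latticeIndex d k * b i) - k * (latticeIndex d k * b (i - 1)) := by ring
  rw [this, ← e1, ← e2, Finset.mul_sum, Finset.mul_sum, ← Finset.sum_sub_distrib]
  have : ∀ l, ((k : ℤ) + 1) * (a l * weight d k (l - (i + 1))) -
      k * (a l * weight d k (l - (i - 1 + 1))) =
      if l = i then latticeIndex d k * a l else 0 := by
    intro l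
    have h1 := weight_succ d k (l - (i + 1))
    have h2 : l - (i + 1) + 1 = l - (i - 1 + 1) := by abel
    have h3 : l - (i + 1) = Fin.last d ↔ l = i := by
      have : Fin.last d = -1 := by
        rw [eq_neg_iff_add_eq_zero, Fin.last_add_one]
      rw [this, sub_eq_iff_eq_add]
      constructor
      · rintro rfl; abel
      · rintro rfl; abel
    rw [h2] at h1
    simp only [h3] at h1
    split_ifs at h1 ⊢ <;> linear_combination a l * h1
  rw [Finset.sum_congr rfl fun l _ => this l]
  simp

/-- The vector `∑ aᵢ wᵢ`. -/
def wSum {d : ℕ} (a : Fin (d + 1) → ℤ) : Fin (d + 1) → ℤ :=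
  fun j => ((d : ℤ) + 1) * a j - ∑ i, a i

theorem sum_smul_w {d : ℕ} (a : Fin (d + 1) → ℤ) : ∑ i, a i • w d i = wSum a := by
  funext j
  simp only [Finset.sum_apply, Pi.smul_apply, w_apply, smul_eq_mul, wSum, mul_sub, mul_one,
    Finset.sum_sub_distrib, mul_ite, mul_zero, Finset.sum_ite_eq, Finset.mem_univ, if_true]
  ring

theorem weightedSum_sub {d : ℕ} (k : ℕ) (a b : Fin (d + 1) → ℤ) :
    weightedSum k (a - b) = weightedSum k a - weightedSum k b := by
  simp [weightedSum, sub_mul, Finset.sum_sub_distrib]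

theorem wSum_sub {d : ℕ} (a b : Fin (d + 1) → ℤ) : wSum (a - b) = wSum a - wSum b := by
  funext j
  simp [wSum, Finset.sum_sub_distrib]
  ring

theorem weightedSum_const {d : ℕ} (k : ℕ) (c : ℤ) :
    weightedSum k (fun _ : Fin (d + 1) => c) = c * latticeIndex d k := by
  rw [weightedSum, ← Finset.mul_sum, sum_weight]

theorem wSum_eq_zero_iff {d : ℕ} {a : Fin (d + 1) → ℤ} : wSum a = 0 ↔ ∀ i j, a i = a j := by
  have hd : ((d : ℤ) + 1) ≠ 0 := by positivity
  constructor
  · intro h i j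
    have hi := congrFun h i
    have hj := congrFun h j
    simp only [wSum, Pi.zero_apply] at hi hj
    exact mul_left_cancel₀ hd (by linarith)
  · intro h
    funext j
    simp only [wSum, Pi.zero_apply]
    rw [Finset.sum_congr rfl fun i _ => h i j]
    simp

theorem mem_sublattice_iff {d k : ℕ} (hk : 1 ≤ k) {v : Fin (d + 1) → ℤ} :
    v ∈ sublattice (d := d) (fun _ => k) ↔
      ∃ a, v = wSum a ∧ latticeIndex d k ∣ weightedSum k a := by
  constructor
  · rintro ⟨b, rfl⟩
    exact ⟨_, sum_smul_w _, _, weightedSum_vecMul k b⟩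
  · rintro ⟨a, rfl, h⟩
    obtain ⟨b, hb⟩ := exists_vecMul_eq hk h
    exact ⟨b, by rw [hb, sum_smul_w]⟩

/-- The only relation among the wᵢ is ∑ wᵢ = 0, so `a` is determined up to a constant `c`. This
changes the weighted sum by cN, because the weights add up to N; divisibility is therefore
independent of the choice of `a`. -/
theorem wSum_mem_sublattice_iff {d k : ℕ} (hk : 1 ≤ k) {a : Fin (d + 1) → ℤ} :
    wSum a ∈ sublattice (d := d) (fun _ => k) ↔ latticeIndex d k ∣ weightedSum k a := by
  rw [mem_sublattice_iff hk]
  refine ⟨?_, fun h => ⟨a, rfl, h⟩⟩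
  rintro ⟨b, hb, h⟩
  have h0 : wSum (a - b) = 0 := by rw [wSum_sub, hb, sub_self]
  have h1 : a - b = fun _ => (a - b) 0 := funext fun i => wSum_eq_zero_iff.1 h0 i 0
  have h2 := weightedSum_sub k a b
  rw [h1, weightedSum_const] at h2
  rw [show weightedSum k a = weightedSum k b + (a - b) 0 * latticeIndex d k by linarith]
  exact dvd_add h (dvd_mul_left _ _)

theorem eq_zero_of_weightedSum_eq_zero {d k : ℕ} (hk : 1 ≤ k) {a : Fin (d + 1) → ℤ}
    (ha : ∀ i, |a i| ≤ 1) (h : weightedSum k a = 0) : a = 0 := by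
  by_contra hne
  have hex : ∃ i, a i ≠ 0 := Function.ne_iff.1 hne
  obtain ⟨i, hi, hmin⟩ := WellFounded.has_min (wellFounded_lt (α := Fin (d + 1)))
    {i | a i ≠ 0} hex
  have hmin' : ∀ j < i, a j = 0 := fun j hj => by
    by_contra hj'
    exact hmin j hj' hj
  -- Every weight after the first nonzero index `i` contains at least one more factor k+1 than
  -- `weight d k i`. This forces k+1 to divide `a i`, impossible for `a i` = ±1.
  have hdvd : ((k : ℤ) + 1) ^ ((i : ℕ) + 1) ∣ a i * weight d k i := by
    rw [weightedSum, ← Finset.add_sum_erase _ _ (Finset.mem_univ i)] at h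
    rw [eq_neg_of_add_eq_zero_left h]
    refine (Finset.dvd_sum fun j hj => ?_).neg_right
    rcases lt_or_gt_of_ne (Finset.ne_of_mem_erase hj) with hlt | hlt
    · simp [hmin' j hlt]
    · exact ((pow_dvd_pow _ (by exact_mod_cast hlt)).mul_right _).mul_left _
  have h2 : (k : ℤ) + 1 ∣ a i * (k : ℤ) ^ (d - (i : ℕ)) := by
    have hpos : ((k : ℤ) + 1) ^ (i : ℕ) ≠ 0 := by positivity
    rw [weight, pow_succ, mul_left_comm] at hdvd
    exact (mul_dvd_mul_iff_left hpos).1 hdvd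
  have h3 : (k : ℤ) + 1 ∣ a i :=
    IsCoprime.dvd_of_dvd_mul_right (IsCoprime.pow_right ⟨1, -1, by ring⟩) h2
  have h4 := Int.le_of_dvd (abs_pos.2 hi) ((dvd_abs _ _).2 h3)
  have := ha i
  have hk' : (1 : ℤ) ≤ k := by exact_mod_cast hk
  linarith

/-- Nonzero vectors of the sublattice have two coordinates that differ by at least three. -/
theorem const_of_abs_sub_le_two {d k : ℕ} (hk : 1 ≤ k) {a : Fin (d + 1) → ℤ}
    (h : latticeIndex d k ∣ weightedSum k a) (ha : ∀ i j, |a i - a j| ≤ 2) (i j : Fin (d + 1)) :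
    a i = a j := by
  obtain ⟨l, -, hl⟩ := Finset.exists_min_image Finset.univ a Finset.univ_nonempty
  -- Values within 2 above the minimum become values in [-1, 1] after centring at minimum + 1;
  -- subtracting a constant is harmless modulo N.
  set c : Fin (d + 1) → ℤ := a - fun _ => a l + 1 with hc
  have hc1 : ∀ i, |c i| ≤ 1 := fun i => by
    have h1 := hl i (Finset.mem_univ _)
    have h2 := (abs_le.1 (ha i l)).2
    rw [abs_le]
    simp only [hc, Pi.sub_apply]
    constructor <;> linarith
  have hcd : latticeIndex d k ∣ weightedSum k c := by
    rw [hc, weightedSum_sub, weightedSum_const]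
    exact dvd_sub h (dvd_mul_left _ _)
  suffices hs : c i = c j by simpa [hc] using hs
  by_cases h1 : ∀ i, c i = 1
  · rw [h1, h1]
  by_cases h2 : ∀ i, c i = -1
  · rw [h2, h2]
  push Not at h1 h2
  obtain ⟨p, hp⟩ := h1
  obtain ⟨q, hq⟩ := h2
  -- Apart from the two constant vectors ±1, the weighted sum is strictly smaller in absolute value
  -- than the sum N of all weights, so divisibility by N makes it vanish.
  have hlt : |weightedSum k c| < latticeIndex d k := by
    rw [abs_lt, ← sum_weight, ← Finset.sum_neg_distrib]
    constructor
    · refine Finset.sum_lt_sum (fun i _ => ?_) ⟨q, Finset.mem_univ _, ?_⟩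
      · nlinarith [(abs_le.1 (hc1 i)).1, weight_pos (d := d) hk i]
      · have : -1 < c q := lt_of_le_of_ne (abs_le.1 (hc1 q)).1 hq.symm
        nlinarith [weight_pos (d := d) hk q]
    · refine Finset.sum_lt_sum (fun i _ => ?_) ⟨p, Finset.mem_univ _, ?_⟩
      · nlinarith [(abs_le.1 (hc1 i)).2, weight_pos (d := d) hk i]
      · have : c p < 1 := lt_of_le_of_ne (abs_le.1 (hc1 p)).2 hp
        nlinarith [weight_pos (d := d) hk p]
  have h0 := eq_zero_of_weightedSum_eq_zero hk hc1 (Int.eq_zero_of_abs_lt_dvd hcd hlt)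
  rw [h0]; rfl

/-- For d = 2, `M` multiplies the quadratic form of squared differences by N = 3k² + 3k + 1, as an
Eisenstein integer of norm N would. Three differences bounded by 3 with sum zero have squares adding
up to at most 18, while N ≥ 19 for k ≥ 2. For k = 1 one has N = 7 and this comparison is lost. -/
theorem const_of_abs_sub_le_three {k : ℕ} (hk : 2 ≤ k) {a : Fin (2 + 1) → ℤ}
    (h : latticeIndex 2 k ∣ weightedSum k a) (ha : ∀ i j, |a i - a j| ≤ 3) (i j : Fin (2 + 1)) :
    a i = a j := by
  obtain ⟨b, rfl⟩ := exists_vecMul_eq (by omega) h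
  set a := Matrix.vecMul b (M fun _ => k) with hadef
  have h0 : a 0 = ((k : ℤ) + 1) * b 0 - k * b 2 := vecMul_M k b 0
  have h1 : a 1 = ((k : ℤ) + 1) * b 1 - k * b 0 := vecMul_M k b 1
  have h2 : a 2 = ((k : ℤ) + 1) * b 2 - k * b 1 := vecMul_M k b 2
  have hk' : (2 : ℤ) ≤ k := by exact_mod_cast hk
  have norm : (a 0 - a 1) ^ 2 + (a 1 - a 2) ^ 2 + (a 2 - a 0) ^ 2 = (3 * k ^ 2 + 3 * k + 1) *
      ((b 0 - b 1) ^ 2 + (b 1 - b 2) ^ 2 + (b 2 - b 0) ^ 2) := by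
    rw [h0, h1, h2]; ring
  have hsum : (a 0 - a 1) + (a 1 - a 2) + (a 2 - a 0) = 0 := by ring
  have hle : (a 0 - a 1) ^ 2 + (a 1 - a 2) ^ 2 + (a 2 - a 0) ^ 2 ≤ 18 := by
    have e1 := abs_le.1 (ha 0 1)
    have e2 := abs_le.1 (ha 1 2)
    have e3 := abs_le.1 (ha 2 0)
    clear norm hadef h0 h1 h2
    generalize a 0 - a 1 = x at *
    generalize a 1 - a 2 = y at *
    generalize a 2 - a 0 = z at *
    obtain rfl : z = -x - y := by linarith
    obtain ⟨x1, x2⟩ := e1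
    obtain ⟨y1, y2⟩ := e2
    obtain ⟨z1, z2⟩ := e3
    interval_cases x <;> interval_cases y <;> first | (exfalso; omega) | norm_num
  have hz : (b 0 - b 1) ^ 2 + (b 1 - b 2) ^ 2 + (b 2 - b 0) ^ 2 ≤ 0 := by
    by_contra hcon
    nlinarith
  have hb01 : b 0 = b 1 := by nlinarith [sq_nonneg (b 0 - b 1), sq_nonneg (b 1 - b 2), sq_nonneg (b 2 - b 0)]
  have hb12 : b 1 = b 2 := by nlinarith [sq_nonneg (b 0 - b 1), sq_nonneg (b 1 - b 2), sq_nonneg (b 2 - b 0)]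
  have hall : ∀ i, a i = b 2 := by
    intro i
    fin_cases i
    · change a 0 = _; rw [h0, hb01, hb12]; ring
    · change a 1 = _; rw [h1, hb01, hb12]; ring
    · change a 2 = _; rw [h2, hb12]; ring
  rw [hall, hall]

/-- Expansion along the first column, whose only nonzero positions are the first and the last row.
The two minors are triangular, with diagonal entries k+1 and -k respectively. -/
theorem det_M (d k : ℕ) : (M (d := d) fun _ => k).det = latticeIndex d k := by
  cases d with
  | zero => simp [M, latticeIndex]
  | succ d =>
    have hupper : ((M (d := d + 1) fun _ => k).submatrix Fin.succ Fin.succ).det =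
        ((k : ℤ) + 1) ^ (d + 1) := by
      have hne : ∀ i j : Fin (d + 1), j ≤ i → j.succ ≠ i.succ + 1 := by
        intro i j hji h
        have := congrArg Fin.val h
        rw [Fin.val_add_one] at this
        have hji' : (j : ℕ) ≤ i := hji
        split_ifs at this <;> simp at this
        omega
      rw [Matrix.det_of_isUpperTriangular]
      · simp [M, hne]
      · intro i j hij
        simp [M, hne i j (le_of_lt hij), (show j < i from hij).ne]
    have hlower : ((M (d := d + 1) fun _ => k).submatrix Fin.castSucc Fin.succ).det =
        (-(k : ℤ)) ^ (d + 1) := by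
      have hne : ∀ i j : Fin (d + 1), i ≤ j → j.succ ≠ i.castSucc := by
        intro i j hji h
        have := congrArg Fin.val h
        have hji' : (i : ℕ) ≤ j := hji
        simp at this
        omega
      rw [Matrix.det_of_isLowerTriangular]
      · simp [M, hne, -Fin.castSucc_inj]
      · intro i j hij
        have : i < j := hij
        simp [M, hne i j this.le, this.ne', -Fin.castSucc_inj]
    rw [Matrix.det_succ_column_zero, Fin.sum_univ_succ, Fin.sum_univ_castSucc,
      Finset.sum_eq_zero]
    · have h1 : (M (d := d + 1) fun _ => k) 0 0 = (k : ℤ) + 1 := by simp [M]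
      have h2 : (M (d := d + 1) fun _ => k) (Fin.last d).succ 0 = -(k : ℤ) := by
        simp [M]
      rw [h1, h2, Fin.succ_last, Fin.succAbove_last, Fin.succAbove_zero, hupper, hlower]
      have h3 : ((-1 : ℤ)) ^ (d + 1) * (-1) ^ (d + 1) = 1 := by rw [← mul_pow]; simp
      simp only [Fin.val_zero, pow_zero, Fin.val_last, latticeIndex, neg_pow (k : ℤ), Nat.succ_eq_add_one]
      linear_combination (-(k : ℤ) ^ (d + 2)) * h3
    · intro i _
      have : (M (d := d + 1) fun _ => k) i.castSucc.succ 0 = 0 := by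
        have h : i.castSucc.succ + 1 ≠ (0 : Fin (d + 2)) := by
          rw [← Fin.castSucc_succ, Fin.coeSucc_eq_succ]
          exact Fin.succ_ne_zero _
        simp [M, h.symm, (Fin.succ_ne_zero i.castSucc).symm]
      simp [this]

/-- A permutation of the coordinates that preserves the sublattice is a rotation. -/
theorem rotation_of_preserves {d k : ℕ} (hd : 2 ≤ d) (hk : 1 ≤ k)
    (π : Equiv.Perm (Fin (d + 1)))
    (h : ∀ a, latticeIndex d k ∣ weightedSum k a → latticeIndex d k ∣ weightedSum k (a ∘ π.symm)) :
    ∀ i, π i = i + π 0 := by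
  -- The permuted row `i` of `M` is still in the lattice. Comparison with the row `π i` gives
  -- k·weight(π i + 1) ≡ k·weight(π (i + 1)) modulo N. As k is a unit and the weights are distinct
  -- numbers between 0 and N, the two indices agree.
  have hstep : ∀ i, π (i + 1) = π i + 1 := by
    intro i
    have hw : ∀ j, weightedSum k (Pi.single j 1) = weight d k j := fun j => by
      simp [weightedSum, Pi.single_apply]
    have hcomb : ∀ p q : Fin (d + 1), ∀ s t : ℤ,
        weightedSum k (fun l => s * (Pi.single p 1 : Fin (d + 1) → ℤ) l -
          t * (Pi.single q 1 : Fin (d + 1) → ℤ) l) = s * weight d k p - t * weight d k q := by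
      intro p q s t
      rw [← hw p, ← hw q]
      simp only [weightedSum, sub_mul, Finset.sum_sub_distrib, mul_assoc, Finset.mul_sum]
    have hrow : ∀ j : Fin (d + 1), latticeIndex d k ∣
        ((k : ℤ) + 1) * weight d k j - k * weight d k (j + 1) := fun j => by
      rw [weight_succ]
      split_ifs <;> simp
    have h1 := h _ (by rw [hcomb]; exact hrow i)
    have h2 : ∀ p, (fun l => ((k : ℤ) + 1) * (Pi.single i 1 : Fin (d + 1) → ℤ) l -
        k * (Pi.single (i + 1) 1 : Fin (d + 1) → ℤ) l) (π.symm p) =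
        ((k : ℤ) + 1) * (Pi.single (π i) 1 : Fin (d + 1) → ℤ) p -
        k * (Pi.single (π (i + 1)) 1 : Fin (d + 1) → ℤ) p := fun p => by
      simp [Pi.single_apply, Equiv.symm_apply_eq]
    rw [show (fun l => ((k : ℤ) + 1) * (Pi.single i 1 : Fin (d + 1) → ℤ) l -
        k * (Pi.single (i + 1) 1 : Fin (d + 1) → ℤ) l) ∘ π.symm = _ from funext h2, hcomb] at h1
    have h3 := dvd_sub h1 (hrow (π i))
    have h4 : latticeIndex d k ∣ k * (weight d k (π i + 1) - weight d k (π (i + 1))) := by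
      obtain ⟨c, hc⟩ := h3
      exact ⟨c, by linear_combination hc⟩
    have h5 := (isCoprime_latticeIndex d k).dvd_of_dvd_mul_left h4
    have h6 : |weight d k (π i + 1) - weight d k (π (i + 1))| < latticeIndex d k := by
      have := weight_pos (d := d) hk
      have h' := weight_lt_latticeIndex hd hk
      rw [abs_lt]
      constructor <;> linarith [this (π i + 1), this (π (i + 1)), h' (π i + 1), h' (π (i + 1))]
    have h7 := Int.eq_zero_of_abs_lt_dvd h5 h6
    exact ((weight_strictMono hk).injective (sub_eq_zero.1 h7)).symm
  intro i
  induction i using Fin.induction with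
  | zero => simp
  | succ j ih => rw [← Fin.coeSucc_eq_succ, hstep, ih]; exact add_right_comm _ _ _


/-! ### The infinite graph: positions of residues and moves -/

section Moves

variable {d : ℕ}

theorem AffineVertex.residues_bijective (x : AffineVertex d) :
    Function.Bijective fun i => (x.coord i : ZMod (d + 1)) :=
  (Fintype.bijective_iff_surjective_and_card _).2
    ⟨x.residues, by rw [ZMod.card, Fintype.card_fin]⟩

/-- The coordinate of `x` with residue `r`. -/
noncomputable def AffineVertex.pos (x : AffineVertex d) : ZMod (d + 1) ≃ Fin (d + 1) :=
  (Equiv.ofBijective _ x.residues_bijective).symm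

theorem AffineVertex.coord_pos (x : AffineVertex d) (r : ZMod (d + 1)) :
    ((x.coord (x.pos r) : ℤ) : ZMod (d + 1)) = r :=
  (Equiv.ofBijective _ x.residues_bijective).apply_symm_apply r

theorem AffineVertex.pos_eq_iff (x : AffineVertex d) {r : ZMod (d + 1)} {i : Fin (d + 1)} :
    x.pos r = i ↔ (x.coord i : ZMod (d + 1)) = r := by
  rw [← x.residues_bijective.1.eq_iff]
  simp only [x.coord_pos, eq_comm]

theorem AffineVertex.dvd_sub_iff (x : AffineVertex d) {i j : Fin (d + 1)} :
    ((d : ℤ) + 1) ∣ x.coord i - x.coord j ↔ i = j := by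
  rw [← x.residues_bijective.1.eq_iff, eq_comm, ZMod.intCast_eq_intCast_iff_dvd_sub]
  push_cast
  rfl

theorem zmod_one_ne_zero (hd : 2 ≤ d) : (1 : ZMod (d + 1)) ≠ 0 := by
  have : Fact (1 < d + 1) := ⟨by omega⟩
  exact one_ne_zero

theorem zmod_two_ne_zero (hd : 2 ≤ d) : (2 : ZMod (d + 1)) ≠ 0 := by
  intro h
  have : ((2 : ℕ) : ZMod (d + 1)) = 0 := by exact_mod_cast h
  rw [ZMod.natCast_eq_zero_iff] at this
  have := Nat.le_of_dvd (by norm_num) this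
  omega

theorem coord_add_single_sub_single_pos (x : AffineVertex d) (r t : ZMod (d + 1)) :
    (x.coord + Pi.single (x.pos r) 1 - Pi.single (x.pos (r + 1)) 1 : Fin (d + 1) → ℤ) (x.pos t) =
      x.coord (x.pos t) + (if t = r then 1 else 0) - (if t = r + 1 then 1 else 0) := by
  simp [Pi.single_apply]

theorem residue_add_single_sub_single (x : AffineVertex d) (r t : ZMod (d + 1)) :
    (((x.coord + Pi.single (x.pos r) 1 - Pi.single (x.pos (r + 1)) 1 : Fin (d + 1) → ℤ)
      (x.pos t) : ℤ) : ZMod (d + 1)) = Equiv.swap r (r + 1) t := by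
  rw [coord_add_single_sub_single_pos]
  push_cast
  rw [x.coord_pos, Equiv.swap_apply_def]
  split_ifs with h1 h2 h2
  · rw [← h2, h1]; ring
  · rw [h1]; ring
  · rw [h2]; ring
  · ring

/-- The neighbour of `x` obtained by exchanging the residues `r` and `r + 1`. -/
noncomputable def AffineVertex.move (x : AffineVertex d) (r : ZMod (d + 1)) : AffineVertex d where
  coord := x.coord + Pi.single (x.pos r) 1 - Pi.single (x.pos (r + 1)) 1
  sum_eq := by simp [Finset.sum_add_distrib, Finset.sum_sub_distrib, x.sum_eq]
  residues s := ⟨x.pos (Equiv.swap r (r + 1) s), by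
    simp only [residue_add_single_sub_single, Equiv.swap_apply_self]⟩

open AffineVertex

theorem coord_move (x : AffineVertex d) (r : ZMod (d + 1)) :
    (x.move r).coord = x.coord + Pi.single (x.pos r) 1 - Pi.single (x.pos (r + 1)) 1 := rfl

theorem pos_move (x : AffineVertex d) (r s : ZMod (d + 1)) :
    (x.move r).pos s = x.pos (Equiv.swap r (r + 1) s) := by
  rw [AffineVertex.pos_eq_iff, coord_move, residue_add_single_sub_single, Equiv.swap_apply_self]

theorem pos_move_self (x : AffineVertex d) (r : ZMod (d + 1)) :
    (x.move r).pos r = x.pos (r + 1) := by simp [pos_move]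

theorem pos_move_succ (x : AffineVertex d) (r : ZMod (d + 1)) :
    (x.move r).pos (r + 1) = x.pos r := by simp [pos_move]

theorem pos_move_of_ne (x : AffineVertex d) {r s : ZMod (d + 1)} (h1 : s ≠ r) (h2 : s ≠ r + 1) :
    (x.move r).pos s = x.pos s := by rw [pos_move, Equiv.swap_apply_of_ne_of_ne h1 h2]

theorem move_move (x : AffineVertex d) (r : ZMod (d + 1)) : (x.move r).move r = x := by
  ext1
  rw [coord_move, pos_move_self, pos_move_succ, coord_move]
  abel

theorem succ_ne_self (hd : 2 ≤ d) (r : ZMod (d + 1)) : r + 1 ≠ r := by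
  simpa using zmod_one_ne_zero hd

theorem succ_succ_ne_self (hd : 2 ≤ d) (r : ZMod (d + 1)) : r + 1 + 1 ≠ r := by
  intro h
  exact zmod_two_ne_zero hd (by linear_combination h)

theorem succ_succ_ne_succ (hd : 2 ≤ d) (r : ZMod (d + 1)) : r + 1 + 1 ≠ r + 1 :=
  succ_ne_self hd _

theorem adj_move (hd : 2 ≤ d) (x : AffineVertex d) (r : ZMod (d + 1)) :
    (affineGraph d).Adj x (x.move r) := by
  refine ⟨x.pos (r + 1), x.pos r, x.pos.injective.ne (succ_ne_self hd r), ?_⟩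
  rw [coord_move]
  abel

/-- The raised coordinate takes over the residue of some other coordinate. Residues must remain
distinct, so that other coordinate is the one being lowered. -/
theorem adj_iff_exists_move (hd : 2 ≤ d) {x y : AffineVertex d} :
    (affineGraph d).Adj x y ↔ ∃ r, y = x.move r := by
  constructor
  · rintro ⟨i, j, hij, h⟩
    have hy : y.coord = x.coord + Pi.single j 1 - Pi.single i 1 := by
      rw [add_sub_assoc, ← h]; abel
    have hyj : y.coord j = x.coord j + 1 := by simp [hy, hij.symm]
    refine ⟨x.coord j, ?_⟩
    have hj : x.pos (x.coord j) = j := x.pos_eq_iff.2 rfl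
    have hi : x.pos (x.coord j + 1) = i := by
      by_contra hne
      set l := x.pos (x.coord j + 1) with hl
      have hxl : ((x.coord l : ℤ) : ZMod (d + 1)) = x.coord j + 1 := x.coord_pos _
      have hlj : l ≠ j := by
        rintro h'
        rw [h'] at hxl
        exact succ_ne_self hd _ hxl.symm
      have hyl : y.coord l = x.coord l := by simp [hy, hne, hlj]
      apply hlj
      apply y.residues_bijective.1
      simp [hyl, hyj, hxl]
    ext1
    rw [coord_move, hi, hj, hy]
  · rintro ⟨r, rfl⟩
    exact adj_move hd x r

theorem move_injective (hd : 2 ≤ d) (x : AffineVertex d) : Function.Injective x.move := by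
  intro r s h
  have h1 := congrFun (congrArg AffineVertex.coord h) (x.pos r)
  rw [coord_move, coord_move, coord_add_single_sub_single_pos,
    coord_add_single_sub_single_pos] at h1
  by_contra hrs
  rw [if_pos rfl, if_neg (succ_ne_self hd r).symm, if_neg hrs] at h1
  split_ifs at h1 <;> linarith

theorem move_comm (x : AffineVertex d) {r s : ZMod (d + 1)} (h1 : s ≠ r) (h2 : s ≠ r + 1)
    (h3 : r ≠ s + 1) : (x.move r).move s = (x.move s).move r := by
  ext1
  rw [coord_move, coord_move, coord_move, coord_move, pos_move_of_ne x h1 h2,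
    pos_move_of_ne x (fun h => h3 h.symm) (fun h => h1 (add_right_cancel h)),
    pos_move_of_ne x h1.symm h3,
    pos_move_of_ne x (fun h => h2 h.symm) (fun h => h1 (add_right_cancel h).symm)]
  abel

/-- The middle coordinate returns to its value, and the displacement to the opposite vertex of the
hexagon determines `r`. This yields the braid relation and later allows hexagons to be recognised.
-/
theorem coord_move_move_move (hd : 2 ≤ d) (x : AffineVertex d) (r : ZMod (d + 1)) :
    (((x.move r).move (r + 1)).move r).coord =
      x.coord + 2 • Pi.single (x.pos r) 1 - 2 • Pi.single (x.pos (r + 1 + 1)) 1 := by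
  have h1 := succ_ne_self hd r
  have h2 := succ_succ_ne_self hd r
  have h3 := succ_succ_ne_succ hd r
  rw [coord_move, coord_move, coord_move, pos_move_succ, pos_move_of_ne x h2 h3,
    pos_move_of_ne _ h1.symm h2.symm, pos_move_self, pos_move_self, pos_move_of_ne x h2 h3]
  abel

theorem coord_move_move_move' (hd : 2 ≤ d) (x : AffineVertex d) (r : ZMod (d + 1)) :
    (((x.move (r + 1)).move r).move (r + 1)).coord =
      x.coord + 2 • Pi.single (x.pos r) 1 - 2 • Pi.single (x.pos (r + 1 + 1)) 1 := by
  have h1 := succ_ne_self hd r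
  have h2 := succ_succ_ne_self hd r
  have h3 := succ_succ_ne_succ hd r
  rw [coord_move, coord_move, coord_move, pos_move_self, pos_move_of_ne x h1.symm h2.symm,
    pos_move_succ, pos_move_of_ne _ h2 h3, pos_move_of_ne x h1.symm h2.symm, pos_move_succ]
  abel

theorem move_braid (hd : 2 ≤ d) (x : AffineVertex d) (r : ZMod (d + 1)) :
    ((x.move r).move (r + 1)).move r = ((x.move (r + 1)).move r).move (r + 1) := by
  ext1
  rw [coord_move_move_move hd, coord_move_move_move' hd]

/-! ### Descending the squared distance to a root -/

/-- The squared distance of `x` to the root `o`. -/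
def height (o x : AffineVertex d) : ℤ := ∑ i, (x.coord i - o.coord i) ^ 2

/-- The displacement from `o` of the coordinate of `x` with residue `r`. -/
noncomputable def gap (o x : AffineVertex d) (r : ZMod (d + 1)) : ℤ :=
  x.coord (x.pos r) - o.coord (x.pos r)

theorem height_nonneg (o x : AffineVertex d) : 0 ≤ height o x :=
  Finset.sum_nonneg fun _ _ => sq_nonneg _

theorem height_move (hd : 2 ≤ d) (o x : AffineVertex d) (r : ZMod (d + 1)) :
    height o (x.move r) = height o x + 2 * (gap o x r - gap o x (r + 1) + 1) := by
  have h1 := succ_ne_self hd r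
  rw [← sub_eq_iff_eq_add', height, height, ← Finset.sum_sub_distrib, ← x.pos.sum_comp]
  have : ∀ t, ((x.move r).coord (x.pos t) - o.coord (x.pos t)) ^ 2 -
      (x.coord (x.pos t) - o.coord (x.pos t)) ^ 2 =
      (if t = r then 2 * gap o x r + 1 else 0) +
      (if t = r + 1 then 1 - 2 * gap o x (r + 1) else 0) := by
    intro t
    rw [coord_move, coord_add_single_sub_single_pos]
    by_cases ht : t = r
    · subst ht
      simp only [if_true, h1.symm, if_false, gap]
      ring
    · by_cases ht' : t = r + 1
      · subst ht'
        simp only [if_true, h1, if_false, gap]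
        ring
      · simp only [ht, ht', if_false]
        ring
  rw [Finset.sum_congr rfl fun t _ => this t, Finset.sum_add_distrib]
  simp
  ring

theorem gap_move_self (hd : 2 ≤ d) (o x : AffineVertex d) (r : ZMod (d + 1)) :
    gap o (x.move r) r = gap o x (r + 1) - 1 := by
  rw [gap, pos_move_self, coord_move, coord_add_single_sub_single_pos, if_neg (succ_ne_self hd r),
    if_pos rfl, gap]
  ring

theorem gap_move_succ (hd : 2 ≤ d) (o x : AffineVertex d) (r : ZMod (d + 1)) :
    gap o (x.move r) (r + 1) = gap o x r + 1 := by
  rw [gap, pos_move_succ, coord_move, coord_add_single_sub_single_pos,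
    if_neg (succ_ne_self hd r).symm, if_pos rfl, gap]
  ring

theorem gap_move_of_ne (o x : AffineVertex d) {r s : ZMod (d + 1)} (h1 : s ≠ r)
    (h2 : s ≠ r + 1) : gap o (x.move r) s = gap o x s := by
  rw [gap, pos_move_of_ne x h1 h2, coord_move, coord_add_single_sub_single_pos, if_neg h1,
    if_neg h2, gap]
  ring

/-- Equality would give two different coordinates of `o` the same residue. Consequently no edge
preserves the height. -/
theorem gap_succ_ne (hd : 2 ≤ d) (o x : AffineVertex d) (r : ZMod (d + 1)) :
    gap o x (r + 1) ≠ gap o x r + 1 := by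
  intro h
  apply succ_ne_self hd r
  apply x.pos.injective
  apply o.residues_bijective.1
  have hc := congrArg (Int.cast : ℤ → ZMod (d + 1)) h
  simp only [gap] at hc
  push_cast at hc
  rw [x.coord_pos, x.coord_pos] at hc
  simp only
  linear_combination -hc

theorem height_move_ne (hd : 2 ≤ d) (o x : AffineVertex d) (r : ZMod (d + 1)) :
    height o (x.move r) ≠ height o x := by
  rw [height_move hd]
  have := gap_succ_ne hd o x r
  omega

/-- If no move descends, then `gap_succ_ne` makes the gaps weakly decreasing along the cycle of
residues, hence constant; their sum is zero, so they all vanish. -/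
theorem exists_lower (hd : 2 ≤ d) {o x : AffineVertex d} (hne : x ≠ o) :
    ∃ r, height o (x.move r) < height o x := by
  by_contra! hcon
  have hmono : ∀ r, gap o x (r + 1) ≤ gap o x r := fun r => by
    have h1 := hcon r
    rw [height_move hd] at h1
    have := gap_succ_ne hd o x r
    omega
  obtain ⟨m, hm⟩ := Finite.exists_min (gap o x)
  have hall : ∀ t : ℕ, gap o x (m + t) = gap o x m := by
    intro t
    induction t with
    | zero => simp
    | succ t ih =>
      have := hmono (m + t)
      have h2 := hm (m + t + 1)
      push_cast
      rw [← add_assoc]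
      omega
  have hall' : ∀ r, gap o x r = gap o x m := fun r => by
    have := hall (r - m).val
    rwa [ZMod.natCast_zmod_val, add_sub_cancel] at this
  have hsum : ∑ r, gap o x r = 0 := by
    simp only [gap]
    rw [x.pos.sum_comp (fun i => x.coord i - o.coord i), Finset.sum_sub_distrib, x.sum_eq, o.sum_eq,
      sub_self]
  rw [Finset.sum_congr rfl fun r _ => hall' r] at hsum
  have h0 : gap o x m = 0 := by
    have h' : ((d : ℤ) + 1) ≠ 0 := by positivity
    simpa [ZMod.card, h'] using hsum
  apply hne
  ext i
  have := hall' (x.pos.symm i)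
  rw [h0, gap, Equiv.apply_symm_apply] at this
  linarith

theorem affine_induction (hd : 2 ≤ d) (o : AffineVertex d) {P : AffineVertex d → Prop} (h0 : P o)
    (hstep : ∀ x r, P x → P (x.move r)) (x : AffineVertex d) : P x := by
  induction hn : (height o x).toNat using Nat.strong_induction_on generalizing x with
  | _ n ih =>
    by_cases hx : x = o
    · rwa [hx]
    · obtain ⟨r, hr⟩ := exists_lower hd hx
      have hlt : (height o (x.move r)).toNat < n := by
        have := height_nonneg o (x.move r)
        omega
      have := hstep _ r (ih _ hlt (x.move r) rfl)
      rwa [move_move] at this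

/-- Equal or adjacent. -/
def Near (x y : AffineVertex d) : Prop := x = y ∨ (affineGraph d).Adj x y

theorem Near.symm {x y : AffineVertex d} (h : Near x y) : Near y x :=
  h.imp Eq.symm SimpleGraph.Adj.symm

theorem near_move (hd : 2 ≤ d) (x : AffineVertex d) (r : ZMod (d + 1)) : Near x (x.move r) :=
  Or.inr (adj_move hd x r)

/-- The two descents say that the gap grows by at least 2 from `r` to `r + 1` and again to `r + 2`.
The remaining vertices of the hexagon then lie below `x` as well. -/
theorem exists_chain_succ (hd : 2 ≤ d) {o x : AffineVertex d} {r : ZMod (d + 1)}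
    (hr : height o (x.move r) < height o x) (hs : height o (x.move (r + 1)) < height o x) :
    ∃ a b c, height o a < height o x ∧ height o b < height o x ∧ height o c < height o x ∧
      Near (x.move r) a ∧ Near a b ∧ Near b c ∧ Near c (x.move (r + 1)) := by
  have h1 := succ_ne_self hd r
  have h2 := succ_succ_ne_self hd r
  have h3 := succ_succ_ne_succ hd r
  have k1 := gap_succ_ne hd o x r
  have k2 := gap_succ_ne hd o x (r + 1)
  refine ⟨(x.move r).move (r + 1), ((x.move r).move (r + 1)).move r, (x.move (r + 1)).move r,
    ?_, ?_, ?_, near_move hd _ _, near_move hd _ _, ?_, (near_move hd _ _).symm⟩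
  · rw [height_move hd] at hr hs ⊢
    rw [height_move hd, gap_move_succ hd, gap_move_of_ne o x h2 h3]
    omega
  · rw [height_move hd] at hr hs ⊢
    rw [height_move hd, height_move hd, gap_move_self hd, gap_move_succ hd,
      gap_move_of_ne o _ h1.symm h2.symm, gap_move_of_ne o x h2 h3, gap_move_self hd]
    omega
  · rw [height_move hd] at hr hs ⊢
    rw [height_move hd, gap_move_self hd, gap_move_of_ne o x h1.symm h2.symm]
    omega
  · rw [move_braid hd]
    exact (near_move hd _ _).symm

/-- Two descending edges span a hexagon or a square, according as their labels are consecutive or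
not, with all other vertices below `x`. This is the local step behind path independence of the lift.
-/
theorem exists_chain (hd : 2 ≤ d) {o x : AffineVertex d} {r s : ZMod (d + 1)} (hrs : r ≠ s)
    (hr : height o (x.move r) < height o x) (hs : height o (x.move s) < height o x) :
    ∃ a b c, height o a < height o x ∧ height o b < height o x ∧ height o c < height o x ∧
      Near (x.move r) a ∧ Near a b ∧ Near b c ∧ Near c (x.move s) := by
  by_cases h1 : s = r + 1
  · subst h1
    exact exists_chain_succ hd hr hs
  by_cases h2 : r = s + 1
  · subst h2
    obtain ⟨a, b, c, ha, hb, hc, k1, k2, k3, k4⟩ := exists_chain_succ hd hs hr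
    exact ⟨c, b, a, hc, hb, ha, k4.symm, k3.symm, k2.symm, k1.symm⟩
  -- A square has a single further corner; the chain is padded by repeating its endpoint.
  refine ⟨(x.move r).move s, x.move s, x.move s, ?_, hs, hs, near_move hd _ _, ?_, Or.inl rfl,
    Or.inl rfl⟩
  · rw [height_move hd] at hr hs ⊢
    rw [height_move hd, gap_move_of_ne o x hrs.symm h1,
      gap_move_of_ne o x (fun h => h2 h.symm) (fun h => hrs (add_right_cancel h).symm)]
    omega
  · rw [move_comm x hrs.symm h1 h2]
    exact (near_move hd _ _).symm

/-! ### Counting walls -/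

/-- Twice the number of hyperplanes `x_i - x_j ≡ 0` that separate `x` and `y`. -/
def wallDist (x y : AffineVertex d) : ℤ :=
  ∑ i, ∑ j, |(x.coord i - x.coord j) / ((d : ℤ) + 1) - (y.coord i - y.coord j) / ((d : ℤ) + 1)|

theorem wallDist_self (x : AffineVertex d) : wallDist x x = 0 := by simp [wallDist]

theorem wallDist_comm (x y : AffineVertex d) : wallDist x y = wallDist y x := by
  simp only [wallDist, abs_sub_comm]

theorem wallDist_triangle (x y z : AffineVertex d) :
    wallDist x z ≤ wallDist x y + wallDist y z := by
  simp only [wallDist, ← Finset.sum_add_distrib]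
  exact Finset.sum_le_sum fun i _ => Finset.sum_le_sum fun j _ => abs_sub_le _ _ _

/-- A step of size one changes the quotient only by reaching or leaving a multiple of `n`. -/
theorem ediv_eq_of_abs_sub_le_one {n z z' : ℤ} (hn : 0 < n) (h : |z - z'| ≤ 1) (hz : ¬ n ∣ z)
    (hz' : ¬ n ∣ z') : z / n = z' / n := by
  have key : ∀ a b : ℤ, |a - b| ≤ 1 → ¬ n ∣ a → a / n ≤ b / n := by
    intro a b hab ha
    by_contra hcon
    rw [not_le] at hcon
    have h1 := Int.emod_add_mul_ediv b n
    have h2 := Int.emod_lt_of_pos b hn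
    have h3 := Int.emod_add_mul_ediv a n
    have h4 := Int.emod_nonneg a hn.ne'
    have h5 := (abs_le.1 hab).2
    have h6 : n * (b / n + 1) ≤ n * (a / n) := mul_le_mul_of_nonneg_left hcon hn.le
    exact ha ⟨a / n, by rw [mul_add] at h6; omega⟩
  exact le_antisymm (key _ _ h hz) (key _ _ (by rwa [abs_sub_comm]) hz')

theorem abs_ediv_sub_ediv_le_one {n z z' : ℤ} (hn : 2 ≤ n) (h : |z - z'| ≤ 2) :
    |z / n - z' / n| ≤ 1 := by
  have key : ∀ a b : ℤ, |a - b| ≤ 2 → a / n - b / n ≤ 1 := by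
    intro a b hab
    by_contra hcon
    rw [not_le] at hcon
    have h1 := Int.emod_add_mul_ediv b n
    have h2 := Int.emod_lt_of_pos b (by linarith : 0 < n)
    have h3 := Int.emod_add_mul_ediv a n
    have h4 := Int.emod_nonneg a (by linarith : n ≠ 0)
    have h5 := (abs_le.1 hab).2
    have h6 : n * (b / n + 2) ≤ n * (a / n) :=
      mul_le_mul_of_nonneg_left (by linarith) (by linarith)
    linarith
  rw [abs_le]
  have := key _ _ h
  have := key _ _ (by rwa [abs_sub_comm] : |z' - z| ≤ 2)
  constructor <;> linarith

/-- Only the difference of the two exchanged coordinates changes by 2, and so can cross a wall. Any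
other difference changes by at most 1 and avoids multiples of d+1 at both ends. The bound 2 counts
both orders of the pair. -/
theorem wallDist_move (hd : 2 ≤ d) (x : AffineVertex d) (r : ZMod (d + 1)) :
    wallDist x (x.move r) ≤ 2 := by
  have hr := succ_ne_self hd r
  have hpt : ∀ a b, |(x.coord (x.pos a) - x.coord (x.pos b)) / ((d : ℤ) + 1) -
      ((x.move r).coord (x.pos a) - (x.move r).coord (x.pos b)) / ((d : ℤ) + 1)| ≤
      (if a = r then if b = r + 1 then 1 else 0 else 0) +
      (if a = r + 1 then if b = r then 1 else 0 else 0) := by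
    intro a b
    by_cases hab : a = b
    · subst hab
      rw [sub_self, sub_self, sub_self, abs_zero]
      split_ifs <;> norm_num
    have hx : ¬ ((d : ℤ) + 1) ∣ x.coord (x.pos a) - x.coord (x.pos b) := by
      rw [x.dvd_sub_iff]
      exact x.pos.injective.ne hab
    have hx' : ¬ ((d : ℤ) + 1) ∣ (x.move r).coord (x.pos a) - (x.move r).coord (x.pos b) := by
      rw [(x.move r).dvd_sub_iff]
      exact x.pos.injective.ne hab
    have hd' : (2 : ℤ) ≤ d + 1 := by exact_mod_cast (by omega : 2 ≤ d + 1)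
    have hnear : ∀ p : Prop, [Decidable p] → |(x.coord (x.pos a) - x.coord (x.pos b)) -
        ((x.move r).coord (x.pos a) - (x.move r).coord (x.pos b))| ≤ (if p then 2 else 1) →
        |(x.coord (x.pos a) - x.coord (x.pos b)) / ((d : ℤ) + 1) -
        ((x.move r).coord (x.pos a) - (x.move r).coord (x.pos b)) / ((d : ℤ) + 1)| ≤
        (if p then 1 else 0) := by
      intro p _ h
      split_ifs at h ⊢
      · exact abs_ediv_sub_ediv_le_one hd' h
      · rw [ediv_eq_of_abs_sub_le_one (by linarith) h hx hx', sub_self, abs_zero]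
    have hcases : (if a = r then if b = r + 1 then 1 else 0 else 0) +
        (if a = r + 1 then if b = r then 1 else 0 else 0) =
        if (a = r ∧ b = r + 1) ∨ (a = r + 1 ∧ b = r) then (1 : ℤ) else 0 := by
      by_cases h1 : a = r
      · subst h1; simp [hr.symm]
      · simp only [h1, if_false, false_and, false_or, zero_add, ite_and]
    rw [hcases]
    apply hnear
    rw [coord_move, coord_add_single_sub_single_pos, coord_add_single_sub_single_pos]
    by_cases h1 : a = r
    · subst h1
      by_cases h2 : b = a + 1
      · subst h2; simp [hr, hr.symm]; rw [abs_le]; constructor <;> linarith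
      · simp [h2, Ne.symm hab, hr.symm]
    · by_cases h2 : a = r + 1
      · subst h2
        by_cases h3 : b = r
        · subst h3; simp [hr, hr.symm]; rw [abs_le]; constructor <;> linarith
        · simp [h3, Ne.symm hab, hr]
      · by_cases h3 : b = r
        · subst h3; simp [h1, h2, hr.symm]
        · by_cases h4 : b = r + 1
          · subst h4; simp [h1, h2, hr]
          · simp [h1, h2, h3, h4]
  rw [wallDist, ← x.pos.sum_comp]
  refine (Finset.sum_le_sum fun a _ => ?_).trans (b := ∑ a, ((if a = r then 1 else 0) +
    (if a = r + 1 then 1 else 0))) ?_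
  · rw [← x.pos.sum_comp]
    refine (Finset.sum_le_sum fun b _ => hpt a b).trans ?_
    rw [Finset.sum_add_distrib]
    apply add_le_add
    · split_ifs <;> simp
    · split_ifs <;> simp
  · rw [Finset.sum_add_distrib]
    simp

theorem Near.wallDist_le (hd : 2 ≤ d) {x y : AffineVertex d} (h : Near x y) :
    wallDist x y ≤ 2 := by
  rcases h with rfl | h
  · rw [wallDist_self]; norm_num
  · obtain ⟨r, rfl⟩ := (adj_iff_exists_move hd).1 h
    exact wallDist_move hd x r

theorem wallDist_add_wSum {x y : AffineVertex d} {a : Fin (d + 1) → ℤ}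
    (h : y.coord = x.coord + wSum a) : wallDist x y = ∑ i, ∑ j, |a i - a j| := by
  refine Finset.sum_congr rfl fun i _ => Finset.sum_congr rfl fun j _ => ?_
  have hd : ((d : ℤ) + 1) ≠ 0 := by positivity
  have : y.coord i - y.coord j = x.coord i - x.coord j + ((d : ℤ) + 1) * (a i - a j) := by
    rw [h]
    simp only [Pi.add_apply, wSum]
    ring
  rw [this, Int.add_mul_ediv_left _ _ hd, sub_add_cancel_left, abs_neg]

/-- By the triangle inequality, rows `i` and `j` of the double sum together contribute at least d+1
times |a i - a j|, and each of the other d-1 rows at least once. -/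
theorem le_sum_abs_sub (a : Fin (d + 1) → ℤ) (i j : Fin (d + 1)) :
    2 * (d : ℤ) * |a i - a j| ≤ ∑ p, ∑ q, |a p - a q| := by
  by_cases hij : i = j
  · subst hij
    rw [sub_self, abs_zero, mul_zero]
    exact Finset.sum_nonneg fun _ _ => Finset.sum_nonneg fun _ _ => abs_nonneg _
  have htri : ∀ p, |a i - a j| ≤ |a p - a i| + |a p - a j| := fun p => by
    rw [abs_sub_comm (a p) (a i)]
    exact abs_sub_le _ _ _
  have hrow : ∀ p, |a i - a j| ≤ ∑ q, |a p - a q| := fun p => by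
    refine (htri p).trans ?_
    rw [← Finset.sum_pair (f := fun q => |a p - a q|) hij]
    exact Finset.sum_le_sum_of_subset_of_nonneg (Finset.subset_univ _) fun _ _ _ => abs_nonneg _
  have h1 : ∑ p, (∑ q, |a p - a q| - |a i - a j|) ≥
      ∑ p ∈ {i, j}, (∑ q, |a p - a q| - |a i - a j|) :=
    Finset.sum_le_sum_of_subset_of_nonneg (Finset.subset_univ _) fun p _ _ =>
      sub_nonneg.2 (hrow p)
  rw [Finset.sum_pair hij, Finset.sum_sub_distrib] at h1
  have h2 : ((d : ℤ) + 1) * |a i - a j| ≤ ∑ q, |a i - a q| + ∑ q, |a j - a q| := by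
    rw [← Finset.sum_add_distrib]
    refine le_trans ?_ (Finset.sum_le_sum fun p _ => ?_) (b := ∑ p : Fin (d + 1), |a i - a j|)
    · simp
    · rw [abs_sub_comm (a j) (a p)]
      exact abs_sub_le _ _ _
  simp only [Finset.sum_const, Finset.card_univ, Fintype.card_fin, nsmul_eq_mul] at h1
  push_cast at h1
  linarith

/-- Two equivalent vertices at distance at most six are equal. -/
theorem eq_of_wallDist_le {k : ℕ} (hd : 2 ≤ d) (hk : 1 ≤ k) (hdk : ¬ (d = 2 ∧ k = 1))
    {x y : AffineVertex d} (h : (vertexSetoid (d := d) fun _ => k).r x y)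
    (hle : wallDist x y ≤ 12) : x = y := by
  obtain ⟨v, hv, hxy⟩ := h
  obtain ⟨a, rfl, ha⟩ := (mem_sublattice_iff hk).1 hv
  rw [wallDist_add_wSum hxy] at hle
  -- Half of 12 bounds d·|a i - a j|: differences are at most 3 for d = 2 and at most 2 for d ≥ 3,
  -- which are the two ranges covered by the arithmetic.
  have hrange : ∀ i j, (d : ℤ) * |a i - a j| ≤ 6 := fun i j => by
    have := le_sum_abs_sub a i j
    linarith
  have hconst : ∀ i j, a i = a j := by
    by_cases hd2 : d = 2
    · subst hd2
      refine const_of_abs_sub_le_three (k := k) (by omega) ha fun i j => ?_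
      have := hrange i j
      push_cast at this
      linarith
    · refine const_of_abs_sub_le_two hk ha fun i j => ?_
      have := hrange i j
      have hd3 : (3 : ℤ) ≤ d := by exact_mod_cast (by omega : 3 ≤ d)
      nlinarith [abs_nonneg (a i - a j)]
  rw [wSum_eq_zero_iff.2 hconst, add_zero] at hxy
  exact AffineVertex.ext hxy.symm

end Moves


/-! ### Lifting automorphisms of the quotient to the infinite graph -/

section Lift

variable {d k : ℕ}

/-- The class of an affine vertex in `H_k`. -/
abbrev proj (k : ℕ) (x : AffineVertex d) : HeawoodVertex (d := d) fun _ => k :=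
  Quotient.mk (vertexSetoid fun _ => k) x

/-- Translation by a vector with coordinate sum zero and constant residues. -/
def AffineVertex.shift (x : AffineVertex d) (u : Fin (d + 1) → ℤ) (c : ZMod (d + 1))
    (h0 : ∑ i, u i = 0) (hc : ∀ i, (u i : ZMod (d + 1)) = c) : AffineVertex d where
  coord := x.coord + u
  sum_eq := by simp [Finset.sum_add_distrib, x.sum_eq, h0]
  residues r := by
    obtain ⟨i, hi⟩ := x.residues (r - c)
    refine ⟨i, ?_⟩
    simp only [Pi.add_apply, Int.cast_add, hc]
    rw [show (x.coord i : ZMod (d + 1)) = r - c from hi, sub_add_cancel]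

theorem sum_wSum (a : Fin (d + 1) → ℤ) : ∑ i, wSum a i = 0 := by
  simp [wSum, ← Finset.mul_sum]

theorem wSum_residue (a : Fin (d + 1) → ℤ) (i : Fin (d + 1)) :
    (wSum a i : ZMod (d + 1)) = -((∑ i, a i : ℤ) : ZMod (d + 1)) := by
  have h0 : ((d : ZMod (d + 1)) + 1) = 0 := by exact_mod_cast ZMod.natCast_self (d + 1)
  simp [wSum, h0]

theorem exists_coord_eq_add_wSum (x : AffineVertex d) (a : Fin (d + 1) → ℤ) :
    ∃ y : AffineVertex d, y.coord = x.coord + wSum a :=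
  ⟨x.shift _ _ (sum_wSum a) (wSum_residue a), rfl⟩

theorem proj_eq_iff {x y : AffineVertex d} :
    proj k x = proj k y ↔ ∃ v ∈ sublattice (d := d) fun _ => k, y.coord = x.coord + v :=
  Quotient.eq

theorem adj_of_sub_eq {x y x' y' : AffineVertex d} (h : (affineGraph d).Adj x y)
    (he : y'.coord - x'.coord = y.coord - x.coord) : (affineGraph d).Adj x' y' := by
  obtain ⟨i, j, hij, h⟩ := h
  exact ⟨i, j, hij, he.trans h⟩

theorem exists_adj_lift {x : AffineVertex d} {b : HeawoodVertex (d := d) fun _ => k}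
    (hk : 1 ≤ k) (h : (heawoodGraph fun _ => k).Adj (proj k x) b) :
    ∃ y, (affineGraph d).Adj x y ∧ proj k y = b := by
  obtain ⟨-, x', y', hadj, hx, rfl⟩ := h
  obtain ⟨v, hv, hxx⟩ := proj_eq_iff.1 hx
  obtain ⟨a, ha, -⟩ := (mem_sublattice_iff hk).1 (neg_mem hv)
  obtain ⟨y, hy⟩ := exists_coord_eq_add_wSum y' a
  have hva : v = -wSum a := by rw [← ha, neg_neg]
  refine ⟨y, adj_of_sub_eq hadj ?_, ?_⟩
  · rw [hy, hxx, hva]; abel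
  · exact proj_eq_iff.2 ⟨v, hv, by rw [hy, hva]; abel⟩

theorem proj_eq_of_wallDist_le (hd : 2 ≤ d) (hk : 1 ≤ k) (hdk : ¬ (d = 2 ∧ k = 1))
    {x y : AffineVertex d} (h : proj k x = proj k y) (hle : wallDist x y ≤ 12) : x = y :=
  eq_of_wallDist_le hd hk hdk (proj_eq_iff.1 h) hle

theorem adj_proj (hd : 2 ≤ d) (hk : 1 ≤ k) (hdk : ¬ (d = 2 ∧ k = 1)) {x y : AffineVertex d}
    (h : (affineGraph d).Adj x y) : (heawoodGraph fun _ => k).Adj (proj k x) (proj k y) := by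
  refine ⟨fun he => h.ne ?_, x, y, h, rfl, rfl⟩
  have : wallDist x y ≤ 2 := Near.wallDist_le hd (Or.inr h)
  exact proj_eq_of_wallDist_le hd hk hdk he (by linarith)

open Classical in
/-- A neighbour of `z` in the class `b`, if there is one. -/
noncomputable def liftNeighbor (z : AffineVertex d) (b : HeawoodVertex (d := d) fun _ => k) :
    AffineVertex d :=
  if h : ∃ y, (affineGraph d).Adj z y ∧ proj k y = b then h.choose else z

open Classical in
/-- The lift of `φ` that sends `o` to `z`. -/
noncomputable def liftMap (hd : 2 ≤ d) (φ : GraphAut (d := d) fun _ => k) (o z x : AffineVertex d) :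
    AffineVertex d :=
  if h : x = o then z
  -- The lift follows one arbitrarily chosen descending edge. Independence of this choice, and that
  -- the default value of `liftNeighbor` never occurs when `z` lies over the image of `o`, is the
  -- content of `liftMap_spec`.
  else liftNeighbor (liftMap hd φ o z (x.move (exists_lower hd h).choose)) (φ (proj k x))
termination_by (height o x).toNat
decreasing_by
  have h1 := (exists_lower hd h).choose_spec
  have h2 := height_nonneg o (x.move (exists_lower hd h).choose)
  omega

/-- By induction on height, the chain of `exists_chain` below `x` is mapped to a chain. It connects
the value chosen along one descending edge with the value required by another; both lie in the class
of the image of `x` and are too close to be different. -/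
theorem liftMap_spec (hd : 2 ≤ d) (hk : 1 ≤ k) (hdk : ¬ (d = 2 ∧ k = 1))
    (φ : GraphAut (d := d) fun _ => k) {o z : AffineVertex d} (hz : proj k z = φ (proj k o))
    (x : AffineVertex d) :
    proj k (liftMap hd φ o z x) = φ (proj k x) ∧ ∀ r, height o (x.move r) < height o x →
      (affineGraph d).Adj (liftMap hd φ o z (x.move r)) (liftMap hd φ o z x) := by
  induction hn : (height o x).toNat using Nat.strong_induction_on generalizing x with
  | _ n ih =>
    have ih' : ∀ y, height o y < height o x → proj k (liftMap hd φ o z y) = φ (proj k y) ∧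
        ∀ r, height o (y.move r) < height o y →
        (affineGraph d).Adj (liftMap hd φ o z (y.move r)) (liftMap hd φ o z y) := fun y hy => by
      have := height_nonneg o y
      exact ih _ (by omega) y rfl
    by_cases hx : x = o
    · subst hx
      refine ⟨by rw [liftMap, dif_pos rfl, hz], fun r hr => ?_⟩
      have h0 : height x x = 0 := by simp [height]
      have := height_nonneg x (x.move r)
      omega
    have hlift : ∀ y, height o y < height o x → (affineGraph d).Adj y x →
        ∃ y', (affineGraph d).Adj (liftMap hd φ o z y) y' ∧ proj k y' = φ (proj k x) := by
      intro y hy hadj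
      apply exists_adj_lift hk
      rw [(ih' y hy).1]
      exact φ.map_adj_iff.2 (adj_proj hd hk hdk hadj)
    set r₀ := (exists_lower hd hx).choose with hr₀
    have hr₀' : height o (x.move r₀) < height o x := (exists_lower hd hx).choose_spec
    have h₀ := hlift _ hr₀' (adj_move hd x r₀).symm
    have hdef : liftMap hd φ o z x = h₀.choose := by
      rw [liftMap, dif_neg hx, liftNeighbor, dif_pos h₀]
    obtain ⟨hadj₀, hproj₀⟩ := h₀.choose_spec
    rw [← hdef] at hadj₀ hproj₀
    refine ⟨hproj₀, fun r hr => ?_⟩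
    by_cases hrr : r = r₀
    · rw [hrr]; exact hadj₀
    have hnear : ∀ p q, height o p < height o x → height o q < height o x → Near p q →
        Near (liftMap hd φ o z p) (liftMap hd φ o z q) := by
      intro p q hp hq hpq
      rcases hpq with rfl | hpq
      · exact Or.inl rfl
      · obtain ⟨s, rfl⟩ := (adj_iff_exists_move hd).1 hpq
        rcases lt_or_gt_of_ne (height_move_ne hd o p s) with hlt | hlt
        · exact Or.inr ((ih' p hp).2 s hlt).symm
        · have := (ih' _ hq).2 s (by rwa [move_move])
          rw [move_move] at this
          exact Or.inr this
    obtain ⟨a, b, c, ha, hb, hc, n1, n2, n3, n4⟩ := exists_chain hd (Ne.symm hrr) hr₀' hr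
    obtain ⟨y', hy', hpy'⟩ := hlift _ hr (adj_move hd x r).symm
    have m1 := (hnear _ _ hr₀' ha n1).wallDist_le hd
    have m2 := (hnear _ _ ha hb n2).wallDist_le hd
    have m3 := (hnear _ _ hb hc n3).wallDist_le hd
    have m4 := (hnear _ _ hc hr n4).wallDist_le hd
    have m0 := Near.wallDist_le hd (Or.inr hadj₀.symm)
    have m5 := Near.wallDist_le hd (Or.inr hy')
    -- One edge at either end and four steps of the chain: six steps, each of wall distance at most
    -- 2.
    have heq : liftMap hd φ o z x = y' := by
      apply proj_eq_of_wallDist_le hd hk hdk (hproj₀.trans hpy'.symm)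
      have t0 := wallDist_triangle (liftMap hd φ o z x) (liftMap hd φ o z (x.move r₀)) y'
      have t1 := wallDist_triangle (liftMap hd φ o z (x.move r₀)) (liftMap hd φ o z a) y'
      have t2 := wallDist_triangle (liftMap hd φ o z a) (liftMap hd φ o z b) y'
      have t3 := wallDist_triangle (liftMap hd φ o z b) (liftMap hd φ o z c) y'
      have t4 := wallDist_triangle (liftMap hd φ o z c) (liftMap hd φ o z (x.move r)) y'
      linarith
    rw [heq]
    exact hy'

/-- A map of the infinite graph that acts injectively on the labels of the edges at each vertex. -/
structure IsLocalIso (g : AffineVertex d → AffineVertex d)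
    (σ : AffineVertex d → ZMod (d + 1) → ZMod (d + 1)) : Prop where
  move : ∀ x r, g (x.move r) = (g x).move (σ x r)
  injective : ∀ x, Function.Injective (σ x)

/-- The vertex `(1, …, d+1)`. -/
def idVertex (d : ℕ) : AffineVertex d where
  coord i := (i : ℤ) + 1
  sum_eq := rfl
  residues r := by
    refine ⟨⟨(r - 1).val, ZMod.val_lt _⟩, ?_⟩
    simp

theorem exists_lift (hd : 2 ≤ d) (hk : 1 ≤ k) (hdk : ¬ (d = 2 ∧ k = 1))
    (φ : GraphAut (d := d) fun _ => k) :
    ∃ g σ, IsLocalIso g σ ∧ ∀ x : AffineVertex d, proj k (g x) = φ (proj k x) := by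
  set o := idVertex d
  obtain ⟨z, hz⟩ := Quotient.exists_rep (φ (proj k o))
  have hspec := liftMap_spec hd hk hdk φ hz
  set g := liftMap hd φ o z
  have hadj : ∀ x r, (affineGraph d).Adj (g x) (g (x.move r)) := by
    intro x r
    rcases lt_or_gt_of_ne (height_move_ne hd o x r) with hlt | hlt
    · exact ((hspec x).2 r hlt).symm
    · have := (hspec (x.move r)).2 r (by rwa [move_move])
      rwa [move_move] at this
  choose σ hσ using fun x r => (adj_iff_exists_move hd).1 (hadj x r)
  refine ⟨g, σ, ⟨hσ, fun x r s hrs => ?_⟩, fun x => (hspec x).1⟩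
  -- Two neighbours of `x` with the same image lie in one class, since φ is injective; being two
  -- edges apart, they coincide.
  have h1 : g (x.move r) = g (x.move s) := by rw [hσ, hσ, hrs]
  have h2 : proj k (x.move r) = proj k (x.move s) := by
    apply φ.injective
    rw [← (hspec _).1, ← (hspec _).1, h1]
  apply move_injective hd x
  apply proj_eq_of_wallDist_le hd hk hdk h2
  have := wallDist_triangle (x.move r) x (x.move s)
  rw [wallDist_comm (x.move r) x] at this
  linarith [wallDist_move hd x r, wallDist_move hd x s]

end Lift


/-! ### Rigidity of local isomorphisms -/

section Rigid

variable {d k : ℕ}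

/-- The change of the coordinate with residue `t` under the move `a`. -/
def labelShift (a t : ZMod (d + 1)) : ℤ := (if t = a then 1 else 0) - (if t = a + 1 then 1 else 0)

theorem coord_move_pos (x : AffineVertex d) (a t : ZMod (d + 1)) :
    (x.move a).coord (x.pos t) = x.coord (x.pos t) + labelShift a t := by
  rw [coord_move, coord_add_single_sub_single_pos, labelShift, add_sub_assoc]

/-- This follows a fixed coordinate along a path: its residue is transposed at each move. -/
theorem pos_eq_pos_move (x : AffineVertex d) (a t : ZMod (d + 1)) :
    x.pos t = (x.move a).pos (Equiv.swap a (a + 1) t) := by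
  rw [pos_move, Equiv.swap_apply_self]

theorem coord_move_move_pos (x : AffineVertex d) (a b t : ZMod (d + 1)) :
    ((x.move a).move b).coord (x.pos t) =
      x.coord (x.pos t) + labelShift a t + labelShift b (Equiv.swap a (a + 1) t) := by
  rw [← coord_move_pos, pos_eq_pos_move x a t, coord_move_pos]

theorem coord_move_move_move_pos (x : AffineVertex d) (a b c t : ZMod (d + 1)) :
    (((x.move a).move b).move c).coord (x.pos t) =
      x.coord (x.pos t) + labelShift a t + labelShift b (Equiv.swap a (a + 1) t) +
        labelShift c (Equiv.swap b (b + 1) (Equiv.swap a (a + 1) t)) := by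
  rw [← coord_move_move_pos, pos_eq_pos_move x a t, pos_eq_pos_move (x.move a) b, coord_move_pos]

theorem labelShift_le_one (a t : ZMod (d + 1)) : labelShift a t ≤ 1 := by
  unfold labelShift; split_ifs <;> norm_num

theorem neg_one_le_labelShift (a t : ZMod (d + 1)) : -1 ≤ labelShift a t := by
  unfold labelShift; split_ifs <;> norm_num

theorem labelShift_eq_one {a t : ZMod (d + 1)} (h : labelShift a t = 1) : t = a := by
  unfold labelShift at h; split_ifs at h with h1 h2 <;> first | exact h1 | norm_num at h

theorem labelShift_eq_neg_one {a t : ZMod (d + 1)} (h : labelShift a t = -1) : t = a + 1 := by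
  unfold labelShift at h; split_ifs at h with h1 h2 h2 <;> first | exact h2 | norm_num at h

theorem labelShift_self (hd : 2 ≤ d) (a : ZMod (d + 1)) : labelShift a a = 1 := by
  simp [labelShift, (succ_ne_self hd a).symm]

theorem labelShift_succ (hd : 2 ≤ d) (a : ZMod (d + 1)) : labelShift a (a + 1) = -1 := by
  simp [labelShift, succ_ne_self hd a]

/-- Follow the coordinate of residue `a`. The left path raises it, and `b' ≠ a` prevents it from
falling back. The right path must raise it too: so `b` does not lower it, and since `b ≠ a` does not
raise it either, `a'` must be `a`. -/
theorem square_labels_aux (hd : 2 ≤ d) (y : AffineVertex d) {a b a' b' : ZMod (d + 1)}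
    (hab : a ≠ b) (hb' : b' ≠ a)
    (h : (y.move a).move b' = (y.move b).move a') : a' = a ∧ a ≠ b + 1 := by
  have h1 := congrFun (congrArg AffineVertex.coord h) (y.pos a)
  rw [coord_move_move_pos, coord_move_move_pos, labelShift_self hd, Equiv.swap_apply_left] at h1
  have h2 : 0 ≤ labelShift b' (a + 1) := by
    have := neg_one_le_labelShift b' (a + 1)
    by_contra hcon
    have h3 := labelShift_eq_neg_one (show labelShift b' (a + 1) = -1 by omega)
    exact hb' (add_right_cancel h3).symm
  have hab' : a ≠ b + 1 := by
    rintro rfl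
    rw [labelShift_succ hd] at h1
    have := labelShift_le_one a' (Equiv.swap b (b + 1) (b + 1))
    omega
  refine ⟨?_, hab'⟩
  have h4 : labelShift b a = 0 := by simp [labelShift, hab, hab']
  rw [Equiv.swap_apply_of_ne_of_ne hab hab', h4] at h1
  have := labelShift_le_one a' a
  exact (labelShift_eq_one (by omega)).symm

theorem square_labels (hd : 2 ≤ d) (y : AffineVertex d) {a b a' b' : ZMod (d + 1)}
    (hab : a ≠ b) (hb' : b' ≠ a) (ha' : a' ≠ b)
    (h : (y.move a).move b' = (y.move b).move a') : b' = b ∧ a ≠ b + 1 ∧ b ≠ a + 1 := by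
  have h1 := square_labels_aux hd y hab hb' h
  have h2 := square_labels_aux hd y hab.symm ha' h.symm
  exact ⟨h2.1, h1.2, h2.2⟩

/-- Three rising labels lift one coordinate by 3. A path of three moves with the same end must raise
that coordinate at every move, so its first label is forced. -/
theorem not_rising {y : AffineVertex d} (hd : 2 ≤ d) {a₁ b₁ b₂ b₃ : ZMod (d + 1)} (hne : a₁ ≠ b₁)
    (h : ((y.move a₁).move (a₁ + 1)).move (a₁ + 1 + 1) = ((y.move b₁).move b₂).move b₃) : False := by
  have h1 := congrFun (congrArg AffineVertex.coord h) (y.pos a₁)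
  rw [coord_move_move_move_pos, coord_move_move_move_pos, Equiv.swap_apply_left,
    Equiv.swap_apply_left, labelShift_self hd, labelShift_self hd, labelShift_self hd] at h1
  have h2 := labelShift_le_one b₁ a₁
  have h3 := labelShift_le_one b₂ (Equiv.swap b₁ (b₁ + 1) a₁)
  have h4 := labelShift_le_one b₃ (Equiv.swap b₂ (b₂ + 1) (Equiv.swap b₁ (b₁ + 1) a₁))
  exact hne (labelShift_eq_one (by omega))

theorem not_falling {y : AffineVertex d} (hd : 2 ≤ d) {a b₁ b₂ b₃ : ZMod (d + 1)}
    (hne : a + 1 + 1 ≠ b₁)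
    (h : ((y.move (a + 1 + 1)).move (a + 1)).move a = ((y.move b₁).move b₂).move b₃) : False := by
  have h1 := congrFun (congrArg AffineVertex.coord h) (y.pos (a + 1 + 1 + 1))
  rw [coord_move_move_move_pos, coord_move_move_move_pos, Equiv.swap_apply_right,
    Equiv.swap_apply_right, labelShift_succ hd, labelShift_succ hd, labelShift_succ hd] at h1
  have h2 := neg_one_le_labelShift b₁ (a + 1 + 1 + 1)
  have h3 := neg_one_le_labelShift b₂ (Equiv.swap b₁ (b₁ + 1) (a + 1 + 1 + 1))
  have h4 := neg_one_le_labelShift b₃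
    (Equiv.swap b₂ (b₂ + 1) (Equiv.swap b₁ (b₁ + 1) (a + 1 + 1 + 1)))
  exact hne (add_right_cancel (labelShift_eq_neg_one (by omega)))

/-- Of the four patterns of consecutive labels, the monotone ones are excluded by `not_rising` and
`not_falling`; the other two are the halves of a hexagon. -/
theorem straight_or_braid (hd : 2 ≤ d) {y : AffineVertex d} {a₁ a₂ a₃ b₁ b₂ b₃ : ZMod (d + 1)}
    (ha₂ : a₂ = a₁ + 1 ∨ a₁ = a₂ + 1) (ha₃ : a₃ = a₂ + 1 ∨ a₂ = a₃ + 1) (hne : a₁ ≠ b₁)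
    (h : ((y.move a₁).move a₂).move a₃ = ((y.move b₁).move b₂).move b₃) :
    ∃ c, (a₁ = c ∧ a₂ = c + 1 ∨ a₁ = c + 1 ∧ a₂ = c) ∧ (((y.move a₁).move a₂).move a₃).coord =
      y.coord + 2 • Pi.single (y.pos c) 1 - 2 • Pi.single (y.pos (c + 1 + 1)) 1 := by
  rcases ha₂ with rfl | rfl <;> rcases ha₃ with rfl | ha₃
  · exact (not_rising hd hne h).elim
  · obtain rfl := add_right_cancel ha₃
    exact ⟨_, Or.inl ⟨rfl, rfl⟩, coord_move_move_move hd y _⟩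
  · exact ⟨_, Or.inr ⟨rfl, rfl⟩, coord_move_move_move' hd y _⟩
  · subst ha₃
    exact (not_falling hd hne h).elim

/-- The common displacement determines the hexagon, so the two paths are its halves c, c+1, c and
c+1, c, c+1 in some order. -/
theorem braid_labels (hd : 2 ≤ d) {y : AffineVertex d} {a₁ a₂ a₃ b₁ b₂ b₃ : ZMod (d + 1)}
    (ha₂ : a₂ = a₁ + 1 ∨ a₁ = a₂ + 1) (ha₃ : a₃ = a₂ + 1 ∨ a₂ = a₃ + 1)
    (hb₂ : b₂ = b₁ + 1 ∨ b₁ = b₂ + 1) (hb₃ : b₃ = b₂ + 1 ∨ b₂ = b₃ + 1) (hne : a₁ ≠ b₁)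
    (h : ((y.move a₁).move a₂).move a₃ = ((y.move b₁).move b₂).move b₃) : a₂ = b₁ := by
  obtain ⟨c, hc, ec⟩ := straight_or_braid hd ha₂ ha₃ hne h
  obtain ⟨c', hc', ec'⟩ := straight_or_braid hd hb₂ hb₃ hne.symm h.symm
  have hcc : c = c' := by
    have h1 := congrFun (ec.symm.trans ((congrArg AffineVertex.coord h).trans ec')) (y.pos c)
    by_contra hne
    have h2 := succ_succ_ne_self hd c
    simp [Pi.single_apply, h2.symm, hne] at h1
    split_ifs at h1 <;> omega
  subst hcc
  rcases hc with ⟨h1, h2⟩ | ⟨h1, h2⟩ <;> rcases hc' with ⟨h3, h4⟩ | ⟨h3, h4⟩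
  · exact (hne (h1.trans h3.symm)).elim
  · exact h2.trans h3.symm
  · exact h2.trans h3.symm
  · exact (hne (h1.trans h3.symm)).elim

/-! ### Labels of a local isomorphism -/

namespace IsLocalIso

variable {g : AffineVertex d → AffineVertex d} {σ : AffineVertex d → ZMod (d + 1) → ZMod (d + 1)}

theorem label_move_self (hd : 2 ≤ d) (H : IsLocalIso g σ) (x : AffineVertex d) (r : ZMod (d + 1)) :
    σ (x.move r) r = σ x r := by
  apply move_injective hd (g (x.move r))
  rw [← H.move, move_move, H.move, move_move]

theorem label_move_ne (hd : 2 ≤ d) (H : IsLocalIso g σ) (x : AffineVertex d) {r s : ZMod (d + 1)}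
    (h : s ≠ r) : σ (x.move r) s ≠ σ x r := by
  rw [← H.label_move_self hd x r]
  exact (H.injective _).ne h

theorem square (hd : 2 ≤ d) (H : IsLocalIso g σ) (x : AffineVertex d) {r s : ZMod (d + 1)}
    (h1 : s ≠ r) (h2 : s ≠ r + 1) (h3 : r ≠ s + 1) :
    σ (x.move r) s = σ x s ∧ σ x r ≠ σ x s + 1 ∧ σ x s ≠ σ x r + 1 := by
  apply square_labels hd (g x) (a' := σ (x.move s) r) ((H.injective x).ne h1.symm)
    (H.label_move_ne hd x h1) (H.label_move_ne hd x h1.symm)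
  rw [← H.move, ← H.move, ← H.move, ← H.move, move_comm x h1 h2 h3]

/-- Squares show that non-consecutive pairs of labels go to non-consecutive pairs. On a finite set
this injection is onto, so a consecutive pair cannot land there. -/
theorem label_adj (hd : 2 ≤ d) (H : IsLocalIso g σ) (x : AffineVertex d) {r s : ZMod (d + 1)}
    (h : s = r + 1 ∨ r = s + 1) : σ x s = σ x r + 1 ∨ σ x r = σ x s + 1 := by
  let f : Equiv.Perm (ZMod (d + 1)) :=
    Equiv.ofBijective (σ x) (Finite.injective_iff_bijective.1 (H.injective x))
  let F : Equiv.Perm (ZMod (d + 1) × ZMod (d + 1)) := f.prodCongr f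
  let S : Set (ZMod (d + 1) × ZMod (d + 1)) := {p | p.2 ≠ p.1 ∧ p.2 ≠ p.1 + 1 ∧ p.1 ≠ p.2 + 1}
  have hmaps : Set.MapsTo F S S := by
    rintro ⟨p, q⟩ ⟨h1, h2, h3⟩
    obtain ⟨-, e1, e2⟩ := H.square hd x h1 h2 h3
    exact ⟨(H.injective x).ne h1, e2, e1⟩
  have hsurj : Function.Surjective (hmaps.restrict F S S) :=
    Finite.injective_iff_surjective.1 (hmaps.restrict_inj.2 F.injective.injOn)
  by_contra! hcon
  have hrs : s ≠ r := by
    rcases h with rfl | rfl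
    · exact succ_ne_self hd r
    · exact (succ_ne_self hd s).symm
  have hmem : F (r, s) ∈ S := ⟨(H.injective x).ne hrs, hcon.1, hcon.2⟩
  obtain ⟨⟨p, h4⟩, hp⟩ := hsurj ⟨_, hmem⟩
  obtain rfl : p = (r, s) := F.injective (congrArg Subtype.val hp)
  rcases h with h | h
  · exact h4.2.1 h
  · exact h4.2.2 h

/-- A label different from `r` lies with `r` on a square or on a hexagon; the image closes up as
well, and `square` or `braid_labels` reads off the transported label. -/
theorem label_move (hd : 2 ≤ d) (H : IsLocalIso g σ) (x : AffineVertex d) (r : ZMod (d + 1)) :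
    σ (x.move r) = σ x := by
  have hbraid : ∀ (x : AffineVertex d) (r s : ZMod (d + 1)), (s = r + 1 ∨ r = s + 1) →
      ((x.move r).move s).move r = ((x.move s).move r).move s := by
    rintro x r s (rfl | rfl)
    · exact move_braid hd x r
    · exact (move_braid hd x s).symm
  funext s
  by_cases h1 : s = r
  · rw [h1, H.label_move_self hd]
  by_cases h2 : s = r + 1 ∨ r = s + 1
  · apply braid_labels hd (y := g x) (a₁ := σ x r) (a₃ := σ ((x.move r).move s) r) (b₁ := σ x s)
      (b₂ := σ (x.move s) r) (b₃ := σ ((x.move s).move r) s)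
    · rw [← H.label_move_self hd x r]
      exact H.label_adj hd _ h2
    · rw [← H.label_move_self hd (x.move r) s]
      exact H.label_adj hd _ h2.symm
    · rw [← H.label_move_self hd x s]
      exact H.label_adj hd _ h2.symm
    · rw [← H.label_move_self hd (x.move s) r]
      exact H.label_adj hd _ h2
    · exact (H.injective x).ne (Ne.symm h1)
    · simp only [← H.move]
      rw [hbraid x r s h2]
  · push Not at h2
    exact (H.square hd x h1 h2.1 h2.2).1

theorem label_eq (hd : 2 ≤ d) (H : IsLocalIso g σ) (o x : AffineVertex d) : σ x = σ o :=
  affine_induction hd o (P := fun x => σ x = σ o) rfl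
    (fun x r h => (H.label_move hd x r).trans h) x

/-- An injective adjacency-preserving map of the cycle cannot turn back, so the direction of its
first step persists. -/
theorem exists_label_formula (hd : 2 ≤ d) (H : IsLocalIso g σ) :
    (∃ c, ∀ x r, σ x r = r + c) ∨ ∃ c, ∀ x r, σ x r = c - r := by
  set o := idVertex d
  have key : ∀ e : ZMod (d + 1), σ o 1 = σ o 0 + e → (e = 1 ∨ e = -1) →
      ∀ x r, σ x r = σ o 0 + e * r := by
    intro e he he1 x r
    rw [H.label_eq hd o x]
    have : ∀ t : ℕ, σ o t = σ o 0 + e * t ∧ σ o (t + 1) = σ o 0 + e * (t + 1) := by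
      intro t
      induction t with
      | zero => simp [he]
      | succ t ih =>
        obtain ⟨h1, h2⟩ := ih
        push_cast
        refine ⟨h2, ?_⟩
        have hadj := H.label_adj hd o (r := (t : ZMod (d + 1)) + 1) (s := t + 1 + 1) (Or.inl rfl)
        have hne : σ o ((t : ZMod (d + 1)) + 1 + 1) ≠ σ o t :=
          (H.injective o).ne (succ_succ_ne_self hd _)
        rw [h1] at hne
        rw [h2] at hadj
        rcases he1 with rfl | rfl
        · rcases hadj with h | h
          · rw [h]; ring
          · exact (hne (by linear_combination -h)).elim
        · rcases hadj with h | h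
          · exact (hne (by linear_combination h)).elim
          · linear_combination -h
    have := (this r.val).1
    rwa [ZMod.natCast_zmod_val] at this
  rcases H.label_adj hd o (r := 0) (s := 1) (Or.inl (zero_add 1).symm) with h | h
  · left
    refine ⟨σ o 0, fun x r => ?_⟩
    rw [key 1 h (Or.inl rfl) x r]
    ring
  · right
    refine ⟨σ o 0, fun x r => ?_⟩
    rw [key (-1) (by rw [h]; ring) (Or.inr rfl) x r]
    ring

/-- A local isomorphism that rotates the labels is affine. -/
theorem exists_affine (hd : 2 ≤ d) (H : IsLocalIso g σ) {c : ZMod (d + 1)}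
    (hc : ∀ x r, σ x r = r + c) :
    ∃ (π : Equiv.Perm (Fin (d + 1))) (u : Fin (d + 1) → ℤ), (∀ i, (u i : ZMod (d + 1)) = c) ∧
      ∀ x i, (g x).coord (π i) = x.coord i + u i := by
  set o := idVertex d
  let π : Equiv.Perm (Fin (d + 1)) := o.pos.symm.trans ((Equiv.addRight c).trans (g o).pos)
  let u : Fin (d + 1) → ℤ := fun i => (g o).coord (π i) - o.coord i
  -- The positions of the residues are carried along in the induction, because they decide which
  -- coordinates the next move changes.
  have hall : ∀ x, (∀ r, (g x).pos (r + c) = π (x.pos r)) ∧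
      ∀ i, (g x).coord (π i) = x.coord i + u i := by
    intro x
    induction x using affine_induction hd o with
    | h0 => exact ⟨fun r => by simp [π], fun i => by simp [u]⟩
    | hstep x r ih =>
      obtain ⟨h1, h2⟩ := ih
      rw [H.move, hc]
      constructor
      · intro s
        have hsw : Equiv.swap (r + c) (r + c + 1) (s + c) = Equiv.swap r (r + 1) s + c := by
          rw [Equiv.swap_apply_def, Equiv.swap_apply_def, add_right_comm r c 1]
          simp only [add_left_inj]
          split_ifs <;> rfl
        rw [pos_move, pos_move, hsw, h1]
      · intro i
        rw [coord_move, coord_move, add_right_comm r c 1, h1, h1]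
        simp only [Pi.add_apply, Pi.sub_apply, Pi.single_apply, h2, π.injective.eq_iff]
        ring
  refine ⟨π, u, fun i => ?_, fun x => (hall x).2⟩
  have h1 := (hall o).1 (o.pos.symm i)
  rw [Equiv.apply_symm_apply, AffineVertex.pos_eq_iff, (hall o).2] at h1
  have h2 := o.coord_pos (o.pos.symm i)
  rw [Equiv.apply_symm_apply] at h2
  push_cast at h1
  rw [h2] at h1
  exact add_left_cancel h1

end IsLocalIso

/-- As d+2 ≡ 1, a residue s becomes 1 - s, and the pair r, r+1 becomes the pair -r, -r+1.
Composition with this map therefore turns a reflecting action on labels into a rotating one. -/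
theorem affineReflection_move (x : AffineVertex d) (r : ZMod (d + 1)) :
    affineReflection d (x.move r) = (affineReflection d x).move (-r) := by
  have h0 : ((d : ZMod (d + 1)) + 1) = 0 := by exact_mod_cast ZMod.natCast_self (d + 1)
  have hpos : ∀ s, (affineReflection d x).pos s = x.pos (1 - s) := by
    intro s
    rw [AffineVertex.pos_eq_iff, affineReflection_coord]
    push_cast
    rw [x.coord_pos]
    linear_combination h0
  ext i
  rw [coord_move, hpos, hpos, affineReflection_coord, coord_move]
  simp only [Pi.add_apply, Pi.sub_apply, affineReflection_coord]
  rw [show (1 : ZMod (d + 1)) - -r = r + 1 by ring, show (1 : ZMod (d + 1)) - (-r + 1) = r by ring]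
  ring

end Rigid


/-! ### The automorphism group of `H_k` -/

section Group

open Fin.NatCast Fin.CommRing

variable {d k : ℕ}

theorem wSum_single (d : ℕ) (m : ℤ) : wSum (Pi.single (0 : Fin (d + 1)) m) = m • w d 0 := by
  rw [← sum_smul_w, Finset.sum_eq_single 0]
  · simp
  · intro i _ hi
    simp [hi]
  · simp

theorem weightedSum_single (d k : ℕ) (m : ℤ) :
    weightedSum k (Pi.single (0 : Fin (d + 1)) m) = m * (k : ℤ) ^ d := by
  simp [weightedSum, Pi.single_apply, weight]

theorem translation_pow_apply (x : AffineVertex d) (m : ℕ) :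
    ∃ y : AffineVertex d, y.coord = x.coord + (m : ℤ) • w d 0 ∧
      (translation (fun _ => k) 0 ^ m) (proj k x) = proj k y := by
  induction m with
  | zero => exact ⟨x, by simp, rfl⟩
  | succ m ih =>
    obtain ⟨y, hy, h⟩ := ih
    refine ⟨affineTranslation d 0 y, ?_, ?_⟩
    · change y.coord + w d 0 = _
      rw [hy, Nat.cast_succ, add_smul, one_smul, add_assoc]
    · rw [pow_succ', RelIso.mul_apply, h]
      rfl

theorem C_pow_apply (x : AffineVertex d) (i : ℕ) :
    ∃ y : AffineVertex d, (∀ l, y.coord l = x.coord (l - (i : Fin (d + 1)))) ∧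
      (C d k ^ i) (proj k x) = proj k y := by
  induction i with
  | zero => exact ⟨x, by simp, rfl⟩
  | succ i ih =>
    obtain ⟨y, hy, h⟩ := ih
    refine ⟨affineRotation d y, fun l => ?_, ?_⟩
    · change y.coord (l - 1) = _
      rw [hy, Nat.cast_succ, sub_sub, add_comm (1 : Fin (d + 1))]
    · rw [pow_succ', RelIso.mul_apply, h]
      rfl

theorem affineReflection_affineReflection (x : AffineVertex d) :
    affineReflection d (affineReflection d x) = x := by
  ext i
  simp

theorem R_mul_R : R (d := d) (fun _ => k) * R (fun _ => k) = 1 := by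
  ext a
  obtain ⟨x, rfl⟩ := Quotient.exists_rep a
  change proj k (affineReflection d (affineReflection d x)) = proj k x
  rw [affineReflection_affineReflection]

/-- The weighted sum of w₀ is k^d, a unit modulo N. Hence multiples of w₀ reach every translation
modulo the lattice. -/
theorem exists_natCast_mul_sub_dvd (hk : 1 ≤ k) (c : ℤ) :
    ∃ m : ℕ, (m : ℤ) < latticeIndex d k ∧ latticeIndex d k ∣ m * (k : ℤ) ^ d - c := by
  have hN := latticeIndex_pos (d := d) hk
  obtain ⟨p, q, hpq⟩ := (isCoprime_latticeIndex d k).pow_right (n := d)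
  refine ⟨(c * q % latticeIndex d k).toNat, ?_, ?_⟩
  · rw [Int.toNat_of_nonneg (Int.emod_nonneg _ hN.ne')]
    exact Int.emod_lt_of_pos _ hN
  · rw [Int.toNat_of_nonneg (Int.emod_nonneg _ hN.ne')]
    have := Int.emod_add_mul_ediv (c * q) (latticeIndex d k)
    refine ⟨-(c * p) - (c * q / latticeIndex d k) * (k : ℤ) ^ d, ?_⟩
    linear_combination (k : ℤ) ^ d * this + c * hpq

theorem exists_eq_wSum {u : Fin (d + 1) → ℤ} {c : ZMod (d + 1)} (h0 : ∑ i, u i = 0)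
    (hc : ∀ i, (u i : ZMod (d + 1)) = c) : ∃ a, u = wSum a := by
  have hdvd : ∀ i, ∃ a, u i - c.val = ((d : ℤ) + 1) * a := fun i => by
    have : ((u i - c.val : ℤ) : ZMod (d + 1)) = 0 := by
      push_cast
      rw [hc, ZMod.natCast_zmod_val, sub_self]
    rw [ZMod.intCast_zmod_eq_zero_iff_dvd] at this
    exact_mod_cast this
  choose a ha using hdvd
  refine ⟨a, funext fun j => ?_⟩
  have hsum : ((d : ℤ) + 1) * ∑ i, a i = ((d : ℤ) + 1) * -(c.val : ℤ) := by
    rw [Finset.mul_sum, ← Finset.sum_congr rfl fun i _ => ha i, Finset.sum_sub_distrib, h0]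
    simp
  have := mul_left_cancel₀ (by positivity) hsum
  rw [wSum, this, ← ha]
  ring

theorem exists_normal_form_of_rotating (hd : 2 ≤ d) (hk : 1 ≤ k) (φ : GraphAut (d := d) fun _ => k)
    {g : AffineVertex d → AffineVertex d} {σ : AffineVertex d → ZMod (d + 1) → ZMod (d + 1)}
    (H : IsLocalIso g σ) (hg : ∀ x, proj k (g x) = φ (proj k x)) {c : ZMod (d + 1)}
    (hc : ∀ x r, σ x r = r + c) :
    ∃ m i : ℕ, (m : ℤ) < latticeIndex d k ∧ i < d + 1 ∧
      φ = translation (fun _ => k) 0 ^ m * C d k ^ i := by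
  obtain ⟨π, u, hu, hgx⟩ := H.exists_affine hd hc
  -- Vertices that differ by a lattice vector have images in one class, so the linear part of `g`
  -- preserves the lattice.
  have hpres : ∀ a, latticeIndex d k ∣ weightedSum k a →
      latticeIndex d k ∣ weightedSum k (a ∘ π.symm) := by
    intro a ha
    obtain ⟨y, hy⟩ := exists_coord_eq_add_wSum (idVertex d) a
    have hp : proj k (g (idVertex d)) = proj k (g y) := by
      rw [hg, hg]
      exact congrArg φ (proj_eq_iff.2 ⟨_, (wSum_mem_sublattice_iff hk).2 ha, hy⟩)
    obtain ⟨v, hv, hgy⟩ := proj_eq_iff.1 hp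
    rw [← wSum_mem_sublattice_iff hk]
    convert hv using 1
    funext l
    obtain ⟨i, rfl⟩ := π.surjective l
    have h1 := congrFun hgy (π i)
    have h2 := congrFun hy i
    rw [Pi.add_apply, hgx, hgx] at h1
    rw [Pi.add_apply] at h2
    have h3 : wSum (a ∘ π.symm) (π i) = wSum a i := by
      simp [wSum, Equiv.sum_comp π.symm a]
    linarith
  have hrot := rotation_of_preserves hd hk π hpres
  set j := π 0
  have hcoord : ∀ x l, (g x).coord l = x.coord (l - j) + u (l - j) := fun x l => by
    rw [← hgx, hrot, sub_add_cancel]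
  have hsum : ∑ l, u (l - j) = 0 := by
    have h1 := (g (idVertex d)).sum_eq
    rw [Finset.sum_congr rfl fun l _ => hcoord _ l, Finset.sum_add_distrib,
      show ∑ l, (idVertex d).coord (l - j) = _ from
        Equiv.sum_comp (Equiv.subRight j) (idVertex d).coord, (idVertex d).sum_eq] at h1
    linarith
  obtain ⟨a, ha⟩ := exists_eq_wSum hsum fun l => hu (l - j)
  obtain ⟨m, hm, hdvd⟩ := exists_natCast_mul_sub_dvd (d := d) hk (weightedSum k a)
  refine ⟨m, j, hm, j.2, ?_⟩
  ext b
  obtain ⟨x, rfl⟩ := Quotient.exists_rep b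
  obtain ⟨y, hy, hCy⟩ := C_pow_apply (k := k) x j
  obtain ⟨z, hz, htz⟩ := translation_pow_apply (k := k) y m
  change φ (proj k x) = _
  rw [RelIso.mul_apply]
  change _ = (translation (fun _ => k) 0 ^ m) ((C d k ^ (j : ℕ)) (proj k x))
  rw [hCy, htz, ← hg]
  refine proj_eq_iff.2 ⟨wSum (Pi.single 0 (m : ℤ) - a), ?_, ?_⟩
  · rw [wSum_mem_sublattice_iff hk, weightedSum_sub, weightedSum_single]
    exact hdvd
  · rw [wSum_sub, wSum_single, hz]
    funext l
    have h1 := congrFun ha l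
    simp only [Pi.add_apply, Pi.sub_apply, hcoord, hy, Fin.cast_val_eq_self, h1]
    ring

/-- The composite of a reflection, a rotation and a translation. -/
noncomputable def normalForm (d k m i e : ℕ) : GraphAut (d := d) fun _ => k :=
  translation (fun _ => k) 0 ^ m * C d k ^ i * R (fun _ => k) ^ e

theorem exists_normalForm (hd : 2 ≤ d) (hk : 1 ≤ k) (hdk : ¬ (d = 2 ∧ k = 1))
    (φ : GraphAut (d := d) fun _ => k) :
    ∃ m i e : ℕ, (m : ℤ) < latticeIndex d k ∧ i < d + 1 ∧ e < 2 ∧ φ = normalForm d k m i e := by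
  obtain ⟨g, σ, H, hg⟩ := exists_lift hd hk hdk φ
  rcases H.exists_label_formula hd with ⟨c, hc⟩ | ⟨c, hc⟩
  · obtain ⟨m, i, hm, hi, h⟩ := exists_normal_form_of_rotating hd hk φ H hg hc
    exact ⟨m, i, 0, hm, hi, by norm_num, by rw [normalForm, pow_zero, mul_one, h]⟩
  · have H' : IsLocalIso (fun x => g (affineReflection d x))
        (fun x r => σ (affineReflection d x) (-r)) :=
      ⟨fun x r => by rw [affineReflection_move, H.move],
        fun x => (H.injective _).comp neg_injective⟩
    obtain ⟨m, i, hm, hi, h⟩ := exists_normal_form_of_rotating hd hk (φ * R (fun _ => k)) H'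
      (fun x => by rw [hg]; rfl) (c := c) (fun x r => by rw [hc]; ring)
    refine ⟨m, i, 1, hm, hi, by norm_num, ?_⟩
    rw [normalForm, pow_one, ← h, mul_assoc, R_mul_R, mul_one]

theorem normalForm_apply (x : AffineVertex d) (m i e : ℕ) (he : e < 2) :
    ∃ y : AffineVertex d, (∀ l, y.coord l = (-1) ^ e * x.coord (l - (i : Fin (d + 1))) +
      ((d : ℤ) + 2) * e + m * w d 0 l) ∧ normalForm d k m i e (proj k x) = proj k y := by
  have hR : ∃ x' : AffineVertex d, (∀ l, x'.coord l = (-1) ^ e * x.coord l + ((d : ℤ) + 2) * e) ∧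
      (R (fun _ => k) ^ e) (proj k x) = proj k x' := by
    interval_cases e
    · exact ⟨x, by simp, rfl⟩
    · exact ⟨affineReflection d x, fun l => by simp; ring, rfl⟩
  obtain ⟨x', hx', hRx⟩ := hR
  obtain ⟨y, hy, hCy⟩ := C_pow_apply (k := k) x' i
  obtain ⟨z, hz, htz⟩ := translation_pow_apply (k := k) y m
  refine ⟨z, fun l => ?_, ?_⟩
  · rw [hz, Pi.add_apply, hy, hx']
    simp
  · rw [normalForm, RelIso.mul_apply, RelIso.mul_apply, hRx, hCy, htz]

theorem idVertex_pos_one (d : ℕ) : (idVertex d).pos 1 = 0 := by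
  rw [AffineVertex.pos_eq_iff]
  simp [idVertex]

theorem idVertex_pos_two (hd : 2 ≤ d) : (idVertex d).pos (1 + 1) = 1 := by
  rw [AffineVertex.pos_eq_iff]
  have : ((1 : Fin (d + 1)) : ℕ) = 1 := by
    rw [Fin.val_one']
    exact Nat.mod_eq_of_lt (by omega)
  simp only [idVertex, this]
  norm_num

/-- One edge suffices: it is sent to an edge of direction ±(e_i - e_{i+1}), which determines `i` and
`e`. The images of its starting point then determine `m` modulo N. -/
theorem normalForm_injective (hd : 2 ≤ d) (hk : 1 ≤ k) (hdk : ¬ (d = 2 ∧ k = 1))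
    {m i e m' i' e' : ℕ} (hm : (m : ℤ) < latticeIndex d k) (hm' : (m' : ℤ) < latticeIndex d k)
    (hi : i < d + 1) (hi' : i' < d + 1) (he : e < 2) (he' : e' < 2)
    (h : normalForm d k m i e = normalForm d k m' i' e') : m = m' ∧ i = i' ∧ e = e' := by
  set o := idVertex d with ho
  obtain ⟨y, hy, hpy⟩ := normalForm_apply (k := k) o m i e he
  obtain ⟨y₁, hy₁, hpy₁⟩ := normalForm_apply (k := k) (o.move 1) m i e he
  obtain ⟨z, hz, hpz⟩ := normalForm_apply (k := k) o m' i' e' he'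
  obtain ⟨z₁, hz₁, hpz₁⟩ := normalForm_apply (k := k) (o.move 1) m' i' e' he'
  have h01 : (1 : Fin (d + 1)) ≠ 0 := zmod_one_ne_zero hd
  have hmove : ∀ l, (o.move 1).coord l = o.coord l +
      ((if l = 0 then 1 else 0) - (if l = 1 then 1 else 0)) := fun l => by
    rw [coord_move, idVertex_pos_one, idVertex_pos_two hd]
    simp [Pi.single_apply]
    ring
  have hdiff : ∀ {y y₁ : AffineVertex d} {m i e : ℕ},
      (∀ l, y.coord l = (-1) ^ e * o.coord (l - (i : Fin (d + 1))) +
        ((d : ℤ) + 2) * e + m * w d 0 l) →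
      (∀ l, y₁.coord l = (-1) ^ e * (o.move 1).coord (l - (i : Fin (d + 1))) +
        ((d : ℤ) + 2) * e + m * w d 0 l) → ∀ l, y₁.coord l - y.coord l =
      (-1) ^ e * ((if l = i then 1 else 0) - (if l = 1 + i then 1 else 0)) := by
    intro y y₁ m i e hy hy₁ l
    rw [hy, hy₁, hmove]
    simp only [sub_eq_iff_eq_add, zero_add]
    ring
  have hnear : ∀ {y y₁ : AffineVertex d} {i e : ℕ}, e < 2 → (∀ l, y₁.coord l - y.coord l =
      (-1) ^ e * ((if l = i then 1 else 0) - (if l = 1 + i then 1 else 0))) →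
      (affineGraph d).Adj y y₁ := by
    intro y y₁ i e he hl
    interval_cases e
    · exact ⟨1 + i, i, by simpa using h01, funext fun l => by
        rw [Pi.sub_apply, hl]; simp [Pi.single_apply]⟩
    · exact ⟨i, 1 + i, by simpa using h01, funext fun l => by
        rw [Pi.sub_apply, hl]; simp [Pi.single_apply]⟩
  have hdy := hdiff hy hy₁
  have hdz := hdiff hz hz₁
  have hyz : proj k y = proj k z := by rw [← hpy, ← hpz, h]
  have hyz₁ : proj k y₁ = proj k z₁ := by rw [← hpy₁, ← hpz₁, h]
  obtain ⟨v, hv, hzv⟩ := proj_eq_iff.1 hyz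
  obtain ⟨a, hva, -⟩ := (mem_sublattice_iff hk).1 (neg_mem hv)
  -- The lattice vector that brings `z` back to `y` brings `z₁` to a neighbour of `y` in the class
  -- of `y₁`. Two neighbours of `y` in one class are equal.
  obtain ⟨z₂, hz₂⟩ := exists_coord_eq_add_wSum z₁ a
  rw [← hva] at hz₂
  have hpz₂ : proj k z₁ = proj k z₂ := proj_eq_iff.2 ⟨-v, neg_mem hv, hz₂⟩
  have hadj : (affineGraph d).Adj y z₂ := by
    refine adj_of_sub_eq (hnear he' hdz) ?_
    rw [hz₂, hzv]
    abel
  have heq : y₁ = z₂ := by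
    apply proj_eq_of_wallDist_le hd hk hdk (hyz₁.trans hpz₂)
    have h1 := wallDist_triangle y₁ y z₂
    have h2 := Near.wallDist_le hd (Or.inr (hnear he hdy).symm)
    have h3 := Near.wallDist_le hd (Or.inr hadj)
    linarith
  have hlab : ∀ l : Fin (d + 1),
      (-1 : ℤ) ^ e * ((if l = i then 1 else 0) - (if l = 1 + i then 1 else 0)) =
      (-1) ^ e' * ((if l = i' then 1 else 0) - (if l = 1 + i' then 1 else 0)) := by
    intro l
    rw [← hdy, ← hdz, heq, hz₂, hzv]
    simp only [Pi.add_apply, Pi.neg_apply]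
    ring
  have hne : ∀ p : Fin (d + 1), p ≠ 1 + p := fun p hp => by
    apply h01; simpa using hp.symm
  have hii : (i : Fin (d + 1)) = i' ∧ e = e' := by
    have h1 := hlab i
    have h2 := hlab (1 + i)
    rw [if_pos rfl, if_neg (hne _)] at h1
    rw [if_neg (hne _).symm, if_pos rfl] at h2
    -- Opposite signs would give i = i' + 1 and i' = i + 1, hence 2 = 0 modulo d+1.
    have h5 : (1 : Fin (d + 1)) + (1 + (i : Fin (d + 1))) ≠ i := fun hp => by
      have : (2 : ZMod (d + 1)) ≠ 0 := zmod_two_ne_zero hd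
      apply this
      have hp' : (1 : Fin (d + 1)) + 1 = 0 := by
        rw [← add_assoc] at hp
        simpa using hp
      exact (one_add_one_eq_two (R := ZMod (d + 1))).symm.trans hp'
    by_cases hee : e = e'
    · refine ⟨?_, hee⟩
      subst hee
      have h3 := mul_left_cancel₀ (pow_ne_zero _ (by norm_num)) h1
      by_contra hcon
      rw [if_neg hcon] at h3
      split_ifs at h3 <;> norm_num at h3
    · exfalso
      have hsign : (-1 : ℤ) ^ e' = -(-1) ^ e := by
        interval_cases e <;> interval_cases e' <;> simp at hee ⊢
      rw [hsign, neg_mul, ← mul_neg] at h1 h2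
      have h3 := mul_left_cancel₀ (pow_ne_zero _ (by norm_num)) h1
      have h4 := mul_left_cancel₀ (pow_ne_zero _ (by norm_num)) h2
      have h6 : (i : Fin (d + 1)) = 1 + i' := by
        by_contra hcon
        rw [if_neg hcon] at h3
        split_ifs at h3 <;> norm_num at h3
      have h7 : 1 + (i : Fin (d + 1)) = i' := by
        by_contra hcon
        rw [if_neg hcon] at h4
        split_ifs at h4 <;> norm_num at h4
      exact h5 (by rw [h7, ← h6])
  obtain ⟨hii, rfl⟩ := hii
  have hii' : i = i' := by
    have := congrArg Fin.val hii
    rwa [Fin.val_natCast, Fin.val_natCast, Nat.mod_eq_of_lt hi, Nat.mod_eq_of_lt hi'] at this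
  subst hii'
  refine ⟨?_, rfl, rfl⟩
  have hvw : v = wSum (Pi.single (0 : Fin (d + 1)) ((m' : ℤ) - m)) := by
    rw [wSum_single]
    funext l
    have h1 := congrFun hzv l
    rw [Pi.add_apply, hz, hy] at h1
    simp only [Pi.smul_apply, smul_eq_mul]
    linarith
  rw [hvw, wSum_mem_sublattice_iff hk, weightedSum_single] at hv
  have h1 := ((isCoprime_latticeIndex d k).pow_right (n := d)).dvd_of_dvd_mul_right hv
  have h2 := Int.eq_zero_of_abs_lt_dvd h1 (by rw [abs_lt]; constructor <;> omega)
  omega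

theorem sup_eq_top (hd : 2 ≤ d) (hk : 1 ≤ k) (hdk : ¬ (d = 2 ∧ k = 1)) :
    T (d := d) (fun _ => k) ⊔ Subgroup.zpowers (R (d := d) (fun _ => k)) ⊔
      Subgroup.zpowers (C d k) = ⊤ := by
  rw [eq_top_iff]
  intro φ _
  obtain ⟨m, i, e, -, -, -, rfl⟩ := exists_normalForm hd hk hdk φ
  refine mul_mem (mul_mem (pow_mem ?_ _) (pow_mem ?_ _)) (pow_mem ?_ _)
  · exact Subgroup.mem_sup_left (Subgroup.mem_sup_left
      (Subgroup.subset_closure (Set.mem_range_self _)))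
  · exact Subgroup.mem_sup_right (Subgroup.mem_zpowers _)
  · exact Subgroup.mem_sup_left (Subgroup.mem_sup_right (Subgroup.mem_zpowers _))

theorem card_graphAut (hd : 2 ≤ d) (hk : 1 ≤ k) (hdk : ¬ (d = 2 ∧ k = 1)) :
    (Nat.card (GraphAut (d := d) fun _ => k) : ℤ) = 2 * ((d : ℤ) + 1) * latticeIndex d k := by
  have hN := latticeIndex_pos (d := d) hk
  let F : Fin (latticeIndex d k).toNat × Fin (d + 1) × Fin 2 → GraphAut (d := d) fun _ => k :=
    fun p => normalForm d k p.1 p.2.1 p.2.2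
  have hF : Function.Bijective F := by
    constructor
    · rintro ⟨m, i, e⟩ ⟨m', i', e'⟩ h
      obtain ⟨h1, h2, h3⟩ := normalForm_injective hd hk hdk (by have := m.2; omega)
        (by have := m'.2; omega) i.2 i'.2 e.2 e'.2 h
      exact Prod.ext (Fin.ext h1) (Prod.ext (Fin.ext h2) (Fin.ext h3))
    · intro φ
      obtain ⟨m, i, e, hm, hi, he, rfl⟩ := exists_normalForm hd hk hdk φ
      exact ⟨⟨⟨m, by omega⟩, ⟨i, hi⟩, ⟨e, he⟩⟩, rfl⟩
  rw [← Nat.card_congr (Equiv.ofBijective F hF)]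
  simp only [Nat.card_eq_fintype_card, Fintype.card_prod, Fintype.card_fin]
  push_cast
  rw [Int.toNat_of_nonneg hN.le]
  ring

end Group


/-! ### Facets of the affine Coxeter complex -/

section Faces

variable {d k : ℕ}

/-- The vertex of the facet dual to `x` at which the coordinate with residue `r` is the least one
of the tile. -/
noncomputable def AffineVertex.vert (x : AffineVertex d) (r : ZMod (d + 1)) : Fin (d + 1) → ℝ :=
  fun i => ((x.coord i : ℝ) - 1 - (((x.coord i : ZMod (d + 1)) - r).val : ℝ)) / (d + 1)

theorem mul_vert (x : AffineVertex d) (r : ZMod (d + 1)) (i : Fin (d + 1)) :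
    ((d : ℝ) + 1) * x.vert r i =
      (x.coord i : ℝ) - 1 - (((x.coord i : ZMod (d + 1)) - r).val : ℝ) := by
  have : (d : ℝ) + 1 ≠ 0 := by positivity
  rw [AffineVertex.vert]
  field_simp

/-- The permutation by which `x` sits in its tile at `x.vert r`. -/
noncomputable def AffineVertex.tilePerm (x : AffineVertex d) (r : ZMod (d + 1)) :
    Equiv.Perm (Fin (d + 1)) :=
  -- The values lie in `ZMod (d + 1)`, which is `Fin (d + 1)` by definition.
  x.pos.symm.trans (Equiv.subRight r)

theorem tilePerm_val (x : AffineVertex d) (r : ZMod (d + 1)) (i : Fin (d + 1)) :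
    (x.tilePerm r i : ℕ) = ((x.coord i : ZMod (d + 1)) - r).val := rfl

theorem vert_mem (x : AffineVertex d) (r : ZMod (d + 1)) : x.vert r ∈ dualVertices x := by
  have hd : (d : ℝ) + 1 ≠ 0 := by positivity
  refine ⟨⟨?_, fun i j => ?_⟩, x.tilePerm r, fun i => ?_⟩
  · apply mul_left_cancel₀ hd
    rw [Finset.mul_sum, mul_zero]
    simp only [mul_vert]
    have h1 : ∑ i, ((x.coord i : ℤ) : ℝ) = ∑ i : Fin (d + 1), ((i : ℝ) + 1) := by
      have := congrArg (Int.cast : ℤ → ℝ) x.sum_eq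
      push_cast at this
      exact this
    have h2 := Equiv.sum_comp (x.tilePerm r) fun i : Fin (d + 1) => (((i : ℕ) : ℝ) + 1)
    rw [← h1] at h2
    simp only [tilePerm_val] at h2
    rw [← sub_eq_zero, ← Finset.sum_sub_distrib] at h2
    rw [← neg_eq_zero, ← Finset.sum_neg_distrib, ← h2]
    exact Finset.sum_congr rfl fun i _ => by ring
  · have hdvd : (((d + 1 : ℕ) : ℤ)) ∣ (x.coord j - x.coord i) -
        ((((x.coord j : ZMod (d + 1)) - r).val : ℤ) - (((x.coord i : ZMod (d + 1)) - r).val : ℤ)) := by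
      rw [← ZMod.intCast_zmod_eq_zero_iff_dvd]
      push_cast
      rw [ZMod.natCast_zmod_val, ZMod.natCast_zmod_val]
      ring
    obtain ⟨n, hn⟩ := hdvd
    refine ⟨n, ?_⟩
    apply mul_left_cancel₀ hd
    rw [mul_sub, mul_vert, mul_vert]
    have := congrArg (Int.cast : ℤ → ℝ) hn
    push_cast at this
    rw [← this]
    ring
  · rw [mul_vert, tilePerm_val]
    ring

/-- Relative to the tile, all coordinates lie within d above the least one, so residues modulo d+1
determine them up to a common constant. The sum condition fixes that constant. -/
theorem eq_vert_of_bounds (x : AffineVertex d) {u : Fin (d + 1) → ℝ} (hu : u ∈ affineLattice d)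
    (h : ∀ i j, (x.coord j : ℝ) - x.coord i - ((d : ℝ) + 1) * (u j - u i) ≤ d) :
    ∃ r, u = x.vert r := by
  have hd : (d : ℝ) + 1 ≠ 0 := by positivity
  obtain ⟨a, -, ha⟩ := Finset.exists_min_image Finset.univ
    (fun i => (x.coord i : ℝ) - (d + 1) * u i) Finset.univ_nonempty
  refine ⟨x.coord a, ?_⟩
  have hval : ∀ i, (x.coord i : ℝ) - (d + 1) * u i = (x.coord a : ℝ) - (d + 1) * u a +
      (((x.coord i : ZMod (d + 1)) - x.coord a).val : ℝ) := by
    intro i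
    obtain ⟨m, hm⟩ := hu.2 a i
    have h0 : 0 ≤ x.coord i - x.coord a - (d + 1) * m := by
      have := ha i (Finset.mem_univ _)
      have h' : (0 : ℝ) ≤ x.coord i - x.coord a - (d + 1) * m := by
        rw [← hm]; linarith
      exact_mod_cast h'
    have h1 : x.coord i - x.coord a - (d + 1) * m ≤ d := by
      have := h a i
      rw [hm] at this
      exact_mod_cast this
    obtain ⟨t, ht⟩ := Int.eq_ofNat_of_zero_le h0
    have hcast : (x.coord i : ZMod (d + 1)) - x.coord a = t := by
      have h2 := congrArg (Int.cast : ℤ → ZMod (d + 1)) ht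
      have hz : ((d : ZMod (d + 1)) + 1) = 0 := by exact_mod_cast ZMod.natCast_self (d + 1)
      push_cast at h2
      rw [hz, zero_mul, sub_zero] at h2
      exact h2
    rw [hcast, ZMod.val_natCast_of_lt (by omega)]
    have h3 : (x.coord i : ℝ) - x.coord a - (d + 1) * m = t := by exact_mod_cast ht
    rw [← hm] at h3
    linarith
  have hv := vert_mem x (x.coord a)
  have hconst : ∀ i, u i = x.vert (x.coord a) i +
      (1 - ((x.coord a : ℝ) - (d + 1) * u a)) / (d + 1) := by
    intro i
    apply mul_left_cancel₀ hd
    rw [mul_add, mul_vert, mul_div_cancel₀ _ hd]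
    linarith [hval i]
  have hsum := hu.1
  rw [Finset.sum_congr rfl fun i _ => hconst i, Finset.sum_add_distrib, hv.1.1] at hsum
  have h0 : (1 - ((x.coord a : ℝ) - (d + 1) * u a)) / (d + 1) = 0 := by
    simp only [Finset.sum_const, Finset.card_univ, Fintype.card_fin, nsmul_eq_mul, zero_add] at hsum
    push_cast at hsum
    exact (mul_eq_zero.1 hsum).resolve_left hd
  funext i
  rw [hconst, h0, add_zero]

theorem mem_dualVertices_iff {x : AffineVertex d} {u : Fin (d + 1) → ℝ} :
    u ∈ dualVertices x ↔ ∃ r, u = x.vert r := by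
  constructor
  · rintro ⟨hu, σ, hσ⟩
    refine eq_vert_of_bounds x hu fun i j => ?_
    rw [hσ, hσ]
    have h1 : ((σ j : ℕ) : ℝ) ≤ d := by exact_mod_cast Nat.lt_succ_iff.1 (σ j).2
    have h2 : (0 : ℝ) ≤ ((σ i : ℕ) : ℝ) := by positivity
    linarith
  · rintro ⟨r, rfl⟩
    exact vert_mem x r

theorem vert_pos (x : AffineVertex d) (r : ZMod (d + 1)) :
    (x.coord (x.pos r) : ℝ) = 1 + ((d : ℝ) + 1) * x.vert r (x.pos r) := by
  rw [mul_vert, x.coord_pos, sub_self, ZMod.val_zero]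
  simp

theorem vert_pos_pred (x : AffineVertex d) (r : ZMod (d + 1)) :
    (x.coord (x.pos (r - 1)) : ℝ) = d + 1 + ((d : ℝ) + 1) * x.vert r (x.pos (r - 1)) := by
  rw [mul_vert, x.coord_pos, sub_sub_cancel_left, ZMod.val_neg_one]
  ring

theorem eq_of_vert_pos {x : AffineVertex d} {r s : ZMod (d + 1)}
    (h : (x.coord (x.pos r) : ℝ) = 1 + ((d : ℝ) + 1) * x.vert s (x.pos r)) : s = r := by
  rw [mul_vert, x.coord_pos] at h
  have h1 : ((r - s).val : ℝ) = 0 := by linarith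
  have h2 : (r - s).val = 0 := by exact_mod_cast h1
  rw [ZMod.val_eq_zero, sub_eq_zero] at h2
  exact h2.symm

theorem vert_injective (x : AffineVertex d) : Function.Injective x.vert := fun r s h =>
  (eq_of_vert_pos (by rw [← h]; exact vert_pos x r)).symm

theorem dualVertices_eq_range (x : AffineVertex d) : dualVertices x = Set.range x.vert := by
  ext u
  rw [mem_dualVertices_iff, Set.mem_range]
  exact exists_congr fun r => eq_comm

theorem finite_dualVertices (x : AffineVertex d) : (dualVertices x).Finite := by
  rw [dualVertices_eq_range]
  exact Set.finite_range _

theorem ncard_dualVertices (x : AffineVertex d) : (dualVertices x).ncard = d + 1 := by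
  rw [dualVertices_eq_range, ← Set.image_univ, Set.ncard_image_of_injective _ (vert_injective x),
    Set.ncard_univ, Nat.card_zmod]

/-- In the tile at `x.vert r`, the coordinate of residue `r` has the least possible value and that
of residue `r - 1` the greatest. -/
theorem le_of_vert_mem {x y : AffineVertex d} {r : ZMod (d + 1)} (h : x.vert r ∈ dualVertices y) :
    x.coord (x.pos r) ≤ y.coord (x.pos r) ∧
      y.coord (x.pos (r - 1)) ≤ x.coord (x.pos (r - 1)) := by
  obtain ⟨-, σ, hσ⟩ := h
  constructor
  · have h1 := vert_pos x r
    have h2 := hσ (x.pos r)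
    have h3 : (0 : ℝ) ≤ ((σ (x.pos r) : ℕ) : ℝ) := by positivity
    have h4 : (x.coord (x.pos r) : ℝ) ≤ y.coord (x.pos r) := by linarith
    exact_mod_cast h4
  · have h1 := vert_pos_pred x r
    have h2 := hσ (x.pos (r - 1))
    have h3 : ((σ (x.pos (r - 1)) : ℕ) : ℝ) ≤ d := by
      exact_mod_cast Nat.lt_succ_iff.1 (σ (x.pos (r - 1))).2
    have h4 : (y.coord (x.pos (r - 1)) : ℝ) ≤ x.coord (x.pos (r - 1)) := by linarith
    exact_mod_cast h4

/-- Each vertex gives one coordinatewise inequality; the coordinate sums agree, so all are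
equalities. -/
theorem eq_of_dualVertices_subset {x y : AffineVertex d} (h : dualVertices x ⊆ dualVertices y) :
    x = y := by
  have hle : ∀ i ∈ Finset.univ, x.coord i ≤ y.coord i := fun i _ => by
    have := (le_of_vert_mem (h (vert_mem x (x.pos.symm i)))).1
    rwa [Equiv.apply_symm_apply] at this
  have := (Finset.sum_eq_sum_iff_of_le hle).1 (x.sum_eq.trans y.sum_eq.symm)
  exact AffineVertex.ext (funext fun i => this i (Finset.mem_univ _))

/-- Distinct facets that share all vertices of the first but one are adjacent. -/
theorem eq_or_adj_of_vert_mem (hd : 2 ≤ d) {x y : AffineVertex d} {r₀ : ZMod (d + 1)}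
    (h : ∀ r ≠ r₀, x.vert r ∈ dualVertices y) : x = y ∨ (affineGraph d).Adj x y := by
  have h1 := zmod_one_ne_zero hd
  have hpred : r₀ - 1 ≠ r₀ := by simpa using h1
  -- The coordinate of residue `r` is bounded on one side by vertex `r` and on the other by vertex
  -- `r + 1`; it is fixed unless one of these is the missing vertex.
  have heq : ∀ r, r ≠ r₀ → r ≠ r₀ - 1 → y.coord (x.pos r) = x.coord (x.pos r) := by
    intro r hr hr'
    refine le_antisymm ?_ (le_of_vert_mem (h r hr)).1
    have := (le_of_vert_mem (h (r + 1) fun hc => hr' (eq_sub_of_add_eq hc))).2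
    rwa [add_sub_cancel_right] at this
  set t := y.coord (x.pos (r₀ - 1)) - x.coord (x.pos (r₀ - 1)) with ht
  have ht0 : 0 ≤ t := sub_nonneg.2 (le_of_vert_mem (h _ hpred)).1
  have hsum : y.coord (x.pos r₀) = x.coord (x.pos r₀) - t := by
    have hs : ∑ r, (y.coord (x.pos r) - x.coord (x.pos r)) = 0 := by
      rw [x.pos.sum_comp fun i => y.coord i - x.coord i, Finset.sum_sub_distrib, x.sum_eq, y.sum_eq,
        sub_self]
    rw [← Finset.sum_subset (Finset.subset_univ {r₀, r₀ - 1}), Finset.sum_pair hpred.symm] at hs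
    · rw [ht]; linarith
    · intro r _ hr
      simp only [Finset.mem_insert, Finset.mem_singleton, not_or] at hr
      rw [heq r hr.1 hr.2, sub_self]
  have htd : t ≤ d := by
    obtain ⟨hu, σ, hσ⟩ := h _ hpred
    have e1 := vert_pos x (r₀ - 1)
    have e2 := hσ (x.pos (r₀ - 1))
    have e3 : ((σ (x.pos (r₀ - 1)) : ℕ) : ℝ) ≤ d := by
      exact_mod_cast Nat.lt_succ_iff.1 (σ (x.pos (r₀ - 1))).2
    have e4 : (t : ℝ) ≤ d := by
      rw [ht]
      push_cast
      linarith
    exact_mod_cast e4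
  obtain ⟨n, hn⟩ := Int.eq_ofNat_of_zero_le ht0
  rw [hn] at ht hsum htd
  -- For 2 ≤ n ≤ d, the lowered coordinate would collide in `y` with the unchanged coordinate of
  -- residue r₀ - n.
  have hcases : n = 0 ∨ n = 1 := by
    by_contra! hcon
    have hnd : n < d + 1 := by omega
    have hn0 : (n : ZMod (d + 1)) ≠ 0 := by
      rw [Ne, ZMod.natCast_eq_zero_iff]
      exact fun hdvd => absurd (Nat.le_of_dvd (by omega) hdvd) (by omega)
    have hn1 : (n : ZMod (d + 1)) ≠ 1 := by
      intro hc
      have hc' : ((n - 1 : ℕ) : ZMod (d + 1)) = 0 := by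
        rw [Nat.cast_sub (by omega), hc]; simp
      rw [ZMod.natCast_eq_zero_iff] at hc'
      exact absurd (Nat.le_of_dvd (by omega) hc') (by omega)
    have hr1 : r₀ - n ≠ r₀ := by simpa using hn0
    have hr2 : r₀ - n ≠ r₀ - 1 := by simpa using hn1
    apply hr1
    apply x.pos.injective
    apply y.residues_bijective.1
    simp only
    rw [heq _ hr1 hr2, hsum, x.coord_pos]
    push_cast
    rw [x.coord_pos]
  have hy : y.coord = x.coord + (n : ℤ) • (Pi.single (x.pos (r₀ - 1)) 1 - Pi.single (x.pos r₀) 1) := by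
    funext i
    obtain ⟨r, rfl⟩ := x.pos.surjective i
    by_cases hr : r = r₀
    · subst hr
      simp [hsum, hpred.symm]
      ring
    · by_cases hr' : r = r₀ - 1
      · subst hr'
        simp [hpred]
        linarith
      · simp [heq r hr hr', hr, hr']
  rcases hcases with rfl | rfl
  · left
    exact AffineVertex.ext (by simp [hy])
  · right
    exact ⟨x.pos r₀, x.pos (r₀ - 1), x.pos.injective.ne hpred.symm, by simp [hy]⟩

theorem zmod_val_add_one {a : ZMod (d + 1)} (h : a + 1 ≠ 0) : (a + 1).val = a.val + 1 := by
  have h1 : a.val + 1 < d + 1 := by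
    have := ZMod.val_lt a
    by_contra hcon
    apply h
    have h2 : a.val = d := by omega
    rw [← ZMod.natCast_zmod_val a, h2]
    exact_mod_cast ZMod.natCast_self (d + 1)
  conv_lhs => rw [← ZMod.natCast_zmod_val a]
  exact_mod_cast ZMod.val_natCast_of_lt h1

/-- Seen from vertex `r`, the residues s and s+1 occupy consecutive places of the tile, and
exchanging them stays inside it. Only at vertex s+1 are they the last and the first place. -/
theorem vert_move (x : AffineVertex d) {r s : ZMod (d + 1)} (h : r ≠ s + 1) :
    (x.move s).vert r = x.vert r := by
  funext i
  obtain ⟨t, rfl⟩ := x.pos.surjective i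
  rw [AffineVertex.vert, AffineVertex.vert]
  congr 1
  have hs : (((s + 1) - r).val : ℝ) = ((s - r).val : ℝ) + 1 := by
    have : s + 1 - r = (s - r) + 1 := by ring
    rw [this, zmod_val_add_one (by rw [← this]; exact sub_ne_zero.2 h.symm)]
    push_cast
    rfl
  have h1 := (x.move s).coord_pos (Equiv.swap s (s + 1) t)
  rw [← pos_eq_pos_move] at h1
  rw [h1, coord_move_pos, x.coord_pos, labelShift, Equiv.swap_apply_def]
  by_cases h2 : t = s
  · subst h2
    by_cases h3 : t = t + 1
    · rw [← h3] at hs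
      linarith
    · simp only [if_true, if_neg h3]
      push_cast
      linarith
  · by_cases h3 : t = s + 1
    · subst h3
      simp only [if_neg h2, if_true]
      push_cast
      linarith
    · simp [h2, h3]

/-- An integer whose product with d+1 is at most 2d in absolute value is at most 1 in absolute
value. With `eq_zero_of_abs_sub_le_two` this shows that lattice translations do not identify
vertices of a facet. -/
theorem abs_sub_le_one_of_mem {x : AffineVertex d} {u v : Fin (d + 1) → ℝ}
    (hu : u ∈ dualVertices x) (hv : v ∈ dualVertices x) (i j : Fin (d + 1)) :
    |(u - v) i - (u - v) j| ≤ 1 := by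
  obtain ⟨hu, σ, hσ⟩ := hu
  obtain ⟨hv, τ, hτ⟩ := hv
  obtain ⟨m, hm⟩ := hu.2 j i
  obtain ⟨n, hn⟩ := hv.2 j i
  have hb : ∀ (ρ : Equiv.Perm (Fin (d + 1))) l, (0 : ℝ) ≤ ((ρ l : ℕ) : ℝ) ∧ ((ρ l : ℕ) : ℝ) ≤ d :=
    fun ρ l => ⟨by positivity, by exact_mod_cast Nat.lt_succ_iff.1 (ρ l).2⟩
  have h1 : (u - v) i - (u - v) j = ((m - n : ℤ) : ℝ) := by
    push_cast
    rw [← hm, ← hn]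
    simp only [Pi.sub_apply]
    ring
  have h2 : ((d : ℝ) + 1) * ((m - n : ℤ) : ℝ) = ((τ i : ℕ) - (σ i : ℕ)) - ((τ j : ℕ) - (σ j : ℕ)) := by
    rw [← h1]
    simp only [Pi.sub_apply]
    linarith [hσ i, hσ j, hτ i, hτ j]
  have h3 := hb σ i
  have h4 := hb σ j
  have h5 := hb τ i
  have h6 := hb τ j
  have hd : (0 : ℝ) < d + 1 := by positivity
  have h7 : ((m - n : ℤ) : ℝ) < 2 := by
    by_contra hcon
    have := mul_le_mul_of_nonneg_left (not_lt.1 hcon) hd.le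
    linarith
  have h8 : (-2 : ℝ) < ((m - n : ℤ) : ℝ) := by
    by_contra hcon
    have := mul_le_mul_of_nonneg_left (not_lt.1 hcon) hd.le
    linarith
  have h7' : m - n < 2 := by exact_mod_cast h7
  have h8' : -2 < m - n := by exact_mod_cast h8
  rw [h1, abs_le]
  constructor
  · exact_mod_cast (by omega : -1 ≤ m - n)
  · exact_mod_cast (by omega : m - n ≤ 1)

/-! ### Faces are nonempty and lie in facets -/

theorem affineFace_nonempty (F : AffineFace d) : F.verts.Nonempty := by
  obtain ⟨p, -, hF⟩ := F.isFace
  rw [hF]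
  -- Rounding down preserves all inequalities n ≤ p j - p i with integral n; the subtracted mean
  -- restores the sum zero.
  refine ⟨fun i => (⌊p i⌋ : ℝ) - (∑ j, (⌊p j⌋ : ℝ)) / (d + 1), ⟨?_, fun i j => ?_⟩, ?_, ?_⟩
  · have hd : (d : ℝ) + 1 ≠ 0 := by positivity
    rw [Finset.sum_sub_distrib]
    simp only [Finset.sum_const, Finset.card_univ, Fintype.card_fin, nsmul_eq_mul]
    push_cast
    rw [mul_div_cancel₀ _ hd, sub_self]
  · exact ⟨⌊p j⌋ - ⌊p i⌋, by push_cast; ring⟩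
  · have hd : (d : ℝ) + 1 ≠ 0 := by positivity
    rw [Finset.sum_sub_distrib]
    simp only [Finset.sum_const, Finset.card_univ, Fintype.card_fin, nsmul_eq_mul]
    push_cast
    rw [mul_div_cancel₀ _ hd, sub_self]
  · intro i j n hn
    have h1 : n + ⌊p i⌋ ≤ ⌊p j⌋ := by
      rw [Int.le_floor]
      push_cast
      linarith [Int.floor_le (p i)]
    have h2 : (n : ℝ) + ⌊p i⌋ ≤ ⌊p j⌋ := by exact_mod_cast h1
    linarith

theorem exists_dualVertices_superset (F : AffineFace d) : ∃ x, F.verts ⊆ dualVertices x := by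
  obtain ⟨p, -, hF⟩ := F.isFace
  let f : Fin (d + 1) → ℝ := fun i => Int.fract (p i)
  -- The ranks of the fractional parts of `p`, ties broken arbitrarily, select a facet containing
  -- the cell.
  let σ : Equiv.Perm (Fin (d + 1)) := (Tuple.sort f).symm
  have hσ : ∀ i j, σ i ≤ σ j → f i ≤ f j := fun i j hij => by
    have := Tuple.monotone_sort f hij
    simpa [σ] using this
  let x : AffineVertex d :=
    { coord := fun i => ((d : ℤ) + 1) * ⌊p i⌋ + ((σ i : ℕ) + 1) - ∑ j, ⌊p j⌋
      sum_eq := by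
        rw [Finset.sum_sub_distrib, Finset.sum_add_distrib,
          Equiv.sum_comp σ fun i : Fin (d + 1) => (((i : ℕ) : ℤ) + 1), ← Finset.mul_sum]
        simp
      residues := fun r => by
        have hz : ((d : ZMod (d + 1)) + 1) = 0 := by exact_mod_cast ZMod.natCast_self (d + 1)
        let t : ZMod (d + 1) := r - 1 + ∑ j, ((⌊p j⌋ : ℤ) : ZMod (d + 1))
        refine ⟨σ.symm ⟨t.val, ZMod.val_lt t⟩, ?_⟩
        simp [hz, t]
        ring }
  refine ⟨x, fun u hu => ?_⟩
  rw [hF] at hu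
  rw [mem_dualVertices_iff]
  refine eq_vert_of_bounds x hu.1 fun i j => ?_
  have hx : ∀ i, (x.coord i : ℝ) =
      ((d : ℝ) + 1) * ⌊p i⌋ + (((σ i : ℕ) : ℝ) + 1) - ∑ j, (⌊p j⌋ : ℝ) := fun i => by
    simp [x]
  rw [hx, hx]
  have hfl : ∀ i, p i = ⌊p i⌋ + f i := fun i => (Int.floor_add_fract (p i)).symm
  have hf0 : ∀ i, 0 ≤ f i := fun i => Int.fract_nonneg _
  have hf1 : ∀ i, f i < 1 := fun i => Int.fract_lt_one _
  have hd : (0 : ℝ) ≤ d + 1 := by positivity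
  have hj : ((σ j : ℕ) : ℝ) ≤ d := by exact_mod_cast Nat.lt_succ_iff.1 (σ j).2
  have hi : (0 : ℝ) ≤ ((σ i : ℕ) : ℝ) := by positivity
  rcases le_or_gt (σ i) (σ j) with hij | hij
  · have h1 := hu.2.2 i j (⌊p j⌋ - ⌊p i⌋) (by
      push_cast
      linarith [hfl i, hfl j, hσ i j hij])
    push_cast at h1
    have := mul_le_mul_of_nonneg_left h1 hd
    linarith
  · have h1 := hu.2.2 i j (⌊p j⌋ - ⌊p i⌋ - 1) (by
      push_cast
      linarith [hfl i, hfl j, hf0 j, hf1 i])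
    push_cast at h1
    have h2 := mul_le_mul_of_nonneg_left h1 hd
    have h3 : ((σ j : ℕ) : ℝ) + 1 ≤ ((σ i : ℕ) : ℝ) := by exact_mod_cast hij
    linarith

/-- A vertex of the affine Coxeter complex as a face. -/
def pointFace (v : Fin (d + 1) → ℝ) (hv : v ∈ affineLattice d) : AffineFace d where
  verts := {v}
  isFace := by
    refine ⟨v, hv.1, ?_⟩
    ext u
    rw [Set.mem_singleton_iff]
    constructor
    · rintro rfl
      exact ⟨hv, hv.1, fun _ _ _ h => h⟩
    · rintro ⟨-, hsum, hcell⟩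
      have hle : ∀ i j, v j - v i ≤ u j - u i := fun i j => by
        obtain ⟨n, hn⟩ := hv.2 i j
        rw [hn]
        exact hcell i j n hn.ge
      have hconst : ∀ i, u i - v i = u 0 - v 0 := fun i => by linarith [hle i 0, hle 0 i]
      have h0 : ∑ i, (u i - v i) = 0 := by rw [Finset.sum_sub_distrib, hsum, hv.1, sub_self]
      rw [Finset.sum_congr rfl fun i _ => hconst i] at h0
      have hd : (d : ℝ) + 1 ≠ 0 := by positivity
      have h1 : u 0 - v 0 = 0 := by
        simp only [Finset.sum_const, Finset.card_univ, Fintype.card_fin, nsmul_eq_mul] at h0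
        push_cast at h0
        exact (mul_eq_zero.1 h0).resolve_left hd
      funext i
      linarith [hconst i]

/-! ### Symmetries of the affine Coxeter complex -/

/-- A bijection of the ambient space that respects the cells. -/
structure IsCellMap (A : (Fin (d + 1) → ℝ) ≃ (Fin (d + 1) → ℝ)) : Prop where
  sum_eq_zero : ∀ p, ∑ i, A p i = 0 ↔ ∑ i, p i = 0
  mem_lattice : ∀ p, A p ∈ affineLattice d ↔ p ∈ affineLattice d
  mem_cell : ∀ p q, A q ∈ closedCell (A p) ↔ q ∈ closedCell p

theorem IsCellMap.symm {A : (Fin (d + 1) → ℝ) ≃ (Fin (d + 1) → ℝ)} (h : IsCellMap A) :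
    IsCellMap A.symm :=
  ⟨fun p => by rw [← h.sum_eq_zero, A.apply_symm_apply],
    fun p => by rw [← h.mem_lattice, A.apply_symm_apply],
    fun p q => by rw [← h.mem_cell, A.apply_symm_apply, A.apply_symm_apply]⟩

/-- The image of a face under a cell map. -/
def mapFace {A : (Fin (d + 1) → ℝ) ≃ (Fin (d + 1) → ℝ)} (h : IsCellMap A) (F : AffineFace d) :
    AffineFace d where
  verts := A '' F.verts
  isFace := by
    obtain ⟨p, hp, hF⟩ := F.isFace
    refine ⟨A p, (h.sum_eq_zero p).2 hp, ?_⟩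
    ext u
    rw [Equiv.image_eq_preimage_symm, Set.mem_preimage, hF, Set.mem_inter_iff, Set.mem_inter_iff,
      ← h.mem_lattice, ← h.mem_cell, A.apply_symm_apply]

theorem isCellMap_add {t : Fin (d + 1) → ℝ} (ht : t ∈ affineLattice d) :
    IsCellMap (Equiv.addRight t) where
  sum_eq_zero p := by simp [Finset.sum_add_distrib, ht.1]
  mem_lattice p := by
    refine ⟨fun h => ?_, fun h => affineLattice_add h ht⟩
    refine ⟨by simpa [Finset.sum_add_distrib, ht.1] using h.1, fun i j => ?_⟩
    obtain ⟨m, hm⟩ := h.2 i j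
    obtain ⟨n, hn⟩ := ht.2 i j
    simp only [Equiv.coe_addRight, Pi.add_apply] at hm
    exact ⟨m - n, by push_cast; linarith⟩
  mem_cell p q := by
    refine and_congr (by simp [Finset.sum_add_distrib, ht.1]) (forall₂_congr fun i j => ?_)
    obtain ⟨m, hm⟩ := ht.2 i j
    have e1 : ∀ q : Fin (d + 1) → ℝ, (Equiv.addRight t) q j - (Equiv.addRight t) q i =
        q j - q i + m := fun q => by
      simp only [Equiv.coe_addRight, Pi.add_apply]
      rw [← hm]
      ring
    simp only [e1]
    constructor
    · intro h n hn
      have := h (n + m) (by push_cast; linarith)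
      push_cast at this
      linarith
    · intro h n hn
      have := h (n - m) (by push_cast; linarith)
      push_cast at this
      linarith

theorem isCellMap_neg : IsCellMap (Equiv.neg (Fin (d + 1) → ℝ)) where
  sum_eq_zero p := by simp
  mem_lattice p := by
    refine and_congr (by simp) ⟨fun h i j => ?_, fun h i j => ?_⟩
    · obtain ⟨n, hn⟩ := h i j
      simp only [Equiv.neg_apply, Pi.neg_apply] at hn
      exact ⟨-n, by push_cast; linarith⟩
    · obtain ⟨n, hn⟩ := h i j
      simp only [Equiv.neg_apply, Pi.neg_apply]
      exact ⟨-n, by push_cast; linarith⟩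
  mem_cell p q := by
    refine and_congr (by simp) ⟨fun h i j n hn => ?_, fun h i j n hn => ?_⟩
    · have := h j i n (by simp only [Equiv.neg_apply, Pi.neg_apply]; linarith)
      simp only [Equiv.neg_apply, Pi.neg_apply] at this
      linarith
    · simp only [Equiv.neg_apply, Pi.neg_apply] at hn ⊢
      have := h j i n (by linarith)
      linarith

/-- The cyclic shift of coordinates. -/
def shiftEquiv (d : ℕ) : (Fin (d + 1) → ℝ) ≃ (Fin (d + 1) → ℝ) :=
  (Equiv.addRight (1 : Fin (d + 1))).arrowCongr (Equiv.refl ℝ)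

theorem shiftEquiv_apply (p : Fin (d + 1) → ℝ) (i : Fin (d + 1)) :
    shiftEquiv d p i = p (i - 1) := by
  simp [shiftEquiv, Equiv.arrowCongr, sub_eq_add_neg]

theorem shiftEquiv_symm_apply (p : Fin (d + 1) → ℝ) (i : Fin (d + 1)) :
    (shiftEquiv d).symm p i = p (i + 1) := by
  simp [shiftEquiv, Equiv.arrowCongr]

theorem isCellMap_shift : IsCellMap (shiftEquiv d) := by
  have hsum : ∀ p : Fin (d + 1) → ℝ, ∑ i, shiftEquiv d p i = ∑ i, p i := fun p => by
    simp only [shiftEquiv_apply]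
    exact Equiv.sum_comp (Equiv.subRight (1 : Fin (d + 1))) p
  refine ⟨fun p => by rw [hsum], fun p => and_congr (by rw [hsum]) ?_,
    fun p q => and_congr (by rw [hsum]) ?_⟩
  · simp only [shiftEquiv_apply]
    exact ⟨fun h i j => by simpa using h (i + 1) (j + 1), fun h i j => h _ _⟩
  · simp only [shiftEquiv_apply]
    exact ⟨fun h i j => by simpa using h (i + 1) (j + 1), fun h i j => h _ _⟩

end Faces


/-! ### The torus -/

section Torus

variable {d k : ℕ}

theorem mem_sublatticeTilde_iff {v : Fin (d + 1) → ℝ} :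
    v ∈ sublatticeTilde (d := d) (fun _ => k) ↔
      ∃ u ∈ sublattice (d := d) (fun _ => k), v = fun j => (u j : ℝ) / (d + 1) := by
  constructor
  · rintro ⟨b, rfl⟩
    refine ⟨_, ⟨b, rfl⟩, ?_⟩
    funext j
    simp [wTilde, Finset.sum_apply, Finset.sum_div, mul_div_assoc]
  · rintro ⟨u, hu, rfl⟩
    exact scaled_mem_sublatticeTilde hu

/-- Nonzero translations of the torus move some coordinate difference by more than two. -/
theorem eq_zero_of_abs_sub_le_two (hk : 1 ≤ k) {v : Fin (d + 1) → ℝ}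
    (hv : v ∈ sublatticeTilde (d := d) fun _ => k) (h : ∀ i j, |v i - v j| ≤ 2) : v = 0 := by
  obtain ⟨u, hu, rfl⟩ := mem_sublatticeTilde_iff.1 hv
  obtain ⟨a, rfl, ha⟩ := (mem_sublattice_iff hk).1 hu
  have hd : (d : ℝ) + 1 ≠ 0 := by positivity
  have hconst := const_of_abs_sub_le_two hk ha fun i j => by
    have h1 := h i j
    have h2 : ((wSum a i : ℤ) : ℝ) / (d + 1) - ((wSum a j : ℤ) : ℝ) / (d + 1) =
        ((a i - a j : ℤ) : ℝ) := by
      simp only [wSum]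
      push_cast
      field_simp
      ring
    rw [h2] at h1
    exact_mod_cast h1
  rw [wSum_eq_zero_iff.2 hconst]
  funext j
  simp

theorem dualVertices_add {x y : AffineVertex d} {t : Fin (d + 1) → ℝ} (ht : t ∈ affineLattice d)
    (h : ∀ i, (y.coord i : ℝ) = x.coord i + (d + 1) * t i) {u : Fin (d + 1) → ℝ}
    (hu : u ∈ dualVertices x) : u + t ∈ dualVertices y := by
  obtain ⟨hu, σ, hσ⟩ := hu
  refine ⟨affineLattice_add hu ht, σ, fun i => ?_⟩
  rw [h, hσ, Pi.add_apply]
  ring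

theorem affineLattice_neg {u : Fin (d + 1) → ℝ} (hu : u ∈ affineLattice d) :
    -u ∈ affineLattice d := by
  refine ⟨by simp [hu.1], fun i j => ?_⟩
  obtain ⟨n, hn⟩ := hu.2 i j
  exact ⟨-n, by simp only [Pi.neg_apply]; push_cast; linarith⟩

/-- The translate of an affine vertex that is dual to a translated facet. -/
theorem exists_translate (y : AffineVertex d) {t : Fin (d + 1) → ℝ} (hk : 1 ≤ k)
    (ht : t ∈ sublatticeTilde (d := d) fun _ => k) :
    ∃ y' : AffineVertex d, proj k y' = proj k y ∧ ∀ u, u ∈ dualVertices y' ↔ u + t ∈ dualVertices y := by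
  obtain ⟨v, hv, rfl⟩ := mem_sublatticeTilde_iff.1 ht
  obtain ⟨a, ha, -⟩ := (mem_sublattice_iff hk).1 (neg_mem hv)
  obtain ⟨y', hy'⟩ := exists_coord_eq_add_wSum y a
  rw [← ha] at hy'
  have hd : (d : ℝ) + 1 ≠ 0 := by positivity
  have hl := sublatticeTilde_subset ht
  refine ⟨y', proj_eq_iff.2 ⟨v, hv, by rw [hy']; abel⟩, fun u => ⟨fun h => ?_, fun h => ?_⟩⟩
  · refine dualVertices_add hl (fun i => ?_) h
    rw [hy', Pi.add_apply, Pi.neg_apply, mul_div_cancel₀ _ hd]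
    push_cast
    ring
  · have := dualVertices_add (x := y) (y := y') (affineLattice_neg hl) (fun i => ?_) h
    · rwa [add_neg_cancel_right] at this
    · rw [hy', Pi.add_apply, Pi.neg_apply, Pi.neg_apply, mul_neg, mul_div_cancel₀ _ hd]
      push_cast
      ring

/-- The class of a face in the torus. -/
abbrev faceClass (k : ℕ) (F : AffineFace d) : TorusFace (d := d) fun _ => k :=
  Quotient.mk (faceSetoid fun _ => k) F

theorem faceClass_eq_iff {F G : AffineFace d} : faceClass k F = faceClass k G ↔
    ∃ v ∈ sublatticeTilde (d := d) (fun _ => k), G.verts = (fun x => x + v) '' F.verts :=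
  Quotient.eq

theorem faceClass_le_iff {F G : AffineFace d} : faceClass k F ≤ faceClass k G ↔
    ∃ v ∈ sublatticeTilde (d := d) (fun _ => k), ∀ u ∈ F.verts, u + v ∈ G.verts := by
  constructor
  · rintro ⟨F', G', hF, hG, hFG⟩
    obtain ⟨v, hv, h1⟩ := faceClass_eq_iff.1 hF
    obtain ⟨v', hv', h2⟩ := faceClass_eq_iff.1 hG.symm
    refine ⟨v + v', add_mem hv hv', fun u hu => ?_⟩
    rw [h2, ← add_assoc]
    exact ⟨u + v, hFG (by rw [h1]; exact ⟨u, hu, rfl⟩), rfl⟩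
  · rintro ⟨v, hv, h⟩
    refine ⟨mapFace (isCellMap_add (sublatticeTilde_subset hv)) F, G,
      faceClass_eq_iff.2 ⟨v, hv, rfl⟩, rfl, ?_⟩
    rintro _ ⟨u, hu, rfl⟩
    exact h u hu

theorem torusFacet_proj (x : AffineVertex d) :
    torusFacet (fun _ => k) (proj k x) = faceClass k (dualFacet x) := rfl

theorem torusFacet_injective (hk : 1 ≤ k) :
    Function.Injective (torusFacet (d := d) fun _ => k) := by
  intro a b h
  obtain ⟨x, rfl⟩ := Quotient.exists_rep a
  obtain ⟨y, rfl⟩ := Quotient.exists_rep b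
  obtain ⟨v, hv, hxy⟩ := faceClass_eq_iff.1 h
  obtain ⟨y', hy', hmem⟩ := exists_translate y hk hv
  have : x = y' := eq_of_dualVertices_subset fun u hu => by
    rw [hmem]
    change u + v ∈ (dualFacet y).verts
    rw [hxy]
    exact ⟨u, hu, rfl⟩
  rw [← this] at hy'
  exact hy'

theorem exists_le_torusFacet (ρ : TorusFace (d := d) fun _ => k) :
    ∃ a, ρ ≤ torusFacet (fun _ => k) a := by
  obtain ⟨F, rfl⟩ := Quotient.exists_rep ρ
  obtain ⟨x, hx⟩ := exists_dualVertices_superset F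
  exact ⟨proj k x, F, dualFacet x, rfl, rfl, hx⟩

/-- Any face lies in a facet, which has only d+1 vertices. So facets are exactly the maximal faces
and are permuted by order automorphisms. -/
theorem eq_of_torusFacet_le {a : HeawoodVertex (d := d) fun _ => k}
    {ρ : TorusFace (d := d) fun _ => k} (h : torusFacet (fun _ => k) a ≤ ρ) :
    torusFacet (fun _ => k) a = ρ := by
  obtain ⟨x, rfl⟩ := Quotient.exists_rep a
  obtain ⟨G, rfl⟩ := Quotient.exists_rep ρ
  obtain ⟨v, hv, hxG⟩ := faceClass_le_iff.1 h
  obtain ⟨y, hy⟩ := exists_dualVertices_superset G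
  refine faceClass_eq_iff.2 ⟨v, hv, ?_⟩
  have hsub : (fun u => u + v) '' dualVertices x ⊆ G.verts := by
    rintro _ ⟨u, hu, rfl⟩
    exact hxG u hu
  refine (Set.eq_of_subset_of_ncard_le hsub ?_ ((finite_dualVertices y).subset hy)).symm
  rw [Set.ncard_image_of_injective _ (add_left_injective v), ncard_dualVertices]
  exact (Set.ncard_le_ncard hy (finite_dualVertices y)).trans (ncard_dualVertices y).le

/-- The class of a vertex of the affine Coxeter complex. -/
def IsPoint (ρ : TorusFace (d := d) fun _ => k) : Prop :=
  ∃ v, ∃ hv : v ∈ affineLattice d, ρ = faceClass k (pointFace v hv)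

theorem pointFace_le_iff {v : Fin (d + 1) → ℝ} {hv : v ∈ affineLattice d} {F : AffineFace d} :
    faceClass k (pointFace v hv) ≤ faceClass k F ↔
      ∃ t ∈ sublatticeTilde (d := d) (fun _ => k), v + t ∈ F.verts := by
  rw [faceClass_le_iff]
  refine exists_congr fun t => and_congr_right fun _ => ⟨fun h => h v rfl, ?_⟩
  intro h u hu
  rw [show u = v from hu]
  exact h

theorem pointFace_eq {u v : Fin (d + 1) → ℝ} {hu : u ∈ affineLattice d} {hv : v ∈ affineLattice d}
    {t : Fin (d + 1) → ℝ} (ht : t ∈ sublatticeTilde (d := d) fun _ => k) (h : v = u + t) :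
    faceClass k (pointFace u hu) = faceClass k (pointFace v hv) :=
  faceClass_eq_iff.2 ⟨t, ht, by
    change {v} = (fun x => x + t) '' {u}
    rw [Set.image_singleton, h]⟩

/-- This order-theoretic description is what makes vertices invariant under automorphisms. -/
theorem isPoint_iff {ρ : TorusFace (d := d) fun _ => k} : IsPoint ρ ↔ ∀ ρ' ≤ ρ, ρ' = ρ := by
  constructor
  · rintro ⟨v, hv, rfl⟩ ρ' h
    obtain ⟨F, rfl⟩ := Quotient.exists_rep ρ'
    obtain ⟨t, ht, hF⟩ := faceClass_le_iff.1 h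
    refine faceClass_eq_iff.2 ⟨t, ht, ?_⟩
    obtain ⟨u, hu⟩ := affineFace_nonempty F
    apply Set.Subset.antisymm
    · intro z hz
      exact ⟨u, hu, (show u + t = v from hF u hu).trans (show z = v from hz).symm⟩
    · rintro _ ⟨u', hu', rfl⟩
      exact hF u' hu'
  · intro h
    obtain ⟨F, rfl⟩ := Quotient.exists_rep ρ
    obtain ⟨u, hu⟩ := affineFace_nonempty F
    obtain ⟨p, -, hF⟩ := F.isFace
    have hul : u ∈ affineLattice d := by
      rw [hF] at hu
      exact hu.1
    exact ⟨u, hul, (h _ (pointFace_le_iff.2 ⟨0, zero_mem _, by simpa using hu⟩)).symm⟩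

theorem IsPoint.map {ρ : TorusFace (d := d) fun _ => k} (τ : TorusAut (d := d) fun _ => k)
    (h : IsPoint ρ) : IsPoint (τ ρ) := by
  rw [isPoint_iff] at h ⊢
  intro ρ' hρ'
  have := h (τ.symm ρ') (by rw [← τ.le_iff_le, τ.apply_symm_apply]; exact hρ')
  rw [← this, τ.apply_symm_apply]

/-- The common vertices of two facets. -/
def commonPoints (a b : HeawoodVertex (d := d) fun _ => k) : Set (TorusFace (d := d) fun _ => k) :=
  {ρ | IsPoint ρ ∧ ρ ≤ torusFacet _ a ∧ ρ ≤ torusFacet _ b}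

/-- The class of a vertex of the facet dual to `x`. -/
noncomputable def vertClass (k : ℕ) (x : AffineVertex d) (r : ZMod (d + 1)) :
    TorusFace (d := d) fun _ => k :=
  faceClass k (pointFace (x.vert r) (vert_mem x r).1)

theorem vertClass_injective (hk : 1 ≤ k) (x : AffineVertex d) :
    Function.Injective (vertClass k x) := by
  intro r s h
  obtain ⟨t, ht, hrs⟩ := faceClass_eq_iff.1 h
  have hst : x.vert s = x.vert r + t := by simpa [pointFace] using hrs
  have ht' : t = x.vert s - x.vert r := by rw [hst]; abel
  have h0 : t = 0 := eq_zero_of_abs_sub_le_two hk ht fun i j => by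
    rw [ht']
    exact (abs_sub_le_one_of_mem (vert_mem x s) (vert_mem x r) i j).trans (by norm_num)
  rw [h0, add_zero] at hst
  exact (vert_injective x hst).symm

theorem commonPoints_subset (x : AffineVertex d) (b : HeawoodVertex (d := d) fun _ => k) :
    commonPoints (proj k x) b ⊆ Set.range (vertClass k x) := by
  rintro _ ⟨⟨v, hv, rfl⟩, h, -⟩
  obtain ⟨t, ht, hvt⟩ := pointFace_le_iff.1 h
  obtain ⟨r, hr⟩ := mem_dualVertices_iff.1 hvt
  exact ⟨r, (pointFace_eq ht hr.symm).symm⟩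

theorem vertClass_le (x : AffineVertex d) (r : ZMod (d + 1)) :
    vertClass k x r ≤ torusFacet _ (proj k x) :=
  pointFace_le_iff.2 ⟨0, zero_mem _, by rw [add_zero]; exact vert_mem x r⟩

/-- A move with label s keeps every vertex of the facet except the one labelled s+1. -/
theorem le_ncard_commonPoints (hd : 2 ≤ d) (hk : 1 ≤ k) {a b : HeawoodVertex (d := d) fun _ => k}
    (h : (heawoodGraph fun _ => k).Adj a b) : d ≤ (commonPoints a b).ncard := by
  obtain ⟨x, rfl⟩ := Quotient.exists_rep a
  obtain ⟨y, hxy, rfl⟩ := exists_adj_lift hk h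
  obtain ⟨s, rfl⟩ := (adj_iff_exists_move hd).1 hxy
  have hsub : vertClass k x '' {s + 1}ᶜ ⊆ commonPoints (proj k x) (proj k (x.move s)) := by
    rintro _ ⟨r, hr, rfl⟩
    refine ⟨⟨_, _, rfl⟩, vertClass_le x r, pointFace_le_iff.2 ⟨0, zero_mem _, ?_⟩⟩
    rw [add_zero, ← vert_move x hr]
    exact vert_mem _ r
  have hcard : (vertClass k x '' {s + 1}ᶜ).ncard = d := by
    rw [Set.ncard_image_of_injective _ (vertClass_injective hk x), Set.ncard_compl,
      Set.ncard_singleton, Nat.card_zmod]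
    rfl
  exact hcard.symm.le.trans <| Set.ncard_le_ncard hsub ((Set.finite_range _).subset (commonPoints_subset x _))

/-- The shared classes might come from different lattice translations. Two such translations differ
by a vector with coordinate differences at most 2, hence agree, so a single representative of `b`
shares d actual vertices with `x`. -/
theorem adj_of_le_ncard (hd : 2 ≤ d) (hk : 1 ≤ k) {a b : HeawoodVertex (d := d) fun _ => k}
    (hne : a ≠ b) (h : d ≤ (commonPoints a b).ncard) : (heawoodGraph fun _ => k).Adj a b := by
  obtain ⟨x, rfl⟩ := Quotient.exists_rep a
  obtain ⟨y, rfl⟩ := Quotient.exists_rep b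
  set S : Set (ZMod (d + 1)) := {r | vertClass k x r ≤ torusFacet _ (proj k y)} with hS
  have hsub : commonPoints (proj k x) (proj k y) ⊆ vertClass k x '' S := by
    intro ρ hρ
    obtain ⟨r, rfl⟩ := commonPoints_subset x _ hρ
    exact ⟨r, hρ.2.2, rfl⟩
  have hcard : d ≤ S.ncard := by
    refine h.trans ((Set.ncard_le_ncard hsub (Set.toFinite _)).trans ?_)
    exact Set.ncard_image_le (Set.toFinite _)
  have ht : ∀ r ∈ S, ∃ t ∈ sublatticeTilde (d := d) (fun _ => k), x.vert r + t ∈ dualVertices y :=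
    fun r hr => pointFace_le_iff.1 hr
  have hSne : S.Nonempty := Set.nonempty_of_ncard_ne_zero (by omega)
  obtain ⟨r₁, hr₁⟩ := hSne
  obtain ⟨t, htL, ht₁⟩ := ht r₁ hr₁
  have hall : ∀ r ∈ S, x.vert r + t ∈ dualVertices y := by
    intro r hr
    obtain ⟨t', htL', ht'⟩ := ht r hr
    have h0 : t' - t = 0 := eq_zero_of_abs_sub_le_two hk (sub_mem htL' htL) fun i j => by
      have e1 := abs_sub_le_one_of_mem ht' ht₁ i j
      have e2 := abs_sub_le_one_of_mem (vert_mem x r₁) (vert_mem x r) i j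
      simp only [Pi.sub_apply, Pi.add_apply] at e1 e2 ⊢
      rw [abs_le] at e1 e2 ⊢
      constructor <;> linarith
    rwa [← sub_eq_zero.1 h0]
  obtain ⟨y', hy', hmem⟩ := exists_translate y hk htL
  have hex : ∃ r₀, ∀ r ≠ r₀, r ∈ S := by
    have hc : Sᶜ.ncard ≤ 1 := by
      rw [Set.ncard_compl, Nat.card_zmod]
      omega
    rcases Set.eq_empty_or_nonempty Sᶜ with he | ⟨r₀, hr₀⟩
    · exact ⟨0, fun r _ => by
        by_contra hr
        exact (he ▸ hr : r ∈ (∅ : Set (ZMod (d + 1))))⟩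
    · refine ⟨r₀, fun r hr => ?_⟩
      by_contra hrS
      exact hr ((Set.ncard_le_one (Set.toFinite _)).1 hc r hrS r₀ hr₀)
  obtain ⟨r₀, hr₀⟩ := hex
  rcases eq_or_adj_of_vert_mem hd (x := x) (y := y') (r₀ := r₀)
    (fun r hr => (hmem _).2 (hall r (hr₀ r hr))) with rfl | hadj
  · exact (hne hy').elim
  · exact ⟨hne, x, y', hadj, rfl, hy'.symm⟩

/-! ### Compatible pairs of automorphisms -/

/-- `φ` describes the action of `τ` on facets. -/
def Compatible (τ : TorusAut (d := d) fun _ => k) (φ : GraphAut (d := d) fun _ => k) : Prop :=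
  ∀ a, torusFacet _ (φ a) = τ (torusFacet _ a)

theorem Compatible.one : Compatible (d := d) (k := k) 1 1 := fun _ => rfl

theorem Compatible.mul {τ τ' : TorusAut (d := d) fun _ => k} {φ φ' : GraphAut (d := d) fun _ => k}
    (h : Compatible τ φ) (h' : Compatible τ' φ') : Compatible (τ * τ') (φ * φ') := fun a => by
  rw [RelIso.mul_apply, RelIso.mul_apply, h, h']

theorem Compatible.pow {τ : TorusAut (d := d) fun _ => k} {φ : GraphAut (d := d) fun _ => k}
    (h : Compatible τ φ) (m : ℕ) : Compatible (τ ^ m) (φ ^ m) := by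
  induction m with
  | zero => exact Compatible.one
  | succ m ih => rw [pow_succ, pow_succ]; exact ih.mul h

theorem exists_torusFacet_eq (τ : TorusAut (d := d) fun _ => k)
    (a : HeawoodVertex (d := d) fun _ => k) : ∃ b, torusFacet _ b = τ (torusFacet _ a) := by
  obtain ⟨b, hb⟩ := exists_le_torusFacet (τ (torusFacet _ a))
  refine ⟨b, ?_⟩
  have h1 : torusFacet _ a ≤ τ.symm (torusFacet _ b) := by
    rw [← τ.le_iff_le, τ.apply_symm_apply]
    exact hb
  rw [eq_of_torusFacet_le h1, τ.apply_symm_apply]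

theorem exists_compatible_graphAut (hd : 2 ≤ d) (hk : 1 ≤ k) (τ : TorusAut (d := d) fun _ => k) :
    ∃ φ, Compatible τ φ := by
  choose f hf using exists_torusFacet_eq τ
  choose g hg using exists_torusFacet_eq τ.symm
  have hinj := torusFacet_injective (d := d) hk
  let e : (HeawoodVertex (d := d) fun _ => k) ≃ HeawoodVertex (d := d) fun _ => k :=
    { toFun := f
      invFun := g
      left_inv := fun a => hinj (by rw [hg, hf, τ.symm_apply_apply])
      right_inv := fun a => hinj (by rw [hf, hg, τ.apply_symm_apply]) }
  have hcommon : ∀ a b, commonPoints (f a) (f b) = τ '' commonPoints a b := by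
    intro a b
    ext ρ
    constructor
    · rintro ⟨h1, h2, h3⟩
      refine ⟨τ.symm ρ, ⟨h1.map τ.symm, ?_, ?_⟩, τ.apply_symm_apply ρ⟩
      · rw [← τ.le_iff_le, τ.apply_symm_apply, ← hf]; exact h2
      · rw [← τ.le_iff_le, τ.apply_symm_apply, ← hf]; exact h3
    · rintro ⟨ρ, ⟨h1, h2, h3⟩, rfl⟩
      refine ⟨h1.map τ, ?_, ?_⟩
      · rw [hf, τ.le_iff_le]; exact h2
      · rw [hf, τ.le_iff_le]; exact h3
  refine ⟨⟨e, fun {a b} => ?_⟩, hf⟩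
  have hiff : ∀ a b, (heawoodGraph (d := d) fun _ => k).Adj a b ↔
      a ≠ b ∧ d ≤ (commonPoints a b).ncard := fun a b =>
    ⟨fun h => ⟨h.ne, le_ncard_commonPoints hd hk h⟩, fun h => adj_of_le_ncard hd hk h.1 h.2⟩
  rw [hiff, hiff, e.injective.ne_iff]
  change _ ∧ d ≤ (commonPoints (f a) (f b)).ncard ↔ _
  rw [hcommon, Set.ncard_image_of_injective _ τ.injective]

/-- The reflection of `x` in a vertex of its dual facet. -/
theorem exists_opposite {x : AffineVertex d} {v : Fin (d + 1) → ℝ} (hv : v ∈ dualVertices x) :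
    ∃ x' : AffineVertex d, v ∈ dualVertices x' ∧
      ∀ u, u ∈ dualVertices x' → v + v - u ∈ dualVertices x := by
  obtain ⟨hvl, σ, hσ⟩ := hv
  -- The vector with entries `x.coord i - (σ i + 1)` is (d+1)v. Adding twice this vector to the
  -- reflected vertex gives the point reflection of `x` in the centre of the tile at v.
  have hsum : ∑ i, 2 * (x.coord i - ((σ i : ℕ) + 1)) = 0 := by
    rw [← Finset.mul_sum, Finset.sum_sub_distrib, x.sum_eq,
      Equiv.sum_comp σ fun i : Fin (d + 1) => (((i : ℕ) : ℤ) + 1), sub_self, mul_zero]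
  have hres : ∀ i, ((2 * (x.coord i - ((σ i : ℕ) + 1)) : ℤ) : ZMod (d + 1)) =
      ((2 * (x.coord 0 - ((σ 0 : ℕ) + 1)) : ℤ) : ZMod (d + 1)) := by
    intro i
    rw [ZMod.intCast_eq_intCast_iff_dvd_sub]
    obtain ⟨n, hn⟩ := hvl.2 i 0
    refine ⟨2 * n, ?_⟩
    have h1 : ((2 * (x.coord 0 - ((σ 0 : ℕ) + 1)) - 2 * (x.coord i - ((σ i : ℕ) + 1)) : ℤ) : ℝ) =
        ((((d + 1 : ℕ) : ℤ) * (2 * n) : ℤ) : ℝ) := by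
      push_cast
      rw [hσ, hσ, ← hn]
      ring
    exact_mod_cast h1
  have hcoord : ∀ i, (((affineReflection d x).shift _ _ hsum hres).coord i : ℤ) =
      (d : ℤ) + 2 - x.coord i + 2 * (x.coord i - ((σ i : ℕ) + 1)) := fun _ => rfl
  have hrev : ∀ (ρ : Equiv.Perm (Fin (d + 1))) i,
      (((ρ.trans Fin.revPerm) i : ℕ) : ℝ) = d - (ρ i : ℕ) := fun ρ i => by
    rw [Equiv.trans_apply, Fin.revPerm_apply, Fin.val_rev, Nat.cast_sub (by have := (ρ i).2; omega)]
    push_cast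
    ring
  refine ⟨(affineReflection d x).shift _ _ hsum hres, ⟨hvl, σ.trans Fin.revPerm, fun i => ?_⟩, ?_⟩
  · rw [hcoord, hrev]
    push_cast
    linarith [hσ i]
  rintro u ⟨hu, τ, hτ⟩
  refine ⟨?_, τ.trans Fin.revPerm, fun i => ?_⟩
  · rw [sub_eq_add_neg]
    exact affineLattice_add (affineLattice_add hvl hvl) (affineLattice_neg hu)
  · have h1 := hτ i
    rw [hcoord] at h1
    push_cast at h1
    rw [hrev]
    simp only [Pi.sub_apply, Pi.add_apply]
    linarith [hσ i]

/-- A vertex of a simplex is extremal: among the vertices of the facet, one coordinate attains its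
maximum only at `v`. -/
theorem eq_of_add_eq_add_self {x : AffineVertex d} {u u' v : Fin (d + 1) → ℝ}
    (hu : u ∈ dualVertices x) (hu' : u' ∈ dualVertices x) (hv : v ∈ dualVertices x)
    (h : u + u' = v + v) : u = v := by
  obtain ⟨r, rfl⟩ := mem_dualVertices_iff.1 hv
  obtain ⟨s, rfl⟩ := mem_dualVertices_iff.1 hu
  obtain ⟨s', rfl⟩ := mem_dualVertices_iff.1 hu'
  have h1 := congrFun h (x.pos r)
  simp only [Pi.add_apply] at h1
  have h2 := vert_pos x r
  have h3 := mul_vert x s (x.pos r)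
  have h4 := mul_vert x s' (x.pos r)
  have h5 : (0 : ℝ) ≤ (((x.coord (x.pos r) : ZMod (d + 1)) - s).val : ℝ) := by positivity
  have h6 : (0 : ℝ) ≤ (((x.coord (x.pos r) : ZMod (d + 1)) - s').val : ℝ) := by positivity
  have h7 : ((d : ℝ) + 1) * x.vert s (x.pos r) + ((d : ℝ) + 1) * x.vert s' (x.pos r) =
      2 * (((d : ℝ) + 1) * x.vert r (x.pos r)) := by
    rw [← mul_add, h1]; ring
  rw [eq_of_vert_pos (x := x) (r := r) (s := s) (by linarith)]

/-- The image of `v` lies in the fixed facets of `x` and of its reflection in `v`. The two lattice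
translations witnessing this coincide by shortness, and the two facets meet only in `v`. -/
theorem point_fixed (hk : 1 ≤ k) {τ : TorusAut (d := d) fun _ => k}
    (hτ : ∀ a, τ (torusFacet _ a) = torusFacet _ a) {v : Fin (d + 1) → ℝ}
    (hv : v ∈ affineLattice d) : τ (faceClass k (pointFace v hv)) = faceClass k (pointFace v hv) := by
  obtain ⟨x, hx⟩ := exists_dualVertices_superset (pointFace v hv)
  have hvx : v ∈ dualVertices x := hx rfl
  obtain ⟨x', hvx', hx'⟩ := exists_opposite hvx
  obtain ⟨u₀, hu₀, hu⟩ := IsPoint.map τ ⟨v, hv, rfl⟩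
  have hle : ∀ y, v ∈ dualVertices y →
      ∃ t ∈ sublatticeTilde (d := d) (fun _ => k), u₀ + t ∈ dualVertices y := fun y hy => by
    have h : τ (faceClass k (pointFace v hv)) ≤ torusFacet _ (proj k y) := by
      rw [← hτ, τ.le_iff_le]
      exact pointFace_le_iff.2 ⟨0, zero_mem _, by rw [add_zero]; exact hy⟩
    rw [hu] at h
    exact pointFace_le_iff.1 h
  obtain ⟨t, ht, htx⟩ := hle x hvx
  obtain ⟨t', ht', htx'⟩ := hle x' hvx'
  have hopp := hx' _ htx'
  have h0 : t' - t = 0 := eq_zero_of_abs_sub_le_two hk (sub_mem ht' ht) fun i j => by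
    have e1 := abs_sub_le_one_of_mem hvx hopp i j
    have e2 := abs_sub_le_one_of_mem hvx htx i j
    simp only [Pi.sub_apply, Pi.add_apply] at e1 e2 ⊢
    rw [abs_le] at e1 e2 ⊢
    constructor <;> linarith
  rw [sub_eq_zero.1 h0] at hopp
  have huv : u₀ + t = v := eq_of_add_eq_add_self htx hopp hvx (add_sub_cancel _ _)
  rw [hu]
  exact pointFace_eq ht huv.symm

/-- A face and its image lie in a common facet, whose vertices are fixed and pairwise inequivalent;
they therefore have the same vertices. -/
theorem eq_one_of_fixes_facets (hk : 1 ≤ k) {τ : TorusAut (d := d) fun _ => k}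
    (hτ : ∀ a, τ (torusFacet _ a) = torusFacet _ a) : τ = 1 := by
  ext ρ
  change τ ρ = ρ
  obtain ⟨F, rfl⟩ := Quotient.exists_rep ρ
  obtain ⟨x, hx⟩ := exists_dualVertices_superset F
  have hle : faceClass k F ≤ torusFacet _ (proj k x) := ⟨F, dualFacet x, rfl, rfl, hx⟩
  have hle' : τ (faceClass k F) ≤ torusFacet _ (proj k x) := by
    rw [← hτ, τ.le_iff_le]
    exact hle
  obtain ⟨G₀, hG₀⟩ := Quotient.exists_rep (τ (faceClass k F))
  rw [← hG₀] at hle'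
  obtain ⟨t, ht, hG₀t⟩ := faceClass_le_iff.1 hle'
  set G := mapFace (isCellMap_add (sublatticeTilde_subset ht)) G₀
  have hG : τ (faceClass k F) = faceClass k G :=
    hG₀.symm.trans (faceClass_eq_iff.2 ⟨t, ht, rfl⟩)
  have hGx : G.verts ⊆ dualVertices x := by
    rintro _ ⟨u, hu, rfl⟩
    exact hG₀t u hu
  have hmem : ∀ F' : AffineFace d, F'.verts ⊆ dualVertices x → ∀ u (hu : u ∈ dualVertices x),
      u ∈ F'.verts ↔ faceClass k (pointFace u hu.1) ≤ faceClass k F' := by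
    intro F' hF' u hu
    rw [pointFace_le_iff]
    refine ⟨fun h => ⟨0, zero_mem _, by rwa [add_zero]⟩, ?_⟩
    rintro ⟨t, ht, hut⟩
    have h0 : t = 0 := eq_zero_of_abs_sub_le_two hk ht fun i j => by
      have := abs_sub_le_one_of_mem (hF' hut) hu i j
      rw [add_sub_cancel_left] at this
      linarith
    rwa [h0, add_zero] at hut
  have hFG : F.verts = G.verts := by
    ext u
    by_cases hu : u ∈ dualVertices x
    · rw [hmem F hx u hu, hmem G hGx u hu, ← hG, ← point_fixed hk hτ hu.1, τ.le_iff_le,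
        point_fixed hk hτ hu.1]
    · exact ⟨fun h => (hu (hx h)).elim, fun h => (hu (hGx h)).elim⟩
  change τ (faceClass k F) = faceClass k F
  rw [hG, AffineFace.ext hFG]

/-- A map that respects the sublattice of the torus. -/
def RespectsSublattice (k : ℕ) (A : (Fin (d + 1) → ℝ) ≃ (Fin (d + 1) → ℝ)) : Prop :=
  ∀ v ∈ sublatticeTilde (d := d) (fun _ => k),
    ∃ v' ∈ sublatticeTilde (d := d) (fun _ => k), ∀ x, A (x + v) = A x + v'

theorem faceSetoid_mapFace {A : (Fin (d + 1) → ℝ) ≃ (Fin (d + 1) → ℝ)} (h : IsCellMap A)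
    (hA : RespectsSublattice k A) (F G : AffineFace d)
    (hFG : (faceSetoid (d := d) fun _ => k).r F G) :
    (faceSetoid fun _ => k).r (mapFace h F) (mapFace h G) := by
  obtain ⟨v, hvL, hFG⟩ := hFG
  obtain ⟨v', hv', hadd⟩ := hA v hvL
  refine ⟨v', hv', ?_⟩
  simp only [mapFace, hFG, Set.image_image, hadd]

/-- The map on the faces of the torus induced by a cell map. -/
def mapTorusFace {A : (Fin (d + 1) → ℝ) ≃ (Fin (d + 1) → ℝ)} (h : IsCellMap A)
    (hA : RespectsSublattice k A) :
    TorusFace (d := d) (fun _ => k) → TorusFace (d := d) fun _ => k :=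
  Quotient.map (mapFace h) (faceSetoid_mapFace h hA)

theorem mapTorusFace_mono {A : (Fin (d + 1) → ℝ) ≃ (Fin (d + 1) → ℝ)} (h : IsCellMap A)
    (hA : RespectsSublattice k A) {a b : TorusFace (d := d) fun _ => k} (hab : a ≤ b) :
    mapTorusFace h hA a ≤ mapTorusFace h hA b := by
  obtain ⟨F, G, rfl, rfl, hFG⟩ := hab
  exact ⟨mapFace h F, mapFace h G, rfl, rfl, Set.image_mono hFG⟩

theorem mapTorusFace_leftInverse {A B : (Fin (d + 1) → ℝ) ≃ (Fin (d + 1) → ℝ)} (h : IsCellMap A)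
    (hA : RespectsSublattice k A) (h' : IsCellMap B) (hB : RespectsSublattice k B)
    (hBA : Function.LeftInverse B A) :
    Function.LeftInverse (mapTorusFace h' hB) (mapTorusFace h hA) := by
  intro a
  obtain ⟨F, rfl⟩ := Quotient.exists_rep a
  exact congrArg (faceClass k) (AffineFace.ext (hBA.image_image F.verts))

/-- A cell map that respects the sublattice induces an automorphism of the torus. -/
def torusAutOfCellMap {A : (Fin (d + 1) → ℝ) ≃ (Fin (d + 1) → ℝ)} (h : IsCellMap A)
    (h1 : RespectsSublattice k A) (h2 : RespectsSublattice k A.symm) :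
    TorusAut (d := d) fun _ => k where
  toFun := mapTorusFace h h1
  invFun := mapTorusFace h.symm h2
  left_inv := mapTorusFace_leftInverse h h1 h.symm h2 A.symm_apply_apply
  right_inv := mapTorusFace_leftInverse h.symm h2 h h1 A.apply_symm_apply
  map_rel_iff' := by
    intro a b
    refine ⟨fun hab => ?_, fun hab => mapTorusFace_mono h h1 hab⟩
    have hl := mapTorusFace_leftInverse h h1 h.symm h2 A.symm_apply_apply
    rw [← hl a, ← hl b]
    exact mapTorusFace_mono h.symm h2 hab

theorem compatible_of_dualVertices {A : (Fin (d + 1) → ℝ) ≃ (Fin (d + 1) → ℝ)} (h : IsCellMap A)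
    (h1 : RespectsSublattice k A) (h2 : RespectsSublattice k A.symm)
    {φ : GraphAut (d := d) fun _ => k} (e : AffineVertex d → AffineVertex d)
    (hφ : ∀ x, φ (proj k x) = proj k (e x))
    (he : ∀ x, A '' dualVertices x ⊆ dualVertices (e x)) :
    Compatible (torusAutOfCellMap h h1 h2) φ := by
  intro a
  obtain ⟨x, rfl⟩ := Quotient.exists_rep a
  change torusFacet _ (φ (proj k x)) = faceClass k (mapFace h (dualFacet x))
  rw [hφ, torusFacet_proj]
  refine congrArg (faceClass k) (AffineFace.ext ?_).symm
  refine Set.eq_of_subset_of_ncard_le (he x) ?_ (finite_dualVertices _)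
  change _ ≤ (A '' dualVertices x).ncard
  rw [Set.ncard_image_of_injective _ A.injective, ncard_dualVertices]
  exact (ncard_dualVertices (e x)).le

/-! ### Torus automorphisms inducing the generators -/

theorem shiftEquiv_add (x v : Fin (d + 1) → ℝ) :
    shiftEquiv d (x + v) = shiftEquiv d x + shiftEquiv d v := by
  funext i
  simp only [shiftEquiv_apply, Pi.add_apply]

theorem wTilde_mem (d : ℕ) (i : Fin (d + 1)) : wTilde d i ∈ affineLattice d := by
  have hd : (d : ℝ) + 1 ≠ 0 := by positivity
  refine ⟨?_, fun a b => ⟨(if b = i then 1 else 0) - (if a = i then 1 else 0), ?_⟩⟩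
  · have h1 : ∑ j, w d i j = 0 := by simp [w_apply]
    simp only [wTilde]
    rw [← Finset.sum_div]
    have h2 := congrArg (Int.cast : ℤ → ℝ) h1
    push_cast at h2
    rw [h2, zero_div]
  · simp only [wTilde, w_apply]
    split_ifs <;> push_cast <;> field_simp <;> ring

theorem exists_compatible_translation : ∃ τ, Compatible τ (translation (d := d) (fun _ => k) 0) := by
  refine ⟨torusAutOfCellMap (isCellMap_add (wTilde_mem d 0)) ?_ ?_,
    compatible_of_dualVertices _ _ _ (affineTranslation d 0) (fun x => rfl) ?_⟩
  · intro v hv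
    exact ⟨v, hv, fun x => by simp only [Equiv.coe_addRight]; abel⟩
  · intro v hv
    exact ⟨v, hv, fun x => by simp only [Equiv.addRight_symm, Equiv.coe_addRight]; abel⟩
  · rintro x _ ⟨u, hu, rfl⟩
    refine dualVertices_add (wTilde_mem d 0) (fun i => ?_) hu
    have hd : (d : ℝ) + 1 ≠ 0 := by positivity
    have : (affineTranslation d 0 x).coord i = x.coord i + w d 0 i := rfl
    rw [this, wTilde, mul_div_cancel₀ _ hd]
    push_cast
    rfl

theorem exists_compatible_R : ∃ τ, Compatible τ (R (d := d) (fun _ => k)) := by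
  refine ⟨torusAutOfCellMap isCellMap_neg ?_ ?_,
    compatible_of_dualVertices _ _ _ (affineReflection d) (fun x => rfl) ?_⟩
  · intro v hv
    exact ⟨-v, neg_mem hv, fun x => neg_add x v⟩
  · intro v hv
    exact ⟨-v, neg_mem hv, fun x => neg_add x v⟩
  · rintro x _ ⟨u, ⟨hu, σ, hσ⟩, rfl⟩
    refine ⟨affineLattice_neg hu, σ.trans Fin.revPerm, fun i => ?_⟩
    rw [affineReflection_coord, Equiv.trans_apply, Fin.revPerm_apply, Fin.val_rev,
      Nat.cast_sub (by have := (σ i).2; omega)]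
    push_cast
    rw [hσ]
    simp only [Equiv.neg_apply, Pi.neg_apply]
    ring

theorem exists_compatible_C : ∃ τ, Compatible τ (C d k) := by
  refine ⟨torusAutOfCellMap isCellMap_shift ?_ ?_,
    compatible_of_dualVertices _ _ _ (affineRotation d) (fun x => rfl) ?_⟩
  · intro v hv
    refine ⟨shiftEquiv d v, ?_, fun x => shiftEquiv_add x v⟩
    obtain ⟨u, hu, rfl⟩ := mem_sublatticeTilde_iff.1 hv
    exact mem_sublatticeTilde_iff.2 ⟨_, sublattice_const_shift 1 hu, funext fun i => by
      rw [shiftEquiv_apply]⟩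
  · intro v hv
    refine ⟨(shiftEquiv d).symm v, ?_, fun x => ?_⟩
    · obtain ⟨u, hu, rfl⟩ := mem_sublatticeTilde_iff.1 hv
      exact mem_sublatticeTilde_iff.2 ⟨_, sublattice_const_shift (-1) hu, funext fun i => by
        rw [shiftEquiv_symm_apply, sub_neg_eq_add]⟩
    · funext i
      simp only [shiftEquiv_symm_apply, Pi.add_apply]
  · rintro x _ ⟨u, ⟨hu, σ, hσ⟩, rfl⟩
    refine ⟨(isCellMap_shift.mem_lattice u).2 hu, (Equiv.subRight 1).trans σ, fun i => ?_⟩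
    rw [shiftEquiv_apply]
    exact hσ (i - 1)

theorem exists_compatible_torusAut (hd : 2 ≤ d) (hk : 1 ≤ k) (hdk : ¬ (d = 2 ∧ k = 1))
    (φ : GraphAut (d := d) fun _ => k) : ∃ τ, Compatible τ φ := by
  obtain ⟨m, i, e, -, -, -, rfl⟩ := exists_normalForm hd hk hdk φ
  obtain ⟨τ₁, h₁⟩ := exists_compatible_translation (d := d) (k := k)
  obtain ⟨τ₂, h₂⟩ := exists_compatible_C (d := d) (k := k)
  obtain ⟨τ₃, h₃⟩ := exists_compatible_R (d := d) (k := k)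
  exact ⟨_, ((h₁.pow m).mul (h₂.pow i)).mul (h₃.pow e)⟩

theorem exists_mulEquiv (hd : 2 ≤ d) (hk : 1 ≤ k) (hdk : ¬ (d = 2 ∧ k = 1)) :
    ∃ Φ : TorusAut (d := d) (fun _ => k) ≃* GraphAut (d := d) (fun _ => k),
      ∀ τ, Compatible τ (Φ τ) := by
  choose f hf using exists_compatible_graphAut (d := d) hd hk
  -- Facets determine the graph automorphism, so the chosen assignment is automatically
  -- multiplicative.
  have huniq : ∀ {τ : TorusAut (d := d) fun _ => k} {φ φ' : GraphAut (d := d) fun _ => k},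
      Compatible τ φ → Compatible τ φ' → φ = φ' := fun h h' => by
    ext a
    exact torusFacet_injective hk ((h a).trans (h' a).symm)
  let F : TorusAut (d := d) (fun _ => k) →* GraphAut (d := d) (fun _ => k) :=
    MonoidHom.mk' f fun τ τ' => huniq (hf _) ((hf τ).mul (hf τ'))
  have hF : Function.Bijective F := by
    constructor
    · rw [injective_iff_map_eq_one]
      intro τ hτ
      refine eq_one_of_fixes_facets hk fun a => ?_
      have := hf τ a
      change f τ = 1 at hτ
      rw [hτ] at this
      exact this.symm
    · intro φ
      obtain ⟨τ, hτ⟩ := exists_compatible_torusAut hd hk hdk φ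
      exact ⟨τ, huniq (hf τ) hτ⟩
  exact ⟨MulEquiv.ofBijective F hF, hf⟩

end Torus

end Heawood

theorem mainTheorem9 (d k : ℕ) (hd : 2 ≤ d) (hk : 1 ≤ k) (hdk : ¬ (d = 2 ∧ k = 1)) :
    (∃ Φ : Heawood.TorusAut (d := d) (fun _ => k) ≃* Heawood.GraphAut (d := d) (fun _ => k),
      ∀ (τ : Heawood.TorusAut (d := d) (fun _ => k)) (a : Heawood.HeawoodVertex (d := d) (fun _ => k)),
        Heawood.torusFacet _ (Φ τ a) = τ (Heawood.torusFacet _ a)) ∧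
    Heawood.T (d := d) (fun _ => k) ⊔ Subgroup.zpowers (Heawood.R (d := d) (fun _ => k)) ⊔
      Subgroup.zpowers (Heawood.C d k) = ⊤ ∧
    (Nat.card (Heawood.GraphAut (d := d) (fun _ => k)) : ℤ) =
      2 * ((d : ℤ) + 1) * (Heawood.M (d := d) (fun _ => k)).det := by
  refine ⟨Heawood.exists_mulEquiv hd hk hdk, Heawood.sup_eq_top hd hk hdk, ?_⟩
  rw [Heawood.card_graphAut hd hk hdk, Heawood.det_M]
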